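/- An orthocomplemented bisemilattice (OCBSL) is a structure $(S,\land,\sqcup,\neg,0,1)$ satisfying $x\sqcup y=y\sqcup x$, $x\sqcup(y\sqcup z)=(x\sqcup y)\sqcup z$, $x\sqcup x=x$, $x\sqcup 1=1$, $x\sqcup 0=x$, $\neg\neg x=x$, $x\sqcup\neg x=1$, $\neg(x\sqcup y)=\neg x\land\neg y$ (laws L1–L8) and the dual laws L1'–L8' (obtained by exchanging $\sqcup$ with $\land$ and $0$ with $1$). Its word problem asks, given two terms $t_1,t_2$ with free variables over $(\land,\sqcup,\neg,0,1)$, whether $t_1=t_2$ is a consequence of these laws. Consider terms with free variables over $(\bigsqcup,\neg,0,1)$, where $\bigsqcup$ takes any positive number of arguments, taken modulo commutativity of $\bigsqcup$ (permutation of the arguments of any join), and the following rewrite rules, applied to arbitrary subterms ($\vec x,\vec y$ denote possibly empty lists of terms such that every join that occurs has at least one argument): - A2: $\bigsqcup(\vec x,\bigsqcup(\vec y))\to\bigsqcup(\vec x,\vec y)$ and $\bigsqcup(x)\to x$; - A3: $\bigsqcup(x,x,\vec y)\to\bigsqcup(x,\vec y)$; - A4: $\bigsqcup(1,\vec x)\to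 1$; - A5: $\bigsqcup(0,\vec x)\to\bigsqcup(\vec x)$; - A6: $\neg\neg x\to x$; - A7: $\bigsqcup(x,\neg x,\vec y)\to 1$; - A9: $\bigsqcup(\vec x,\vec y,\neg\bigsqcup(\vec y))\to 1$; - A10: $\neg 0\to 1$; - A11: $\neg 1\to 0$. Then: 1. Every term $t$ over $(\bigsqcup,\neg,0,1)$ has a normal form under these rules, and it is unique modulo commutativity. 2. For terms $t_1,t_2$ over $(\land,\sqcup,\neg,0,1)$, the equation $t_1=t_2$ is a consequence of L1–L8, L1'–L8' if and only if the terms obtained from $t_1$ and $t_2$ by the translation $x\sqcup y\mapsto\bigsqcup(x,y)$, $x\land y\mapsto\neg\bigsqcup(\neg x,\neg y)$ have the same normal form modulo commutativity. 3. There is an algorithm that computes the normal form modulo commutativity of any given term over $(\bigsqcup,\neg,0,1)$ in time $O(n\log^2 n)$, where $n$ is the size of the term. 4. There is an algorithm that decides the word problem for orthocomplemented bisemilattices in time $O(n\log^2 n)$, where $n$ is the total size of the two terms. Here the size of a term is the number of nodes of its syntax tree. An input term may be stored in memory as any rooted directed acyclic graph that unfolds to it (in particular, as a tree); $n$ remains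 the size of the unfolded term. Running time is the number of steps of a fixed program on a unit-cost random access machine with addition, truncated subtraction, multiplication, comparison and indirect addressing, with all its words bounded by a fixed polynomial in $n$ and the largest number occurring in the input (variable indices and addresses). -/

import Mathlib

/-! ### Orthocomplemented bisemilattices and their word problem -/

/-- Orthocomplemented bisemilattices: structures with two binary operations `⊔` (`join`) and
`∧` (`meet`), a unary operation `¬` (`compl`) and constants `0` (`bot`), `1` (`top`),
satisfying the laws L1-L8 and L1'-L8' (L6' is the same as L6).  No order, absorption or
distributivity is assumed. -/
class OCBSL (S : Type) where
  join : S → S → S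
  meet : S → S → S
  compl : S → S
  bot : S
  top : S
  join_comm : ∀ x y, join x y = join y x
  meet_comm : ∀ x y, meet x y = meet y x
  join_assoc : ∀ x y z, join x (join y z) = join (join x y) z
  meet_assoc : ∀ x y z, meet x (meet y z) = meet (meet x y) z
  join_idem : ∀ x, join x x = x
  meet_idem : ∀ x, meet x x = x
  join_top : ∀ x, join x top = top
  meet_bot : ∀ x, meet x bot = bot
  join_bot : ∀ x, join x bot = x
  meet_top : ∀ x, meet x top = x
  compl_compl : ∀ x, compl (compl x) = x
  join_compl : ∀ x, join x (compl x) = top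
  meet_compl : ∀ x, meet x (compl x) = bot
  compl_join : ∀ x y, compl (join x y) = meet (compl x) (compl y)
  compl_meet : ∀ x y, compl (meet x y) = join (compl x) (compl y)

/-- Terms with free variables over the signature `(∧, ⊔, ¬, 0, 1)`. -/
inductive BTerm : Type
  | var (v : ℕ)
  | zero
  | one
  | neg (t : BTerm)
  | join (s t : BTerm)
  | meet (s t : BTerm)

/-- The size (number of nodes of the syntax tree) of a term. -/
def BTerm.size : BTerm → ℕ
  | .var _ => 1
  | .zero => 1
  | .one => 1
  | .neg t => t.size + 1
  | .join s t => s.size + t.size + 1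
  | .meet s t => s.size + t.size + 1

/-- Value of a term in an orthocomplemented bisemilattice under a valuation. -/
def BTerm.eval {S : Type} [OCBSL S] (ρ : ℕ → S) : BTerm → S
  | .var v => ρ v
  | .zero => OCBSL.bot
  | .one => OCBSL.top
  | .neg t => OCBSL.compl (t.eval ρ)
  | .join s t => OCBSL.join (s.eval ρ) (t.eval ρ)
  | .meet s t => OCBSL.meet (s.eval ρ) (t.eval ρ)

/-- `s = t` is a consequence of the axioms L1-L8, L1'-L8': it holds in all their models, for all
values of the variables.  (Countable models suffice, by completeness of equational logic, so
models in `Type` are no restriction.) -/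
def OCBSLEq (s t : BTerm) : Prop :=
  ∀ (S : Type) [OCBSL S] (ρ : ℕ → S), s.eval ρ = t.eval ρ

/-! ### Terms over `(⨆, ¬, 0, 1)` and rewriting modulo commutativity -/

/-- Terms with free variables over `(⨆, ¬, 0, 1)`, where `⨆` takes any number of arguments. -/
inductive JTerm : Type
  | var (v : ℕ)
  | zero
  | one
  | neg (t : JTerm)
  | sup (l : List JTerm)

mutual
/-- The size (number of nodes of the syntax tree) of a term. -/
def JTerm.size : JTerm → ℕ
  | .var _ => 1
  | .zero => 1
  | .one => 1
  | .neg t => t.size + 1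
  | .sup l => JTerm.sizeList l + 1
/-- The sum of the sizes of the terms of a list. -/
def JTerm.sizeList : List JTerm → ℕ
  | [] => 0
  | t :: l => t.size + JTerm.sizeList l
end

/-- Every join occurring in the term has at least one argument. -/
inductive JTerm.Proper : JTerm → Prop
  | var (v : ℕ) : Proper (.var v)
  | zero : Proper .zero
  | one : Proper .one
  | neg {t : JTerm} : Proper t → Proper (.neg t)
  | sup {l : List JTerm} : l ≠ [] → (∀ t ∈ l, Proper t) → Proper (.sup l)

/-- Removal of `∧` by de Morgan's law `x ∧ y = ¬ ⨆(¬ x, ¬ y)`. -/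
def BTerm.toJTerm : BTerm → JTerm
  | .var v => .var v
  | .zero => .zero
  | .one => .one
  | .neg t => .neg t.toJTerm
  | .join s t => .sup [s.toJTerm, t.toJTerm]
  | .meet s t => .neg (.sup [.neg s.toJTerm, .neg t.toJTerm])

/-- Equality of terms modulo commutativity of `⨆` (rule A1): the congruence generated by
permuting the arguments of joins. -/
inductive CommEq : JTerm → JTerm → Prop
  | perm {l l' : List JTerm} : l.Perm l' → CommEq (.sup l) (.sup l')
  | neg {t u : JTerm} : CommEq t u → CommEq (.neg t) (.neg u)
  | sup {t u : JTerm} (l₁ l₂ : List JTerm) :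
      CommEq t u → CommEq (.sup (l₁ ++ t :: l₂)) (.sup (l₁ ++ u :: l₂))
  | refl (t : JTerm) : CommEq t t
  | symm {t u : JTerm} : CommEq t u → CommEq u t
  | trans {t u v : JTerm} : CommEq t u → CommEq u v → CommEq t v

/-- The rewrite rules A2-A7, A9, A10, A11, applied at the root.  In A5 at least one argument
must remain, since `⨆` is not applied to an empty list of arguments. -/
inductive Rule : JTerm → JTerm → Prop
  | A2 (x y : List JTerm) : Rule (.sup (x ++ [.sup y])) (.sup (x ++ y))
  | A2b (x : JTerm) : Rule (.sup [x]) x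
  | A3 (x : JTerm) (y : List JTerm) : Rule (.sup (x :: x :: y)) (.sup (x :: y))
  | A4 (x : List JTerm) : Rule (.sup (.one :: x)) .one
  | A5 (x : List JTerm) : x ≠ [] → Rule (.sup (.zero :: x)) (.sup x)
  | A6 (x : JTerm) : Rule (.neg (.neg x)) x
  | A7 (x : JTerm) (y : List JTerm) : Rule (.sup (x :: .neg x :: y)) .one
  | A9 (x y : List JTerm) : Rule (.sup (x ++ y ++ [.neg (.sup y)])) .one
  | A10 : Rule (.neg .zero) .one
  | A11 : Rule (.neg .one) .zero

/-- One application of a rule to a subterm. -/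
inductive Rewrite : JTerm → JTerm → Prop
  | root {t u : JTerm} : Rule t u → Rewrite t u
  | neg {t u : JTerm} : Rewrite t u → Rewrite (.neg t) (.neg u)
  | sup {t u : JTerm} (l₁ l₂ : List JTerm) :
      Rewrite t u → Rewrite (.sup (l₁ ++ t :: l₂)) (.sup (l₁ ++ u :: l₂))

/-- One rewrite step on terms taken modulo commutativity. -/
def RewriteMod (t u : JTerm) : Prop :=
  ∃ t' u', CommEq t t' ∧ Rewrite t' u' ∧ CommEq u' u

/-- `u` is, up to commutativity, a term to which `t` rewrites in finitely many (possibly zero)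
steps, and no rule applies to `u` modulo commutativity. -/
def IsNormalFormOf (u t : JTerm) : Prop :=
  (∃ u', Relation.ReflTransGen RewriteMod t u' ∧ CommEq u' u) ∧ ∀ v, ¬ RewriteMod u v

/-! ### Programs for a unit-cost random access machine

A program works on finitely many registers and finitely many arrays of natural numbers, all named
by constants of the program.  Array indices are computed at run time (indirect addressing).
Words are bounded: an execution with word bound `B` exists only if no number that is computed,
read or used as an address exceeds `B`. -/

/-- The contents of the registers and of the arrays. -/
structure RAMState where
  reg : ℕ → ℕ
  arr : ℕ → ℕ → ℕ

/-- Expressions. `load a i` is the entry of array `a` at index `i`; `sub` is truncated at `0`;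
`lt` and `eq` return `1` (true) or `0` (false). -/
inductive RAMExpr : Type
  | const (c : ℕ)
  | reg (x : ℕ)
  | load (a : ℕ) (i : RAMExpr)
  | add (e f : RAMExpr)
  | sub (e f : RAMExpr)
  | mul (e f : RAMExpr)
  | lt (e f : RAMExpr)
  | eq (e f : RAMExpr)

/-- Value of an expression. -/
def RAMExpr.val (s : RAMState) : RAMExpr → ℕ
  | .const c => c
  | .reg x => s.reg x
  | .load a i => s.arr a (i.val s)
  | .add e f => e.val s + f.val s
  | .sub e f => e.val s - f.val s
  | .mul e f => e.val s * f.val s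
  | .lt e f => if e.val s < f.val s then 1 else 0
  | .eq e f => if e.val s = f.val s then 1 else 0

/-- Cost of evaluating an expression: one step per operation. -/
def RAMExpr.cost : RAMExpr → ℕ
  | .const _ => 1
  | .reg _ => 1
  | .load _ i => i.cost + 1
  | .add e f => e.cost + f.cost + 1
  | .sub e f => e.cost + f.cost + 1
  | .mul e f => e.cost + f.cost + 1
  | .lt e f => e.cost + f.cost + 1
  | .eq e f => e.cost + f.cost + 1

/-- The values of the expression and of all its subexpressions are at most `B`. -/
def RAMExpr.Fits (B : ℕ) (s : RAMState) : RAMExpr → Prop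
  | .const c => c ≤ B
  | .reg x => s.reg x ≤ B
  | .load a i => i.Fits B s ∧ s.arr a (i.val s) ≤ B
  | .add e f => e.Fits B s ∧ f.Fits B s ∧ e.val s + f.val s ≤ B
  | .sub e f => e.Fits B s ∧ f.Fits B s
  | .mul e f => e.Fits B s ∧ f.Fits B s ∧ e.val s * f.val s ≤ B
  | .lt e f => e.Fits B s ∧ f.Fits B s ∧ 1 ≤ B
  | .eq e f => e.Fits B s ∧ f.Fits B s ∧ 1 ≤ B

/-- Programs. `store a i e` writes the value of `e` to array `a` at index `i`; the condition of a
test or loop is true when its value is not `0`. -/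
inductive RAMProg : Type
  | skip
  | assign (x : ℕ) (e : RAMExpr)
  | store (a : ℕ) (i e : RAMExpr)
  | seq (p q : RAMProg)
  | ite (e : RAMExpr) (p q : RAMProg)
  | loop (e : RAMExpr) (p : RAMProg)

/-- Write a register. -/
def RAMState.setReg (s : RAMState) (x v : ℕ) : RAMState :=
  { s with reg := Function.update s.reg x v }

/-- Write an array entry. -/
def RAMState.setArr (s : RAMState) (a i v : ℕ) : RAMState :=
  { s with arr := Function.update s.arr a (Function.update (s.arr a) i v) }

/-- `RAMExec B p s s' k`: started in state `s`, the program `p` halts in state `s'` after exactly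
`k` steps, and all words occurring on the way are at most `B`. -/
inductive RAMExec (B : ℕ) : RAMProg → RAMState → RAMState → ℕ → Prop
  | skip (s : RAMState) : RAMExec B .skip s s 1
  | assign (s : RAMState) (x : ℕ) (e : RAMExpr) :
      e.Fits B s → RAMExec B (.assign x e) s (s.setReg x (e.val s)) (e.cost + 1)
  | store (s : RAMState) (a : ℕ) (i e : RAMExpr) :
      i.Fits B s → e.Fits B s →
      RAMExec B (.store a i e) s (s.setArr a (i.val s) (e.val s)) (i.cost + e.cost + 1)
  | seq {p q : RAMProg} {s s' s'' : RAMState} {k k' : ℕ} :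
      RAMExec B p s s' k → RAMExec B q s' s'' k' → RAMExec B (.seq p q) s s'' (k + k')
  | iteTrue {e : RAMExpr} {p q : RAMProg} {s s' : RAMState} {k : ℕ} :
      e.Fits B s → e.val s ≠ 0 → RAMExec B p s s' k →
      RAMExec B (.ite e p q) s s' (e.cost + k + 1)
  | iteFalse {e : RAMExpr} {p q : RAMProg} {s s' : RAMState} {k : ℕ} :
      e.Fits B s → e.val s = 0 → RAMExec B q s s' k →
      RAMExec B (.ite e p q) s s' (e.cost + k + 1)
  | loopDone {e : RAMExpr} {p : RAMProg} {s : RAMState} :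
      e.Fits B s → e.val s = 0 → RAMExec B (.loop e p) s s (e.cost + 1)
  | loopStep {e : RAMExpr} {p : RAMProg} {s s' s'' : RAMState} {k k' : ℕ} :
      e.Fits B s → e.val s ≠ 0 → RAMExec B p s s' k → RAMExec B (.loop e p) s' s'' k' →
      RAMExec B (.loop e p) s s'' (e.cost + k + k' + 1)

/-- Initial state: array `0` holds the input `H`, registers `0` and `1` hold `r₀` and `r₁`,
everything else is `0`. -/
def RAMState.init (H : ℕ → ℕ) (r₀ r₁ : ℕ) : RAMState where
  reg x := if x = 0 then r₀ else if x = 1 then r₁ else 0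
  arr a i := if a = 0 then H i else 0

/-! ### Terms stored in memory

A node is stored at an address `p` of an array `H`: its label is `H p`, and the variable index,
or the number of arguments (of an `n`-ary join) and the addresses of the arguments, follow.
Different nodes may point to the same address, so that an arbitrary rooted directed acyclic graph
is allowed; the stored term is the tree into which the graph unfolds. -/

/-- The graph stored in `H` with root at address `p` unfolds to the given term. -/
inductive StoredJ (H : ℕ → ℕ) : ℕ → JTerm → Prop
  | zero {p : ℕ} : H p = 0 → StoredJ H p .zero
  | one {p : ℕ} : H p = 1 → StoredJ H p .one
  | var {p : ℕ} : H p = 2 → StoredJ H p (.var (H (p + 1)))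
  | neg {p : ℕ} {t : JTerm} : H p = 3 → StoredJ H (H (p + 1)) t → StoredJ H p (.neg t)
  | sup {p : ℕ} {l : List JTerm} : H p = 4 → H (p + 1) = l.length →
      (∀ (i : ℕ) (h : i < l.length), StoredJ H (H (p + 2 + i)) l[i]) → StoredJ H p (.sup l)

/-- The graph stored in `H` with root at address `p` unfolds to the given term. -/
inductive StoredB (H : ℕ → ℕ) : ℕ → BTerm → Prop
  | zero {p : ℕ} : H p = 0 → StoredB H p .zero
  | one {p : ℕ} : H p = 1 → StoredB H p .one
  | var {p : ℕ} : H p = 2 → StoredB H p (.var (H (p + 1)))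
  | neg {p : ℕ} {t : BTerm} : H p = 3 → StoredB H (H (p + 1)) t → StoredB H p (.neg t)
  | join {p : ℕ} {s t : BTerm} : H p = 4 → StoredB H (H (p + 1)) s →
      StoredB H (H (p + 2)) t → StoredB H p (.join s t)
  | meet {p : ℕ} {s t : BTerm} : H p = 5 → StoredB H (H (p + 1)) s →
      StoredB H (H (p + 2)) t → StoredB H p (.meet s t)

/-- The program `P` computes normal forms modulo commutativity in at most `C n (log n + 1) ^ 2`
steps, on words polynomial in `n` and the numbers in the input, where `n` is the size of the input
term.  The normal form is found in array `1`, at the address in register `0`. -/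
def ComputesNormalForm (P : RAMProg) (C : ℕ) : Prop :=
  ∀ (t : JTerm) (H : ℕ → ℕ) (r W : ℕ), t.Proper → StoredJ H r t → r ≤ W → (∀ i, H i ≤ W) →
    ∃ s' k, RAMExec ((t.size + W + 2) ^ C) P (RAMState.init H r 0) s' k ∧
      k ≤ C * (t.size * (Nat.log 2 t.size + 1) ^ 2) ∧
      ∃ u, StoredJ (s'.arr 1) (s'.reg 0) u ∧ IsNormalFormOf u t

/-- The program `P` decides the word problem for orthocomplemented bisemilattices in at most
`C n (log n + 1) ^ 2` steps, on words polynomial in `n` and the numbers in the input, where `n` is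
the total size of the two input terms.  The answer (`1` or `0`) is found in register `0`. -/
def DecidesWordProblem (P : RAMProg) (C : ℕ) : Prop :=
  ∀ (t₁ t₂ : BTerm) (H : ℕ → ℕ) (r₁ r₂ W : ℕ), StoredB H r₁ t₁ → StoredB H r₂ t₂ →
    r₁ ≤ W → r₂ ≤ W → (∀ i, H i ≤ W) →
    ∃ s' k, RAMExec ((t₁.size + t₂.size + W + 2) ^ C) P (RAMState.init H r₁ r₂) s' k ∧
      k ≤ C * ((t₁.size + t₂.size) * (Nat.log 2 (t₁.size + t₂.size) + 1) ^ 2) ∧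
      (OCBSLEq t₁ t₂ → s'.reg 0 = 1) ∧ (¬ OCBSLEq t₁ t₂ → s'.reg 0 = 0)

-- The free algebra on countably many generators is built concretely and takes the place of a
-- confluence argument. An element other than `1` is a finite set of codes, read as the join of its
-- members; a code stands for a variable or for the complement of the join of a finite set of codes.
-- A set is admissible (`Good`) if it contains no code of `¬B` with `B` contained in the set, and
-- if, hereditarily, there is no complement of `0` and no complement of a lone complement. Subsets
-- of good sets are good. So union, with every bad set sent to `1`, is a well defined join
-- (`FreeB.join_norm`), and the complement exchanges `1` with `∅` and `A` with `{¬A}`. All laws can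
-- be read off.
--
-- Each rule is valid in every model and lowers the size, so normal forms exist and have the value
-- of the original term. Irreducible proper terms have the shape `Nice` (`Nice.of_irreducible`). A
-- nice term other than `1` evaluates at the generators of `FreeB` to the set of codes of its
-- arguments (`Nice.eval_eq`), and this set determines it up to permutations
-- (`Nice.commEq_of_asSet_eq`). Hence values in `FreeB` separate normal forms. This gives uniqueness
-- without critical pairs, and completeness of the rules, because an equation that is valid in all
-- models is valid in `FreeB`. Conversely nice terms are irreducible, so an algorithm only has to
-- output a nice term with the right value (`Nice.isNormalFormOf`).
--
-- The algorithm evaluates the term in `FreeB`. Codes are represented by addresses of atoms in the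
-- output, different atoms having different codes (`Heap`). Sets of addresses are nodes of
-- hash-consed binary tries: equal sets are equal nodes (`Trie.WF.eq_of_mem_iff`), and an insertion,
-- which also tests membership, takes logarithmic time. A value on the stack is a sign together with
-- a list of atoms, possibly with repetitions and possibly inconsistent, stored as a rope. A
-- complement flips the sign, and nonempty positive values are joined by concatenation in constant
-- time. Only when a complemented list must become an argument of a join is it sealed (`wp_sealP`):
-- its trie node is computed and looked up; if the node is new, it is checked that no member has all
-- its arguments in the set, and the complement is written to the output.
--
-- Time is amortized over a measure of lists: two for every atom, plus its number of arguments.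
-- Sealing a list of measure `m` takes time `O(m log n)`, and the resulting atom has measure at most
-- `2 + m / 2`, so the released measure pays. The delicate case is a join of two complements one of
-- which turns out to be redundant, so that the other list survives unsealed. There the smaller list
-- is treated first (`wp_negnegLeP`): if it is inconsistent it pays for itself, and if the larger
-- one is inconsistent or equal to it, the larger one pays for both. In total the time is `O(n log
-- n)`, within the bound claimed. The same measure bounds the length of the output.
--
-- Words stay polynomial because everything that is written to memory exceeds the older words by at
-- most a constant (`RAMExpr.Lin`, `Run.exec`).

/-! ### A model: finite sets of codes -/

/-- Code of a variable. -/
def varC (v : ℕ) : ℕ := 2 * v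

/-- Code of the complement of the join of a set of codes. -/
noncomputable def negC (B : Finset ℕ) : ℕ := 2 * Encodable.encode B + 1

theorem varC_inj {v w : ℕ} (h : varC v = varC w) : v = w := by
  unfold varC at h; omega

theorem negC_inj {A B : Finset ℕ} (h : negC A = negC B) : A = B := by
  unfold negC at h
  exact Encodable.encode_injective (by omega)

theorem varC_ne_negC (v : ℕ) (B : Finset ℕ) : varC v ≠ negC B := by
  unfold varC negC; omega

/-- Sets of codes whose join is not `1`, and which contain only codes of reduced terms. -/
inductive Good : Finset ℕ → Prop
  | mk (A : Finset ℕ) :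
      -- The three conditions exclude the redexes of A7 and A9, of A10, and of A6.
      (∀ B, negC B ∈ A → ¬ B ⊆ A ∧ B.Nonempty ∧ ∀ C, B ≠ {negC C}) →
      (∀ B, negC B ∈ A → Good B) → Good A

theorem Good.noclash {A B : Finset ℕ} (h : Good A) (hB : negC B ∈ A) : ¬ B ⊆ A := by
  cases h with | mk _ h1 h2 => exact (h1 B hB).1

theorem Good.nonempty {A B : Finset ℕ} (h : Good A) (hB : negC B ∈ A) : B.Nonempty := by
  cases h with | mk _ h1 h2 => exact (h1 B hB).2.1

theorem Good.ne_neg {A B : Finset ℕ} (h : Good A) (hB : negC B ∈ A) (C : Finset ℕ) :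
    B ≠ {negC C} := by
  cases h with | mk _ h1 h2 => exact (h1 B hB).2.2 C

theorem Good.sub {A B : Finset ℕ} (h : Good A) (hB : negC B ∈ A) : Good B := by
  cases h with | mk _ h1 h2 => exact h2 B hB

/-- A clash inside a set persists in all larger sets, so the sets with join `1` are closed upwards.
This is what makes the join of `FreeB` well defined and associative. -/
theorem Good.mono {A A' : Finset ℕ} (h : Good A') (hs : A ⊆ A') : Good A :=
  .mk A (fun _ hB => ⟨fun hBA => h.noclash (hs hB) (hBA.trans hs), h.nonempty (hs hB),
    h.ne_neg (hs hB)⟩) (fun _ hB => h.sub (hs hB))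

theorem good_empty : Good ∅ := .mk ∅ (by simp) (by simp)

theorem good_var (v : ℕ) : Good {varC v} :=
  .mk _ (fun _ hB => absurd (Finset.mem_singleton.1 hB).symm (varC_ne_negC v _))
    (fun _ hB => absurd (Finset.mem_singleton.1 hB).symm (varC_ne_negC v _))

/-- A clash would mean that the nonempty set `A` is contained in `{negC A}`, hence equal to it,
which is a case of the excluded lone complement. -/
theorem good_neg {A : Finset ℕ} (h : Good A) (hne : A.Nonempty) (hn : ∀ C, A ≠ {negC C}) :
    Good {negC A} := by
  refine .mk _ (fun B hB => ?_) (fun B hB => ?_)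
  · obtain rfl := negC_inj (Finset.mem_singleton.1 hB)
    refine ⟨fun hs => ?_, hne, hn⟩
    exact hn B ((Finset.subset_singleton_iff.1 hs).resolve_left hne.ne_empty)
  · obtain rfl := negC_inj (Finset.mem_singleton.1 hB)
    exact h

theorem not_good_clash {A B : Finset ℕ} (hB : negC B ∈ A) (hs : B ⊆ A) : ¬ Good A :=
  fun h => h.noclash hB hs

/-- The free orthocomplemented bisemilattice on countably many generators. -/
inductive FreeB : Type
  | top
  | set (A : Finset ℕ) (h : Good A)

namespace FreeB

open Classical in
/-- The join of a finite set of codes. -/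
noncomputable def norm (A : Finset ℕ) : FreeB := if h : Good A then set A h else top

theorem norm_good {A : Finset ℕ} (h : Good A) : norm A = set A h := dif_pos h

theorem norm_bad {A : Finset ℕ} (h : ¬ Good A) : norm A = top := dif_neg h

theorem norm_inj {A B : Finset ℕ} (hA : Good A) (h : norm A = norm B) : A = B := by
  by_cases hB : Good B
  · rw [norm_good hA, norm_good hB] at h
    exact FreeB.set.inj h
  · rw [norm_good hA, norm_bad hB] at h
    exact absurd h (by simp)

theorem norm_eq_top {A : Finset ℕ} : norm A = top ↔ ¬ Good A := by
  by_cases hA : Good A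
  · rw [norm_good hA]; simp [hA]
  · rw [norm_bad hA]; simp [hA]

/-- A set of codes whose join is `1`. -/
noncomputable def badSet : Finset ℕ := {varC 0, negC {varC 0}}

theorem badSet_bad : ¬ Good badSet :=
  not_good_clash (B := {varC 0}) (by simp [badSet]) (by simp [badSet])

theorem exists_norm (x : FreeB) : ∃ A, x = norm A := by
  cases x with
  | top => exact ⟨badSet, (norm_bad badSet_bad).symm⟩
  | set A h => exact ⟨A, (norm_good h).symm⟩

/-- Join. -/
noncomputable def join : FreeB → FreeB → FreeB
  | set A _, set B _ => norm (A ∪ B)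
  | _, _ => top

/-- Bad sets are allowed here. Since every element is `norm` of some set, the laws of `join` become
laws of union. -/
theorem join_norm (A B : Finset ℕ) : join (norm A) (norm B) = norm (A ∪ B) := by
  by_cases hA : Good A
  · by_cases hB : Good B
    · rw [norm_good hA, norm_good hB]; rfl
    · rw [norm_bad hB, norm_bad (fun h => hB (h.mono Finset.subset_union_right))]
      cases norm A <;> rfl
  · rw [norm_bad hA, norm_bad (fun h => hA (h.mono Finset.subset_union_left))]
    rfl

open Classical in
/-- Complement. -/
noncomputable def compl : FreeB → FreeB
  | top => norm ∅
  | set A _ => if A = ∅ then top else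
      if h : ∃ B, A = {negC B} then norm h.choose else norm {negC A}

theorem compl_top : compl top = norm ∅ := rfl

theorem compl_empty : compl (norm ∅) = top := by
  rw [norm_good good_empty]; simp [compl]

theorem compl_norm {A : Finset ℕ} (h : Good A) (hne : A.Nonempty) (hn : ∀ C, A ≠ {negC C}) :
    compl (norm A) = norm {negC A} := by
  rw [norm_good h]
  simp only [compl]
  rw [if_neg hne.ne_empty, dif_neg (fun ⟨B, hB⟩ => hn B hB)]

theorem compl_neg {B : Finset ℕ} (h : Good {negC B}) : compl (norm {negC B}) = norm B := by
  rw [norm_good h]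
  simp only [compl]
  have hex : ∃ C, ({negC B} : Finset ℕ) = {negC C} := ⟨B, rfl⟩
  rw [if_neg (by simp), dif_pos hex]
  have := hex.choose_spec
  rw [← negC_inj (Finset.singleton_inj.1 this)]

/-- The complement exchanges the first two cases with each other, and likewise the last two. -/
theorem cases_norm (x : FreeB) : x = top ∨ x = norm ∅ ∨
    (∃ B, Good B ∧ B.Nonempty ∧ (∀ C, B ≠ {negC C}) ∧ Good {negC B} ∧ x = norm {negC B}) ∨
    (∃ A, Good A ∧ A.Nonempty ∧ (∀ C, A ≠ {negC C}) ∧ x = norm A) := by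
  cases x with
  | top => exact .inl rfl
  | set A hA =>
    right
    rw [← norm_good hA]
    rcases Finset.eq_empty_or_nonempty A with rfl | hne
    · exact .inl rfl
    · right
      by_cases h : ∃ B, A = {negC B}
      · obtain ⟨B, rfl⟩ := h
        have hm : negC B ∈ ({negC B} : Finset ℕ) := by simp
        exact .inl ⟨B, hA.sub hm, hA.nonempty hm, hA.ne_neg hm, hA, rfl⟩
      · exact .inr ⟨A, hA, hne, fun C hC => h ⟨C, hC⟩, rfl⟩

theorem compl_compl (x : FreeB) : compl (compl x) = x := by
  rcases cases_norm x with rfl | rfl | ⟨B, hB, hne, hn, hg, rfl⟩ | ⟨A, hA, hne, hn, rfl⟩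
  · rw [compl_top, compl_empty]
  · rw [compl_empty, compl_top]
  · rw [compl_neg hg, compl_norm hB hne hn]
  · rw [compl_norm hA hne hn, compl_neg (good_neg hA hne hn)]

theorem join_top (x : FreeB) : join x top = top := by cases x <;> rfl

theorem join_comm (x y : FreeB) : join x y = join y x := by
  obtain ⟨A, rfl⟩ := exists_norm x
  obtain ⟨B, rfl⟩ := exists_norm y
  rw [join_norm, join_norm, Finset.union_comm]

theorem join_assoc (x y z : FreeB) : join x (join y z) = join (join x y) z := by
  obtain ⟨A, rfl⟩ := exists_norm x
  obtain ⟨B, rfl⟩ := exists_norm y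
  obtain ⟨C, rfl⟩ := exists_norm z
  simp only [join_norm, Finset.union_assoc]

theorem join_idem (x : FreeB) : join x x = x := by
  obtain ⟨A, rfl⟩ := exists_norm x
  rw [join_norm, Finset.union_idempotent]

theorem join_bot (x : FreeB) : join x (norm ∅) = x := by
  obtain ⟨A, rfl⟩ := exists_norm x
  rw [join_norm, Finset.union_empty]

/-- Apart from the constants, one of `x` and its complement is a set `B` and the other is `{negC
B}`, so their union contains a clash. -/
theorem join_compl (x : FreeB) : join x (compl x) = top := by
  rcases cases_norm x with rfl | rfl | ⟨B, hB, hne, hn, hg, rfl⟩ | ⟨A, hA, hne, hn, rfl⟩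
  · rfl
  · rw [compl_empty, join_top]
  · rw [compl_neg hg, join_norm, norm_bad (not_good_clash (B := B) (by simp) (by simp))]
  · rw [compl_norm hA hne hn, join_norm,
      norm_bad (not_good_clash (B := A) (by simp) (by simp))]

/-- Defining the meet by de Morgan's law reduces the dual laws to the laws of the join and the
involution. -/
noncomputable instance : OCBSL FreeB where
  join := join
  meet x y := compl (join (compl x) (compl y))
  compl := compl
  bot := norm ∅
  top := top
  join_comm := join_comm
  meet_comm x y := by rw [join_comm]
  join_assoc := join_assoc
  meet_assoc x y z := by rw [compl_compl, compl_compl, join_assoc]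
  join_idem := join_idem
  meet_idem x := by rw [join_idem, compl_compl]
  join_top := join_top
  meet_bot x := by rw [compl_empty, join_top, compl_top]
  join_bot := join_bot
  meet_top x := by rw [compl_top, join_bot, compl_compl]
  compl_compl := compl_compl
  join_compl := join_compl
  meet_compl x := by rw [join_compl, compl_top]
  compl_join x y := by rw [compl_compl, compl_compl]
  compl_meet x y := by rw [compl_compl]

end FreeB

/-! ### Evaluation of terms with joins of any number of arguments -/

section Eval

variable {S : Type} [OCBSL S]

mutual
/-- Value of a term; the empty join is `0`. -/
def JTerm.eval (ρ : ℕ → S) : JTerm → S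
  | .var v => ρ v
  | .zero => OCBSL.bot
  | .one => OCBSL.top
  | .neg t => OCBSL.compl (t.eval ρ)
  | .sup l => JTerm.evalList ρ l
/-- Join of the values of the terms of a list. -/
def JTerm.evalList (ρ : ℕ → S) : List JTerm → S
  | [] => OCBSL.bot
  | t :: l => OCBSL.join (t.eval ρ) (JTerm.evalList ρ l)
end

theorem OCBSL.bot_join (x : S) : OCBSL.join OCBSL.bot x = x := by
  rw [OCBSL.join_comm, OCBSL.join_bot]

theorem OCBSL.top_join (x : S) : OCBSL.join OCBSL.top x = OCBSL.top := by
  rw [OCBSL.join_comm, OCBSL.join_top]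

theorem OCBSL.compl_top : OCBSL.compl (OCBSL.top : S) = OCBSL.bot := by
  rw [← OCBSL.meet_compl (OCBSL.top : S), OCBSL.meet_comm, OCBSL.meet_top]

theorem OCBSL.compl_bot : OCBSL.compl (OCBSL.bot : S) = OCBSL.top := by
  rw [← OCBSL.compl_top, OCBSL.compl_compl]

theorem JTerm.evalList_append (ρ : ℕ → S) (l m : List JTerm) :
    JTerm.evalList ρ (l ++ m) = OCBSL.join (JTerm.evalList ρ l) (JTerm.evalList ρ m) := by
  induction l with
  | nil => simp [JTerm.evalList, OCBSL.bot_join]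
  | cons t l ih => simp [JTerm.evalList, ih, OCBSL.join_assoc]

theorem JTerm.evalList_perm (ρ : ℕ → S) {l m : List JTerm} (h : l.Perm m) :
    JTerm.evalList ρ l = JTerm.evalList ρ m := by
  induction h with
  | nil => rfl
  | cons t _ ih => simp [JTerm.evalList, ih]
  | swap t u l =>
    simp only [JTerm.evalList, OCBSL.join_assoc]
    rw [OCBSL.join_comm (u.eval ρ)]
  | trans _ _ ih1 ih2 => exact ih1.trans ih2

theorem CommEq.eval_eq {t u : JTerm} (h : CommEq t u) (ρ : ℕ → S) : t.eval ρ = u.eval ρ := by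
  induction h with
  | perm h => exact JTerm.evalList_perm ρ h
  | neg _ ih => simp [JTerm.eval, ih]
  | sup l₁ l₂ _ ih => simp [JTerm.eval, JTerm.evalList_append, JTerm.evalList, ih]
  | refl => rfl
  | symm _ ih => exact ih.symm
  | trans _ _ ih1 ih2 => exact ih1.trans ih2

/-- Soundness. A9 is the law `y ⊔ ¬y = 1` for the join `y` of a sublist, followed by absorption of
the other arguments by `1`. -/
theorem Rule.eval_eq {t u : JTerm} (h : Rule t u) (ρ : ℕ → S) : t.eval ρ = u.eval ρ := by
  cases h with
  | A2 x y => simp [JTerm.eval, JTerm.evalList_append, JTerm.evalList, OCBSL.join_bot]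
  | A2b x => simp [JTerm.eval, JTerm.evalList, OCBSL.join_bot]
  | A3 x y => simp [JTerm.eval, JTerm.evalList, OCBSL.join_assoc, OCBSL.join_idem]
  | A4 x => simp [JTerm.eval, JTerm.evalList, OCBSL.top_join]
  | A5 x => simp [JTerm.eval, JTerm.evalList, OCBSL.bot_join]
  | A6 x => simp [JTerm.eval, OCBSL.compl_compl]
  | A7 x y =>
    simp [JTerm.eval, JTerm.evalList, OCBSL.join_assoc, OCBSL.join_compl, OCBSL.top_join]
  | A9 x y =>
    simp [JTerm.eval, JTerm.evalList_append, JTerm.evalList, OCBSL.join_bot,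
      OCBSL.join_compl, OCBSL.join_top]
  | A10 => simp [JTerm.eval, OCBSL.compl_bot]
  | A11 => simp [JTerm.eval, OCBSL.compl_top]

theorem Rewrite.eval_eq {t u : JTerm} (h : Rewrite t u) (ρ : ℕ → S) : t.eval ρ = u.eval ρ := by
  induction h with
  | root h => exact h.eval_eq ρ
  | neg _ ih => simp [JTerm.eval, ih]
  | sup l₁ l₂ _ ih => simp [JTerm.eval, JTerm.evalList_append, JTerm.evalList, ih]

theorem RewriteMod.eval_eq {t u : JTerm} (h : RewriteMod t u) (ρ : ℕ → S) :
    t.eval ρ = u.eval ρ := by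
  obtain ⟨t', u', h1, h2, h3⟩ := h
  rw [h1.eval_eq, h2.eval_eq, h3.eval_eq]

theorem IsNormalFormOf.eval_eq {t u : JTerm} (h : IsNormalFormOf u t) (ρ : ℕ → S) :
    t.eval ρ = u.eval ρ := by
  obtain ⟨⟨u', h1, h2⟩, -⟩ := h
  rw [← h2.eval_eq]
  clear h2
  induction h1 with
  | refl => rfl
  | tail _ h ih => rw [ih, h.eval_eq]

theorem BTerm.eval_toJTerm (ρ : ℕ → S) (t : BTerm) : t.toJTerm.eval ρ = t.eval ρ := by
  induction t with
  | join s t ihs iht =>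
    simp [BTerm.toJTerm, JTerm.eval, JTerm.evalList, BTerm.eval, OCBSL.join_bot, ihs, iht]
  | meet s t ihs iht =>
    simp [BTerm.toJTerm, JTerm.eval, JTerm.evalList, BTerm.eval, OCBSL.join_bot, ihs, iht,
      OCBSL.compl_join, OCBSL.compl_compl]
  | neg t ih => simp [BTerm.toJTerm, JTerm.eval, BTerm.eval, ih]
  | _ => simp [BTerm.toJTerm, JTerm.eval, BTerm.eval]

end Eval

/-! ### Sizes and termination -/

theorem JTerm.sizeList_append (l m : List JTerm) :
    JTerm.sizeList (l ++ m) = JTerm.sizeList l + JTerm.sizeList m := by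
  induction l with
  | nil => simp [JTerm.sizeList]
  | cons t l ih => simp [JTerm.sizeList, ih, add_assoc]

theorem JTerm.sizeList_perm {l m : List JTerm} (h : l.Perm m) :
    JTerm.sizeList l = JTerm.sizeList m := by
  induction h with
  | nil => rfl
  | cons t _ ih => simp [JTerm.sizeList, ih]
  | swap t u l => simp only [JTerm.sizeList]; omega
  | trans _ _ ih1 ih2 => exact ih1.trans ih2

theorem JTerm.size_pos (t : JTerm) : 1 ≤ t.size := by
  cases t <;> simp [JTerm.size]

theorem JTerm.size_le_of_mem {t : JTerm} {l : List JTerm} (h : t ∈ l) :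
    t.size ≤ JTerm.sizeList l := by
  obtain ⟨a, b, rfl⟩ := List.append_of_mem h
  simp only [JTerm.sizeList_append, JTerm.sizeList]; omega

theorem CommEq.size_eq {t u : JTerm} (h : CommEq t u) : t.size = u.size := by
  induction h with
  | perm h => simp [JTerm.size, JTerm.sizeList_perm h]
  | neg _ ih => simp [JTerm.size, ih]
  | sup l₁ l₂ _ ih => simp [JTerm.size, JTerm.sizeList_append, JTerm.sizeList, ih]
  | refl => rfl
  | symm _ ih => exact ih.symm
  | trans _ _ ih1 ih2 => exact ih1.trans ih2

theorem Rule.size_lt {t u : JTerm} (h : Rule t u) : u.size < t.size := by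
  cases h <;> simp only [JTerm.size, JTerm.sizeList_append, JTerm.sizeList]
  all_goals try have := JTerm.size_pos ‹JTerm›
  all_goals omega

theorem Rewrite.size_lt {t u : JTerm} (h : Rewrite t u) : u.size < t.size := by
  induction h with
  | root h => exact h.size_lt
  | neg _ ih => simpa [JTerm.size] using ih
  | sup l₁ l₂ _ ih => simpa [JTerm.size, JTerm.sizeList_append, JTerm.sizeList] using ih

theorem RewriteMod.size_lt {t u : JTerm} (h : RewriteMod t u) : u.size < t.size := by
  obtain ⟨t', u', h1, h2, h3⟩ := h
  rw [h1.size_eq, ← h3.size_eq]; exact h2.size_lt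

/-- Every rule lowers the number of nodes, and permutations of arguments preserve it, so rewriting
terminates. -/
theorem exists_isNormalFormOf (t : JTerm) : ∃ u, IsNormalFormOf u t := by
  induction hn : t.size using Nat.strong_induction_on generalizing t with
  | _ n ih =>
    by_cases h : ∃ v, RewriteMod t v
    · obtain ⟨v, hv⟩ := h
      obtain ⟨u, ⟨u', h1, h2⟩, h3⟩ := ih v.size (hn ▸ hv.size_lt) v rfl
      exact ⟨u, ⟨u', .head hv h1, h2⟩, h3⟩
    · exact ⟨t, ⟨t, .refl, .refl t⟩, fun v hv => h ⟨v, hv⟩⟩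

/-! ### Proper terms -/

theorem JTerm.proper_neg {t : JTerm} : (JTerm.neg t).Proper ↔ t.Proper :=
  ⟨fun h => by cases h; assumption, .neg⟩

theorem JTerm.proper_sup {l : List JTerm} : (JTerm.sup l).Proper ↔ l ≠ [] ∧ ∀ t ∈ l, t.Proper :=
  ⟨fun h => by cases h; constructor <;> assumption, fun h => .sup h.1 h.2⟩

theorem CommEq.proper_iff {t u : JTerm} (h : CommEq t u) : t.Proper ↔ u.Proper := by
  induction h with
  | @perm l l' h =>
    rw [JTerm.proper_sup, JTerm.proper_sup]
    have h0 : l ≠ [] ↔ l' ≠ [] := not_congr ⟨fun e => by subst e; exact h.nil_eq.symm,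
      fun e => by subst e; exact h.eq_nil⟩
    simp only [h0, h.mem_iff]
  | neg _ ih => simpa [JTerm.proper_neg] using ih
  | sup l₁ l₂ _ ih => simp [JTerm.proper_sup, or_imp, forall_and, ih]
  | refl => rfl
  | symm _ ih => exact ih.symm
  | trans _ _ ih1 ih2 => exact ih1.trans ih2

/-- The side condition of A5 and, for A2, the nonemptiness of the inner join prevent empty joins
from arising. The shape of irreducible terms is known for proper terms only. -/
theorem Rule.proper {t u : JTerm} (h : Rule t u) (ht : t.Proper) : u.Proper := by
  cases h with
  | A2 x y =>
    simp only [JTerm.proper_sup, List.mem_append, or_imp, forall_and, List.mem_singleton,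
      forall_eq] at ht ⊢
    refine ⟨?_, ht.2.1, ht.2.2.2⟩
    simp [ht.2.2.1]
  | A2b x => exact (JTerm.proper_sup.1 ht).2 _ (by simp)
  | A3 x y =>
    rw [JTerm.proper_sup] at ht ⊢
    exact ⟨by simp, fun t h => ht.2 t (List.mem_cons_of_mem _ h)⟩
  | A5 x hx =>
    rw [JTerm.proper_sup] at ht ⊢
    exact ⟨hx, fun t h => ht.2 t (List.mem_cons_of_mem _ h)⟩
  | A6 x => exact JTerm.proper_neg.1 (JTerm.proper_neg.1 ht)
  | A11 => exact .zero
  | _ => exact .one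

theorem Rewrite.proper {t u : JTerm} (h : Rewrite t u) : t.Proper → u.Proper := by
  induction h with
  | root h => exact h.proper
  | neg _ ih => simpa [JTerm.proper_neg] using ih
  | sup l₁ l₂ _ ih =>
    simp only [JTerm.proper_sup, List.mem_append, List.mem_cons]
    rintro ⟨-, h⟩
    refine ⟨by simp, fun t ht => ?_⟩
    rcases ht with ht | rfl | ht
    · exact h t (.inl ht)
    · exact ih (h _ (.inr (.inl rfl)))
    · exact h t (.inr (.inr ht))

theorem RewriteMod.proper {t u : JTerm} (h : RewriteMod t u) (ht : t.Proper) : u.Proper := by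
  obtain ⟨t', u', h1, h2, h3⟩ := h
  exact h3.proper_iff.1 (h2.proper (h1.proper_iff.1 ht))

theorem IsNormalFormOf.proper {t u : JTerm} (h : IsNormalFormOf u t) (ht : t.Proper) :
    u.Proper := by
  obtain ⟨⟨u', h1, h2⟩, -⟩ := h
  refine h2.proper_iff.1 ?_
  clear h2
  induction h1 with
  | refl => exact ht
  | tail _ h ih => exact h.proper ih

theorem BTerm.toJTerm_proper (t : BTerm) : t.toJTerm.Proper := by
  induction t with
  | var v => exact .var v
  | zero => exact .zero
  | one => exact .one
  | neg t ih => exact .neg ih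
  | join s t ihs iht => exact .sup (by simp) (by simp [ihs, iht])
  | meet s t ihs iht => exact .neg (.sup (by simp) (by simp [JTerm.proper_neg, ihs, iht]))

/-! ### Reduced terms -/

mutual
/-- The set of codes of the arguments of a reduced term. -/
noncomputable def JTerm.asSet : JTerm → Finset ℕ
  | .var v => {varC v}
  | .zero => ∅
  -- A default value: the set of `1` is that of `0`, so statements about `asSet` have to exclude the
  -- term `1`.
  | .one => ∅
  | .neg t => {negC t.asSet}
  | .sup l => JTerm.asSetList l
/-- The union of the sets of codes of the terms of a list. -/
noncomputable def JTerm.asSetList : List JTerm → Finset ℕ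
  | [] => ∅
  | t :: l => t.asSet ∪ JTerm.asSetList l
end

theorem JTerm.mem_asSetList {l : List JTerm} {a : ℕ} :
    a ∈ JTerm.asSetList l ↔ ∃ t ∈ l, a ∈ t.asSet := by
  induction l with
  | nil => simp [JTerm.asSetList]
  | cons t l ih => simp [JTerm.asSetList, ih]

/-- Terms whose root is a variable or a complement. -/
inductive JTerm.Atomic : JTerm → Prop
  | var (v : ℕ) : Atomic (.var v)
  | neg (t : JTerm) : Atomic (.neg t)

theorem JTerm.Atomic.exists_asSet {t : JTerm} (h : t.Atomic) : ∃ a, t.asSet = {a} := by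
  cases h <;> exact ⟨_, rfl⟩

/-- Reduced terms, described by their structure. -/
inductive Nice : JTerm → Prop
  | zero : Nice .zero
  | one : Nice .one
  | var (v : ℕ) : Nice (.var v)
  | negvar (v : ℕ) : Nice (.neg (.var v))
  | sup {l : List JTerm} : 2 ≤ l.length → (∀ t ∈ l, Nice t) → (∀ t ∈ l, t.Atomic) →
      -- Distinctness of the sets, not only of the terms, excludes repeated arguments modulo
      -- commutativity.
      (l.map JTerm.asSet).Nodup → Good (JTerm.asSetList l) → Nice (.sup l)
  | negsup {l : List JTerm} : Nice (.sup l) → Nice (.neg (.sup l))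

/-- The arguments contribute different singletons. Hence the set of a reduced join has at least two
elements and is confused neither with `0` nor with an atom. -/
theorem JTerm.card_asSetList {l : List JTerm} (ha : ∀ t ∈ l, t.Atomic)
    (hn : (l.map JTerm.asSet).Nodup) : (JTerm.asSetList l).card = l.length := by
  induction l with
  | nil => simp [JTerm.asSetList]
  | cons t l ih =>
    rw [List.map_cons, List.nodup_cons] at hn
    obtain ⟨a, hta⟩ := (ha t (by simp)).exists_asSet
    have hal : a ∉ JTerm.asSetList l := by
      intro h
      obtain ⟨u, hu, hau⟩ := JTerm.mem_asSetList.1 h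
      obtain ⟨b, hub⟩ := (ha u (by simp [hu])).exists_asSet
      rw [hub, Finset.mem_singleton] at hau
      exact hn.1 (List.mem_map.2 ⟨u, hu, by rw [hta, hub, hau]⟩)
    simp only [JTerm.asSetList, hta, List.length_cons]
    rw [Finset.singleton_union, Finset.card_insert_of_notMem hal,
      ih (fun t h => ha t (by simp [h])) hn.2]

theorem Nice.two_le_card {l : List JTerm} (h : Nice (.sup l)) :
    2 ≤ (JTerm.asSetList l).card := by
  cases h with | sup h1 h2 h3 h4 h5 => rwa [JTerm.card_asSetList h3 h4]

theorem Nice.asSet_ne_neg {l : List JTerm} (h : Nice (.sup l)) (a : ℕ) :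
    JTerm.asSetList l ≠ {a} := fun e => by
  have := h.two_le_card; rw [e, Finset.card_singleton] at this; omega

theorem Nice.good {t : JTerm} (h : Nice t) : Good t.asSet := by
  have hs : ∀ l, Nice (.sup l) → Good (JTerm.asSetList l) := fun l h => by cases h; assumption
  cases h with
  | zero => exact good_empty
  | one => exact good_empty
  | var v => exact good_var v
  | negvar v =>
    exact good_neg (A := {varC v}) (good_var v) (by simp)
      (fun C e => varC_ne_negC v C (Finset.singleton_inj.1 e))
  | sup h1 h2 h3 h4 h5 => exact h5
  | @negsup l h =>
    exact good_neg (A := JTerm.asSetList l) (hs l h) (Finset.card_pos.1 (by have := h.two_le_card; omega))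
      (fun C e => h.asSet_ne_neg _ e)

/-- A reduced term denotes its own set of codes: no complement in it falls into a special case of
`FreeB.compl`, because the complemented set is nonempty and not a lone complement. -/
theorem Nice.eval_eq {t : JTerm} (h : Nice t) (h1 : t ≠ .one) :
    t.eval (fun v => FreeB.norm {varC v}) = FreeB.norm t.asSet := by
  induction h with
  | zero => rfl
  | one => exact absurd rfl h1
  | var v => rfl
  | negvar v =>
    exact FreeB.compl_norm (good_var v) (by simp)
      (fun C e => varC_ne_negC v C (Finset.singleton_inj.1 e))
  | @sup l h2 hl ha hn hg ih =>
    clear hn hg h1 hl h2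
    simp only [JTerm.eval, JTerm.asSet]
    induction l with
    | nil => rfl
    | cons t l ihl =>
      simp only [JTerm.evalList, JTerm.asSetList]
      rw [ih t (by simp) (by rintro rfl; cases ha _ List.mem_cons_self),
        ihl (fun t h => ha t (by simp [h])) (fun t h => ih t (by simp [h]))]
      exact FreeB.join_norm _ _
  | @negsup l h ih =>
    simp only [JTerm.eval, JTerm.asSet] at ih ⊢
    rw [ih (by simp)]
    exact FreeB.compl_norm h.good (Finset.card_pos.1 (by have := h.two_le_card; omega))
      (fun C e => h.asSet_ne_neg _ e)

/-! ### Permutations of arguments -/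

/-- Used to lift a rearrangement of the sets of the arguments to one of the arguments themselves. -/
theorem List.Perm.exists_map_eq {α β : Type*} {f : α → β} {l : List α} {k : List β}
    (h : (l.map f).Perm k) : ∃ l', l.Perm l' ∧ l'.map f = k := by
  induction k generalizing l with
  | nil => exact ⟨[], by simpa using h.eq_nil, rfl⟩
  | cons b k ih =>
    have hb : b ∈ l.map f := h.mem_iff.2 (by simp)
    obtain ⟨a, ha, rfl⟩ := List.mem_map.1 hb
    obtain ⟨x, y, rfl⟩ := List.append_of_mem ha
    have h1 : ((x ++ y).map f).Perm k := by
      refine List.Perm.cons_inv (a := f a) (List.Perm.trans ?_ h)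
      simpa using (List.perm_middle (a := f a) (l₁ := x.map f) (l₂ := y.map f)).symm
    obtain ⟨l', h2, rfl⟩ := ih h1
    exact ⟨a :: l', List.perm_middle.trans (h2.cons a), rfl⟩

theorem CommEq.sup_forall₂ {l m : List JTerm} (h : List.Forall₂ CommEq l m) :
    CommEq (.sup l) (.sup m) := by
  suffices H : ∀ k, CommEq (.sup (k ++ l)) (.sup (k ++ m)) by simpa using H []
  induction h with
  | nil => exact fun k => .refl _
  | @cons t u l m htu _ ih =>
    intro k
    refine .trans (.sup k l htu) ?_
    simpa using ih (k ++ [u])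

theorem CommEq.sup_of_perm {l l' m : List JTerm} (hp : l.Perm l')
    (hm : l'.map JTerm.asSet = m.map JTerm.asSet)
    (h : ∀ t ∈ l, ∀ u ∈ m, t.asSet = u.asSet → CommEq t u) : CommEq (.sup l) (.sup m) := by
  refine .trans (.perm hp) (.sup_forall₂ ?_)
  have h' : ∀ t ∈ l', ∀ u ∈ m, t.asSet = u.asSet → CommEq t u :=
    fun t ht => h t (hp.mem_iff.2 ht)
  clear hp h
  induction l' generalizing m with
  | nil =>
    obtain rfl : m = [] := by simpa using hm.symm
    exact .nil
  | cons t l' ih =>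
    cases m with
    | nil => simp at hm
    | cons u m =>
      simp only [List.map_cons, List.cons.injEq] at hm
      exact .cons (h' t (by simp) u (by simp) hm.1)
        (ih hm.2 (fun t ht u hu => h' t (by simp [ht]) u (by simp [hu])))

/-- The cardinality of the set and the kind of code force equal root shapes. For joins, equal unions
of different singletons are permutations of each other, and matched arguments are smaller terms with
equal sets, so induction on size applies. -/
theorem Nice.commEq_of_asSet_eq {t u : JTerm} (ht : Nice t) (hu : Nice u) (ht1 : t ≠ .one)
    (hu1 : u ≠ .one) (h : t.asSet = u.asSet) : CommEq t u := by
  induction hn : t.size using Nat.strong_induction_on generalizing t u with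
  | _ n ih =>
    have hsup : ∀ l m, l ≠ [] → JTerm.sizeList l < n → Nice (.sup l) → Nice (.sup m) →
        JTerm.asSetList l = JTerm.asSetList m → CommEq (.sup l) (.sup m) := by
      intro l m _ hln hl hm hlm
      cases hl with | sup l1 l2 l3 l4 l5 =>
      cases hm with | sup m1 m2 m3 m4 m5 =>
      have hsub : ∀ l m : List JTerm, (∀ t ∈ l, t.Atomic) → (∀ t ∈ m, t.Atomic) →
          JTerm.asSetList l = JTerm.asSetList m → ∀ x ∈ l.map JTerm.asSet,
          x ∈ m.map JTerm.asSet := by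
        intro l m l3 m3 hlm x hx
        obtain ⟨t, ht, rfl⟩ := List.mem_map.1 hx
        obtain ⟨a, hta⟩ := (l3 t ht).exists_asSet
        have : a ∈ JTerm.asSetList m := hlm ▸ JTerm.mem_asSetList.2 ⟨t, ht, by simp [hta]⟩
        obtain ⟨u, hu, hau⟩ := JTerm.mem_asSetList.1 this
        obtain ⟨b, hub⟩ := (m3 u hu).exists_asSet
        rw [hub, Finset.mem_singleton] at hau
        exact List.mem_map.2 ⟨u, hu, by rw [hta, hub, hau]⟩
      have hp : (l.map JTerm.asSet).Perm (m.map JTerm.asSet) :=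
        (List.perm_ext_iff_of_nodup l4 m4).2
          fun x => ⟨hsub l m l3 m3 hlm x, hsub m l m3 l3 hlm.symm x⟩
      obtain ⟨l', h1, h2⟩ := hp.exists_map_eq
      refine .sup_of_perm h1 h2 fun t ht u hu e => ?_
      refine ih t.size (lt_of_le_of_lt (JTerm.size_le_of_mem ht) hln) (l2 t ht) (m2 u hu) ?_ ?_ e
        rfl
      · rintro rfl; cases l3 _ ht
      · rintro rfl; cases m3 _ hu
    have hc : ∀ l, Nice (.sup l) → ∀ a, JTerm.asSetList l ≠ {a} ∧ JTerm.asSetList l ≠ ∅ := by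
      refine fun l hl a => ⟨hl.asSet_ne_neg a, fun e => ?_⟩
      have := hl.two_le_card
      simp [e] at this
    cases ht with
    | zero =>
      cases hu with
      | zero => exact .refl _
      | one => exact absurd rfl hu1
      | @sup l m1 m2 m3 m4 m5 =>
        exact absurd h.symm (hc l (.sup m1 m2 m3 m4 m5) 0).2
      | _ => simp [JTerm.asSet] at h
    | one => exact absurd rfl ht1
    | var v =>
      cases hu with
      | zero => simp [JTerm.asSet] at h
      | one => exact absurd rfl hu1
      | var w =>
        obtain rfl := varC_inj (Finset.singleton_inj.1 h)
        exact .refl _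
      | @sup l m1 m2 m3 m4 m5 =>
        exact absurd h.symm (hc l (.sup m1 m2 m3 m4 m5) _).1
      | _ => exact absurd (Finset.singleton_inj.1 h) (varC_ne_negC _ _)
    | negvar v =>
      cases hu with
      | zero => simp [JTerm.asSet] at h
      | one => exact absurd rfl hu1
      | var w => exact absurd (Finset.singleton_inj.1 h).symm (varC_ne_negC _ _)
      | negvar w =>
        obtain rfl := varC_inj (Finset.singleton_inj.1 (negC_inj (Finset.singleton_inj.1 h)))
        exact .refl _
      | @sup l m1 m2 m3 m4 m5 =>
        exact absurd h.symm (hc l (.sup m1 m2 m3 m4 m5) _).1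
      | @negsup l hl =>
        exact absurd (negC_inj (Finset.singleton_inj.1 h)).symm (hc l hl _).1
    | @sup l l1 l2 l3 l4 l5 =>
      have hl : Nice (.sup l) := .sup l1 l2 l3 l4 l5
      cases hu with
      | one => exact absurd rfl hu1
      | zero => exact absurd h (hc l hl 0).2
      | var w => exact absurd h (hc l hl _).1
      | negvar w => exact absurd h (hc l hl _).1
      | negsup _ => exact absurd h (hc l hl _).1
      | @sup m m1 m2 m3 m4 m5 =>
        refine hsup l m ?_ (by simp [← hn, JTerm.size]) hl (.sup m1 m2 m3 m4 m5) h
        rintro rfl; simp at l1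
    | @negsup l hl =>
      cases hu with
      | zero => simp [JTerm.asSet] at h
      | one => exact absurd rfl hu1
      | var w => exact absurd (Finset.singleton_inj.1 h).symm (varC_ne_negC _ _)
      | negvar w => exact absurd (negC_inj (Finset.singleton_inj.1 h)) (hc l hl _).1
      | @sup m m1 m2 m3 m4 m5 =>
        exact absurd h.symm (hc m (.sup m1 m2 m3 m4 m5) _).1
      | @negsup m hm =>
        refine .neg (hsup l m ?_ ?_ hl hm (negC_inj (Finset.singleton_inj.1 h)))
        · rintro rfl; cases hl with | sup h => simp at h
        · simp only [← hn, JTerm.size]; omega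

/-! ### Irreducible terms are reduced, and conversely -/

theorem RewriteMod.neg {t v : JTerm} (h : RewriteMod t v) : RewriteMod (.neg t) (.neg v) := by
  obtain ⟨t', u', h1, h2, h3⟩ := h
  exact ⟨_, _, .neg h1, .neg h2, .neg h3⟩

theorem RewriteMod.sup {t v : JTerm} (l₁ l₂ : List JTerm) (h : RewriteMod t v) :
    RewriteMod (.sup (l₁ ++ t :: l₂)) (.sup (l₁ ++ v :: l₂)) := by
  obtain ⟨t', u', h1, h2, h3⟩ := h
  exact ⟨_, _, .sup _ _ h1, .sup _ _ h2, .sup _ _ h3⟩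

theorem RewriteMod.of_rule {t t' v : JTerm} (h : CommEq t t') (h' : Rule t' v) :
    RewriteMod t v := ⟨t', v, h, .root h', .refl v⟩

/-- Two offending arguments are moved to the front, where rule A3 expects them. -/
theorem List.exists_perm_of_not_pairwise {α : Type*} {R : α → α → Prop} {l : List α}
    (h : ¬ l.Pairwise R) : ∃ a b r, l.Perm (a :: b :: r) ∧ ¬ R a b := by
  induction l with
  | nil => exact absurd List.Pairwise.nil h
  | cons a l ih =>
    rw [List.pairwise_cons, not_and_or] at h
    rcases h with h | h
    · push Not at h
      obtain ⟨b, hb, hab⟩ := h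
      obtain ⟨x, y, rfl⟩ := List.append_of_mem hb
      exact ⟨a, b, x ++ y, List.perm_middle.cons a, hab⟩
    · obtain ⟨b, c, r, hp, hbc⟩ := ih h
      refine ⟨b, c, a :: r, ?_, hbc⟩
      exact (hp.cons a).trans ((List.Perm.swap b a _).trans ((List.Perm.swap c a r).cons b))

/-- Each way of violating `Nice` exhibits a redex. Redexes modulo commutativity are recognized by
comparing sets of codes, since the proper subterms are already known to be nice. -/
theorem Nice.of_irreducible {t : JTerm} (hp : t.Proper) (hi : ∀ v, ¬ RewriteMod t v) :
    Nice t := by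
  induction hp with
  | var v => exact .var v
  | zero => exact .zero
  | one => exact .one
  | @neg t _ ih =>
    have ht := ih fun v hv => hi _ hv.neg
    cases ht with
    | zero => exact absurd (.of_rule (.refl _) .A10) (hi _)
    | one => exact absurd (.of_rule (.refl _) .A11) (hi _)
    | var v => exact .negvar v
    | sup h1 h2 h3 h4 h5 => exact .negsup (.sup h1 h2 h3 h4 h5)
    | _ => exact absurd (.of_rule (.refl _) (.A6 _)) (hi _)
  | @sup l hne hpr ih =>
    have hnice : ∀ t ∈ l, Nice t := fun t ht => ih t ht fun v hv => by
      obtain ⟨a, b, rfl⟩ := List.append_of_mem ht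
      exact hi _ (hv.sup a b)
    have hlen : 2 ≤ l.length := by
      by_contra hlt
      match l, hne, hlt with
      | [t], _, _ => exact hi _ (.of_rule (.refl _) (.A2b t))
      | a :: b :: l, _, h => simp at h
    have hat : ∀ t ∈ l, t.Atomic := by
      intro t ht
      obtain ⟨a, b, hab⟩ := List.append_of_mem ht
      have hperm : l.Perm (t :: (a ++ b)) := hab ▸ List.perm_middle
      cases t with
      | var v => exact .var v
      | neg t => exact .neg t
      | zero =>
        refine absurd (.of_rule (.perm hperm) (.A5 _ ?_)) (hi _)
        intro h
        rw [hperm.length_eq, h] at hlen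
        simp at hlen
      | one => exact absurd (.of_rule (.perm hperm) (.A4 _)) (hi _)
      | sup m =>
        exact absurd (.of_rule (.perm (hperm.trans (List.perm_append_singleton _ _).symm))
          (.A2 _ _)) (hi _)
    have hone : ∀ t ∈ l, t ≠ .one := by rintro t ht rfl; cases hat _ ht
    have hnd : (l.map JTerm.asSet).Nodup := by
      rw [List.Nodup, List.pairwise_map]
      by_contra h
      -- Two arguments with equal sets are equal modulo commutativity, so A3 applies.
      obtain ⟨a, b, r, hab, h⟩ := List.exists_perm_of_not_pairwise h
      have ha : a ∈ l := hab.mem_iff.2 (by simp)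
      have hb : b ∈ l := hab.mem_iff.2 (by simp)
      have hc : CommEq b a := (hnice b hb).commEq_of_asSet_eq (hnice a ha) (hone b hb)
        (hone a ha) (not_not.1 h).symm
      exact hi _ (.of_rule (.trans (.perm hab) (.sup [a] r hc)) (.A3 a r))
    refine .sup hlen hnice hat hnd ?_
    refine .mk _ (fun B hB => ⟨fun hsub => ?_, ?_⟩) (fun B hB => ?_)
    · obtain ⟨t, ht, hBt⟩ := JTerm.mem_asSetList.1 hB
      obtain ⟨x, y, hxy⟩ := List.append_of_mem ht
      have hperm : l.Perm (t :: (x ++ y)) := hxy ▸ List.perm_middle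
      have hnt := hnice t ht
      cases hat t ht with
      | var v => exact varC_ne_negC v B (Finset.mem_singleton.1 hBt).symm
      | neg t =>
        obtain rfl := negC_inj (Finset.mem_singleton.1 hBt)
        cases hnt with
        | negvar v =>
          obtain ⟨u, hu, hv⟩ := JTerm.mem_asSetList.1 (hsub (show varC v ∈ _ by
            simp [JTerm.asSet]))
          obtain ⟨a, ha⟩ := (hat u hu).exists_asSet
          rw [ha, Finset.mem_singleton] at hv
          have hc : CommEq u (.var v) := (hnice u hu).commEq_of_asSet_eq (.var v) (hone u hu)
            (by simp) (by rw [ha, ← hv]; rfl)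
          -- The argument equal to the variable is not the complement itself, since commutativity
          -- preserves sizes.
          have hu' : u ∈ x ++ y := by
            have := hperm.mem_iff.1 hu
            rcases List.mem_cons.1 this with rfl | h
            · exact absurd hc.size_eq (by simp [JTerm.size])
            · exact h
          obtain ⟨p, q, hpq⟩ := List.append_of_mem hu'
          rw [hpq] at hperm
          have h2 : l.Perm (u :: .neg (.var v) :: (p ++ q)) :=
            hperm.trans ((List.perm_middle.cons _).trans (.swap _ _ _))
          exact hi _ (.of_rule (.trans (.perm h2) (.sup [] _ hc)) (.A7 _ _))
        | @negsup m hm =>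
          cases hm with | sup m1 m2 m3 m4 m5 =>
          have hkey : ∀ w ∈ m, ∃ u ∈ x ++ y, u.asSet = w.asSet := by
            intro w hw
            obtain ⟨a, ha⟩ := (m3 w hw).exists_asSet
            obtain ⟨u, hu, hv⟩ := JTerm.mem_asSetList.1 (hsub (show a ∈ _ from
              JTerm.mem_asSetList.2 ⟨w, hw, by simp [ha]⟩))
            obtain ⟨b, hb⟩ := (hat u hu).exists_asSet
            rw [hb, Finset.mem_singleton] at hv
            have he : u.asSet = w.asSet := by rw [ha, hb, hv]
            have hc : CommEq u w := (hnice u hu).commEq_of_asSet_eq (m2 w hw) (hone u hu)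
              (by rintro rfl; cases m3 _ hw) he
            refine ⟨u, ?_, he⟩
            rcases List.mem_cons.1 (hperm.mem_iff.1 hu) with rfl | h
            · have h1 := hc.size_eq
              have h2 := JTerm.size_le_of_mem hw
              simp only [JTerm.size] at h1
              omega
            · exact h
          -- The arguments of the inner join have different sets, so they can be matched injectively
          -- with other arguments of the outer join. The matched ones will be `l₁` and the remaining
          -- ones `l₂`.
          have hss : List.Subperm (m.map JTerm.asSet) ((x ++ y).map JTerm.asSet) := by
            refine List.subperm_of_subset m4 fun z hz => ?_
            obtain ⟨w, hw, rfl⟩ := List.mem_map.1 hz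
            obtain ⟨u, hu, e⟩ := hkey w hw
            exact List.mem_map.2 ⟨u, hu, e⟩
          obtain ⟨k, hk, hkl⟩ := hss
          obtain ⟨r, hr'⟩ := hkl.exists_perm_append
          have hr := hr'.trans (hk.append_right r)
          obtain ⟨l', h1, h2⟩ := hr.exists_map_eq
          obtain ⟨l₁, l₂, rfl, e1, -⟩ := List.map_eq_append_iff.1 h2
          have hsubl : ∀ z, z ∈ l₁ ∨ z ∈ l₂ → z ∈ l := fun z hz => by
            have : z ∈ x ++ y := h1.mem_iff.2 (List.mem_append.2 hz)
            exact hperm.mem_iff.2 (List.mem_cons_of_mem _ this)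
          -- A9 wants the inner arguments literally, so `l₁` is replaced by `m` modulo
          -- commutativity.
          have h4 : CommEq (.sup (l₁ ++ (l₂ ++ [.neg (.sup m)])))
              (.sup (m ++ (l₂ ++ [.neg (.sup m)]))) := by
            refine .sup_of_perm (.refl _) (by simp [e1]) ?_
            have hall : ∀ z, z ∈ l₁ ++ (l₂ ++ [.neg (.sup m)]) → Nice z ∧ z.Atomic := by
              intro z hz
              have : z ∈ l := by
                simp only [List.mem_append, List.mem_singleton] at hz
                rcases hz with h | h | h
                · exact hsubl z (.inl h)
                · exact hsubl z (.inr h)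
                · exact h ▸ ht
              exact ⟨hnice z this, hat z this⟩
            intro a ha b hb e
            have ha' := hall a ha
            have hb' : Nice b ∧ b.Atomic := by
              rcases List.mem_append.1 hb with h | h
              · exact ⟨m2 b h, m3 b h⟩
              · exact hall b (List.mem_append.2 (.inr h))
            exact ha'.1.commEq_of_asSet_eq hb'.1 (by rintro rfl; cases ha'.2)
              (by rintro rfl; cases hb'.2) e
          have h3 : l.Perm (l₁ ++ (l₂ ++ [.neg (.sup m)])) := by
            refine hperm.trans ((h1.cons _).trans ?_)
            rw [← List.append_assoc]
            exact (List.perm_append_singleton _ _).symm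
          refine hi _ (.of_rule (.trans (.perm h3) (.trans h4 (.perm ?_))) (.A9 l₂ m))
          rw [← List.append_assoc]
          exact List.perm_append_comm.append_right _
    all_goals
      obtain ⟨t, ht, hBt⟩ := JTerm.mem_asSetList.1 hB
    · exact ⟨(hnice t ht).good.nonempty hBt, (hnice t ht).good.ne_neg hBt⟩
    · exact (hnice t ht).good.sub hBt

-- Normal forms and equations decided by values in the free algebra

/-- Valuation of the variables by the generators. -/
noncomputable def FreeB.gen (v : ℕ) : FreeB := FreeB.norm {varC v}

theorem Nice.eval_one_iff {t : JTerm} (h : Nice t) : t.eval FreeB.gen = OCBSL.top ↔ t = .one := by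
  refine ⟨fun e => ?_, fun e => by subst e; rfl⟩
  by_contra h1
  have h2 : t.eval FreeB.gen = FreeB.norm t.asSet := h.eval_eq h1
  rw [h2] at e
  exact FreeB.norm_eq_top.1 e h.good

/-- The value `1` is taken only by the term `1`; every other value is a good set, and good sets are
recovered from their values by `FreeB.norm_inj`. -/
theorem Nice.commEq_iff {t u : JTerm} (ht : Nice t) (hu : Nice u) :
    CommEq t u ↔ t.eval FreeB.gen = u.eval FreeB.gen := by
  refine ⟨fun h => h.eval_eq _, fun h => ?_⟩
  by_cases h1 : t = .one
  · subst h1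
    rw [hu.eval_one_iff.1 h.symm]
    exact .refl _
  · have h2 : u ≠ .one := fun e => h1 (ht.eval_one_iff.1 (by rw [h, e]; rfl))
    refine ht.commEq_of_asSet_eq hu h1 h2 (FreeB.norm_inj ht.good ?_)
    rw [← ht.eval_eq h1, ← hu.eval_eq h2]
    exact h

theorem IsNormalFormOf.nice {t u : JTerm} (h : IsNormalFormOf u t) (ht : t.Proper) : Nice u :=
  .of_irreducible (h.proper ht) h.2

theorem Nice.proper {t : JTerm} (h : Nice t) : t.Proper := by
  induction h with
  | zero => exact .zero
  | one => exact .one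
  | var v => exact .var v
  | negvar v => exact .neg (.var v)
  | sup h1 _ _ _ _ ih => exact .sup (by rintro rfl; simp at h1) ih
  | negsup _ ih => exact .neg ih

/-- A normal form of `v` would have the value of `t`, hence equal `t` modulo commutativity and have
its size, although a rewrite step has lowered the size. -/
theorem Nice.irreducible {t : JTerm} (h : Nice t) (v : JTerm) : ¬ RewriteMod t v := fun hv => by
  have hle : ∀ a b, Relation.ReflTransGen RewriteMod a b → b.size ≤ a.size := fun a b hab => by
    induction hab with
    | refl => rfl
    | tail _ h ih => exact h.size_lt.le.trans ih
  obtain ⟨u, hu⟩ := exists_isNormalFormOf v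
  have hc : CommEq t u := (h.commEq_iff (hu.nice (hv.proper h.proper))).2
    ((hv.eval_eq _).trans (hu.eval_eq _))
  obtain ⟨⟨u', h1, h2⟩, -⟩ := hu
  have := hle _ _ h1
  rw [h2.size_eq, ← hc.size_eq] at this
  exact absurd hv.size_lt (by omega)

/-- This frees the correctness proof of the algorithm from rewriting: only the shape and the value
of the output matter. -/
theorem Nice.isNormalFormOf {t u : JTerm} (ht : t.Proper) (hu : Nice u)
    (h : t.eval FreeB.gen = u.eval FreeB.gen) : IsNormalFormOf u t := by
  obtain ⟨w, hw⟩ := exists_isNormalFormOf t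
  have hc : CommEq w u := ((hw.nice ht).commEq_iff hu).2 ((hw.eval_eq _).symm.trans h)
  obtain ⟨⟨u', h1, h2⟩, -⟩ := hw
  exact ⟨⟨u', h1, h2.trans hc⟩, hu.irreducible⟩

/-- Both normal forms inherit the value of `t` in `FreeB`, which separates nice terms; no confluence
argument is needed. -/
theorem IsNormalFormOf.commEq {t u u' : JTerm} (ht : t.Proper) (h : IsNormalFormOf u t)
    (h' : IsNormalFormOf u' t) : CommEq u u' :=
  ((h.nice ht).commEq_iff (h'.nice ht)).2 ((h.eval_eq _).symm.trans (h'.eval_eq _))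

theorem ocbslEq_iff_commEq {t₁ t₂ : BTerm} {u₁ u₂ : JTerm} (h₁ : IsNormalFormOf u₁ t₁.toJTerm)
    (h₂ : IsNormalFormOf u₂ t₂.toJTerm) : OCBSLEq t₁ t₂ ↔ CommEq u₁ u₂ := by
  refine ⟨fun h => ?_, fun h S _ ρ => ?_⟩
  · rw [(h₁.nice t₁.toJTerm_proper).commEq_iff (h₂.nice t₂.toJTerm_proper), ← h₁.eval_eq,
      ← h₂.eval_eq, BTerm.eval_toJTerm, BTerm.eval_toJTerm]
    exact h FreeB _
  · rw [← BTerm.eval_toJTerm, ← BTerm.eval_toJTerm, h₁.eval_eq, h₂.eval_eq, h.eval_eq]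

theorem ocbslEq_iff_eval {t₁ t₂ : BTerm} :
    OCBSLEq t₁ t₂ ↔ t₁.eval FreeB.gen = t₂.eval FreeB.gen := by
  obtain ⟨u₁, h₁⟩ := exists_isNormalFormOf t₁.toJTerm
  obtain ⟨u₂, h₂⟩ := exists_isNormalFormOf t₂.toJTerm
  rw [ocbslEq_iff_commEq h₁ h₂, (h₁.nice t₁.toJTerm_proper).commEq_iff
    (h₂.nice t₂.toJTerm_proper), ← h₁.eval_eq, ← h₂.eval_eq, BTerm.eval_toJTerm,
    BTerm.eval_toJTerm]

/-! ### Executions without a bound on the words -/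

/-- Execution of a program without a bound on the words. -/
inductive Run : RAMProg → RAMState → RAMState → ℕ → Prop
  | skip (s : RAMState) : Run .skip s s 1
  | assign (s : RAMState) (x : ℕ) (e : RAMExpr) :
      Run (.assign x e) s (s.setReg x (e.val s)) (e.cost + 1)
  | store (s : RAMState) (a : ℕ) (i e : RAMExpr) :
      Run (.store a i e) s (s.setArr a (i.val s) (e.val s)) (i.cost + e.cost + 1)
  | seq {p q : RAMProg} {s s' s'' : RAMState} {k k' : ℕ} :
      Run p s s' k → Run q s' s'' k' → Run (.seq p q) s s'' (k + k')
  | iteTrue {e : RAMExpr} {p q : RAMProg} {s s' : RAMState} {k : ℕ} :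
      e.val s ≠ 0 → Run p s s' k → Run (.ite e p q) s s' (e.cost + k + 1)
  | iteFalse {e : RAMExpr} {p q : RAMProg} {s s' : RAMState} {k : ℕ} :
      e.val s = 0 → Run q s s' k → Run (.ite e p q) s s' (e.cost + k + 1)
  | loopDone {e : RAMExpr} {p : RAMProg} {s : RAMState} :
      e.val s = 0 → Run (.loop e p) s s (e.cost + 1)
  | loopStep {e : RAMExpr} {p : RAMProg} {s s' s'' : RAMState} {k k' : ℕ} :
      e.val s ≠ 0 → Run p s s' k → Run (.loop e p) s' s'' k' →
      Run (.loop e p) s s'' (e.cost + k + k' + 1)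

/-- The sum of the constants of an expression. -/
def RAMExpr.csum : RAMExpr → ℕ
  | .const c => c
  | .reg _ => 0
  | .load _ i => i.csum
  | .add e f => e.csum + f.csum
  | .sub e f => e.csum + f.csum
  | .mul e f => e.csum + f.csum
  | .lt e f => e.csum + f.csum
  | .eq e f => e.csum + f.csum

/-- Expressions whose value exceeds the words of the state at most by the constants in them. -/
inductive RAMExpr.Lin : RAMExpr → Prop
  | const (c : ℕ) : Lin (.const c)
  | reg (x : ℕ) : Lin (.reg x)
  | load (a : ℕ) (i : RAMExpr) : Lin (.load a i)
  | addConst {e : RAMExpr} (c : ℕ) : Lin e → Lin (.add e (.const c))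
  | sub {e : RAMExpr} (f : RAMExpr) : Lin e → Lin (.sub e f)
  -- An arbitrary value becomes harmless when multiplied by the test that it is smaller than a
  -- harmless one.
  | clamp (e : RAMExpr) {g : RAMExpr} : Lin g → Lin (.mul (.lt e g) e)
  | lt (e f : RAMExpr) : Lin (.lt e f)
  | eq (e f : RAMExpr) : Lin (.eq e f)

/-- All words of the state are at most `M`. -/
def RAMState.Le (s : RAMState) (M : ℕ) : Prop :=
  (∀ x, s.reg x ≤ M) ∧ ∀ a i, s.arr a i ≤ M

theorem RAMState.Le.mono {s : RAMState} {M N : ℕ} (h : s.Le M) (hMN : M ≤ N) : s.Le N :=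
  ⟨fun x => (h.1 x).trans hMN, fun a i => (h.2 a i).trans hMN⟩

theorem RAMState.Le.setReg {s : RAMState} {M v : ℕ} (h : s.Le M) (x : ℕ) (hv : v ≤ M) :
    (s.setReg x v).Le M := by
  refine ⟨fun y => ?_, h.2⟩
  simp only [RAMState.setReg, Function.update_apply]
  split
  · exact hv
  · exact h.1 y

theorem RAMState.Le.setArr {s : RAMState} {M v : ℕ} (h : s.Le M) (a i : ℕ) (hv : v ≤ M) :
    (s.setArr a i v).Le M := by
  refine ⟨h.1, fun b j => ?_⟩
  simp only [RAMState.setArr, Function.update_apply]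
  split
  · rw [Function.update_apply]
    split
    · exact hv
    · exact h.2 a j
  · exact h.2 b j

theorem RAMExpr.Lin.val_le {e : RAMExpr} (he : e.Lin) {s : RAMState} {M : ℕ} (h : s.Le M)
    (hM : 1 ≤ M) : e.val s ≤ M + e.csum := by
  induction he with
  | const c => simp [val, csum]
  | reg x => exact (h.1 x).trans (by simp)
  | load a i => exact (h.2 a _).trans (by simp)
  | addConst c _ ih => simp only [val, csum]; omega
  | sub f _ ih => simp only [val, csum]; omega
  | clamp e _ ih =>
    simp only [val, csum]
    split
    · omega
    · simp
  | lt e f => simp only [val]; split <;> omega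
  | eq e f => simp only [val]; split <;> omega

theorem RAMExpr.Fits.mono {e : RAMExpr} {s : RAMState} {B B' : ℕ} (hB : B ≤ B')
    (h : e.Fits B s) : e.Fits B' s := by
  induction e with
  | const c => exact le_trans h hB
  | reg x => exact le_trans h hB
  | load a i ih => exact ⟨ih h.1, h.2.trans hB⟩
  | sub e f ihe ihf => exact ⟨ihe h.1, ihf h.2⟩
  | _ e f ihe ihf => exact ⟨ihe h.1, ihf h.2.1, h.2.2.trans hB⟩

/-- Intermediate results may be products, but numbers up to `A ^ i` and `A ^ j` have sum and product
at most `A ^ (i + j + 1)`, and costs add up in the same way. -/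
theorem RAMExpr.fits_pow {s : RAMState} {M A : ℕ} (h : s.Le M) (hMA : M ≤ A) (hA : 2 ≤ A)
    (e : RAMExpr) (hc : e.csum ≤ A) : e.Fits (A ^ e.cost) s ∧ e.val s ≤ A ^ e.cost := by
  have hpow : ∀ {i j : ℕ}, i ≤ j → A ^ i ≤ A ^ j := fun hij => Nat.pow_le_pow_right (by omega) hij
  have hone : ∀ i : ℕ, 1 ≤ A ^ i := fun i => Nat.one_le_pow _ _ (by omega)
  have hself : ∀ i : ℕ, 1 ≤ i → A ≤ A ^ i := fun i hi => by
    simpa using hpow hi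
  have hmul : ∀ {x y i j : ℕ}, x ≤ A ^ i → y ≤ A ^ j → x * y ≤ A ^ (i + j + 1) := by
    intro x y i j hx hy
    calc x * y ≤ A ^ i * A ^ j := Nat.mul_le_mul hx hy
      _ = A ^ (i + j) := (pow_add _ _ _).symm
      _ ≤ _ := hpow (by omega)
  have hadd : ∀ {x y i j : ℕ}, x ≤ A ^ i → y ≤ A ^ j → x + y ≤ A ^ (i + j + 1) := by
    intro x y i j hx hy
    calc x + y ≤ A ^ (i + j) + A ^ (i + j) :=
          add_le_add (hx.trans (hpow (by omega))) (hy.trans (hpow (by omega)))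
      _ = A ^ (i + j) * 2 := by ring
      _ ≤ A ^ (i + j) * A := Nat.mul_le_mul_left _ hA
      _ = _ := (pow_succ _ _).symm
  induction e with
  | const c => exact ⟨by simpa [Fits, cost, csum] using hc, by simpa [val, cost, csum] using hc⟩
  | reg x => simpa [Fits, val, cost] using (h.1 x).trans hMA
  | load a i ih =>
    have h1 := ih hc
    have h2 : s.arr a (i.val s) ≤ A ^ (i.cost + 1) :=
      ((h.2 _ _).trans hMA).trans (hself _ (by omega))
    exact ⟨⟨h1.1.mono (hpow (Nat.le_succ _)), h2⟩, h2⟩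
  | _ e f ihe ihf =>
    simp only [csum] at hc
    have he := ihe (by omega)
    have hf := ihf (by omega)
    have he' := he.1.mono (hpow (show e.cost ≤ e.cost + f.cost + 1 by omega))
    have hf' := hf.1.mono (hpow (show f.cost ≤ e.cost + f.cost + 1 by omega))
    simp only [Fits, val, cost]
    first
    | exact ⟨⟨he', hf', hadd he.2 hf.2⟩, hadd he.2 hf.2⟩
    | exact ⟨⟨he', hf', hmul he.2 hf.2⟩, hmul he.2 hf.2⟩
    | exact ⟨⟨he', hf'⟩, (Nat.sub_le _ _).trans ((Nat.le_add_right _ _).trans (hadd he.2 hf.2))⟩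
    | refine ⟨⟨he', hf', hone _⟩, ?_⟩
      split
      · exact hone _
      · simp

namespace RAMProg

/-- The sum of the constants of a program. -/
def csum : RAMProg → ℕ
  | .skip => 0
  | .assign _ e => e.csum
  | .store _ i e => i.csum + e.csum
  | .seq p q => p.csum + q.csum
  | .ite e p q => e.csum + p.csum + q.csum
  | .loop e p => e.csum + p.csum

/-- The sum of the costs of the expressions of a program. -/
def deg : RAMProg → ℕ
  | .skip => 0
  | .assign _ e => e.cost
  | .store _ i e => i.cost + e.cost
  | .seq p q => p.deg + q.deg
  | .ite e p q => e.cost + p.deg + q.deg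
  | .loop e p => e.cost + p.deg

/-- All expressions written to registers or arrays are `RAMExpr.Lin`. -/
def Lin : RAMProg → Prop
  | .skip => True
  | .assign _ e => e.Lin
  | .store _ _ e => e.Lin
  | .seq p q => p.Lin ∧ q.Lin
  | .ite _ p q => p.Lin ∧ q.Lin
  | .loop _ p => p.Lin

/-- The registers written by a program. -/
def regs : RAMProg → List ℕ
  | .skip => []
  | .assign x _ => [x]
  | .store _ _ _ => []
  | .seq p q => p.regs ++ q.regs
  | .ite _ p q => p.regs ++ q.regs
  | .loop _ p => p.regs

/-- The arrays written by a program. -/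
def arrs : RAMProg → List ℕ
  | .skip => []
  | .assign _ _ => []
  | .store a _ _ => [a]
  | .seq p q => p.arrs ++ q.arrs
  | .ite _ p q => p.arrs ++ q.arrs
  | .loop _ p => p.arrs

/-- Sequential composition of a list of programs. -/
def block : List RAMProg → RAMProg
  | [] => .skip
  | p :: l => .seq p (block l)

end RAMProg

/-- Every write raises the largest word by at most the constants of the program, so words grow
linearly with time. A bound on the time thus yields a bound on the words, and correctness can be
shown without one. -/
theorem Run.exec {p : RAMProg} {s s' : RAMState} {k : ℕ} (h : Run p s s' k) :
    ∀ {c d M B : ℕ}, p.Lin → p.csum ≤ c → p.deg ≤ d → s.Le M → 1 ≤ M →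
      (M + k * c + c + 2) ^ d ≤ B → RAMExec B p s s' k ∧ s'.Le (M + k * c) := by
  have hfit : ∀ {s : RAMState} {c d M B k : ℕ} (e : RAMExpr), s.Le M → e.csum ≤ c →
      e.cost ≤ d → (M + k * c + c + 2) ^ d ≤ B → e.Fits B s := by
    intro s c d M B k e hM hc hd hB
    refine (RAMExpr.fits_pow hM (A := M + k * c + c + 2) (by omega) (by omega) e
      (by omega)).1.mono (le_trans ?_ hB)
    exact Nat.pow_le_pow_right (by omega) hd
  induction h with
  | skip s => exact fun _ _ _ hM _ _ => ⟨.skip s, hM.mono (Nat.le_add_right _ _)⟩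
  | assign s x e =>
    intro c d M B hl hc hd hM h1 hB
    refine ⟨.assign s x e (hfit (c := c) (d := d) e hM hc hd hB), ?_⟩
    have : c ≤ (e.cost + 1) * c := Nat.le_mul_of_pos_left _ (by omega)
    exact (hM.mono (Nat.le_add_right _ _)).setReg x ((hl.val_le hM h1).trans
      (by have : e.csum ≤ c := hc; omega))
  | store s a i e =>
    intro c d M B hl hc hd hM h1 hB
    simp only [RAMProg.csum, RAMProg.deg] at hc hd
    refine ⟨.store s a i e (hfit (c := c) (d := d) i hM (by omega) (by omega) hB)
      (hfit (c := c) (d := d) e hM (by omega) (by omega) hB), ?_⟩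
    have : c ≤ (i.cost + e.cost + 1) * c := Nat.le_mul_of_pos_left _ (by omega)
    exact (hM.mono (Nat.le_add_right _ _)).setArr a _ ((RAMExpr.Lin.val_le hl hM h1).trans
      (by omega))
  | @seq p q s s' s'' k k' h h' ih ih' =>
    intro c d M B hl hc hd hM h1 hB
    simp only [RAMProg.csum, RAMProg.deg] at hc hd
    have e1 : (k + k') * c = k * c + k' * c := add_mul _ _ _
    rw [e1] at hB ⊢
    obtain ⟨r1, m1⟩ := ih (c := c) (d := d) hl.1 (by omega) (by omega) hM h1
      ((Nat.pow_le_pow_left (by omega) d).trans hB)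
    obtain ⟨r2, m2⟩ := ih' (c := c) (d := d) hl.2 (by omega) (by omega) m1 (by omega)
      ((Nat.pow_le_pow_left (by omega) d).trans hB)
    exact ⟨.seq r1 r2, m2.mono (by omega)⟩
  | @iteTrue e p q s s' k he h ih =>
    intro c d M B hl hc hd hM h1 hB
    simp only [RAMProg.csum, RAMProg.deg] at hc hd
    have e1 : (e.cost + k + 1) * c = e.cost * c + k * c + c := by ring
    rw [e1] at hB ⊢
    obtain ⟨r1, m1⟩ := ih (c := c) (d := d) hl.1 (by omega) (by omega) hM h1
      ((Nat.pow_le_pow_left (by omega) d).trans hB)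
    refine ⟨.iteTrue (hfit (c := c) (d := d) (k := e.cost + k + 1) e hM (by omega) (by omega) (by rwa [e1])) he r1,
      m1.mono (by omega)⟩
  | @iteFalse e p q s s' k he h ih =>
    intro c d M B hl hc hd hM h1 hB
    simp only [RAMProg.csum, RAMProg.deg] at hc hd
    have e1 : (e.cost + k + 1) * c = e.cost * c + k * c + c := by ring
    rw [e1] at hB ⊢
    obtain ⟨r1, m1⟩ := ih (c := c) (d := d) hl.2 (by omega) (by omega) hM h1
      ((Nat.pow_le_pow_left (by omega) d).trans hB)
    refine ⟨.iteFalse (hfit (c := c) (d := d) (k := e.cost + k + 1) e hM (by omega) (by omega) (by rwa [e1])) he r1,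
      m1.mono (by omega)⟩
  | @loopDone e p s he =>
    intro c d M B hl hc hd hM h1 hB
    simp only [RAMProg.csum, RAMProg.deg] at hc hd
    exact ⟨.loopDone (hfit (c := c) (d := d) e hM (by omega) (by omega) hB) he, hM.mono (Nat.le_add_right _ _)⟩
  | @loopStep e p s s' s'' k k' he h h' ih ih' =>
    intro c d M B hl hc hd hM h1 hB
    have hc' := hc
    have hd' := hd
    simp only [RAMProg.csum, RAMProg.deg] at hc hd
    have e1 : (e.cost + k + k' + 1) * c = e.cost * c + k * c + k' * c + c := by ring
    rw [e1] at hB ⊢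
    obtain ⟨r1, m1⟩ := ih (c := c) (d := d) hl (by omega) (by omega) hM h1
      ((Nat.pow_le_pow_left (by omega) d).trans hB)
    obtain ⟨r2, m2⟩ := ih' (c := c) (d := d) hl hc' hd' m1 (by omega)
      ((Nat.pow_le_pow_left (by omega) d).trans hB)
    exact ⟨.loopStep (hfit (c := c) (d := d) (k := e.cost + k + k' + 1) e hM (by omega) (by omega) (by rwa [e1]))
      he r1 r2, m2.mono (by omega)⟩

/-! ### Frames -/

/-- `s'` agrees with `s` on all registers and arrays that `p` does not write. -/
structure Frame (p : RAMProg) (s s' : RAMState) : Prop where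
  reg : ∀ x, x ∉ p.regs → s'.reg x = s.reg x
  arr : ∀ a, a ∉ p.arrs → s'.arr a = s.arr a

theorem Frame.refl (p : RAMProg) (s : RAMState) : Frame p s s := ⟨fun _ _ => rfl, fun _ _ => rfl⟩

theorem Frame.trans {p : RAMProg} {s s' s'' : RAMState} (h : Frame p s s') (h' : Frame p s' s'') :
    Frame p s s'' :=
  ⟨fun x hx => (h'.reg x hx).trans (h.reg x hx), fun a ha => (h'.arr a ha).trans (h.arr a ha)⟩

theorem Frame.mono {p q : RAMProg} {s s' : RAMState} (h : Frame p s s')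
    (hr : p.regs ⊆ q.regs) (ha : p.arrs ⊆ q.arrs) : Frame q s s' :=
  ⟨fun x hx => h.reg x fun h => hx (hr h), fun a hx => h.arr a fun h => hx (ha h)⟩

theorem Run.frame {p : RAMProg} {s s' : RAMState} {k : ℕ} (h : Run p s s' k) : Frame p s s' := by
  induction h with
  | skip s => exact .refl _ _
  | assign s x e =>
    refine ⟨fun y hy => ?_, fun _ _ => rfl⟩
    exact Function.update_of_ne (by simpa [RAMProg.regs] using hy) _ _
  | store s a i e =>
    refine ⟨fun _ _ => rfl, fun b hb => ?_⟩
    exact Function.update_of_ne (by simpa [RAMProg.arrs] using hb) _ _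
  | seq _ _ ih ih' =>
    exact (ih.mono (List.subset_append_left _ _) (List.subset_append_left _ _)).trans
      (ih'.mono (List.subset_append_right _ _) (List.subset_append_right _ _))
  | iteTrue _ _ ih => exact ih.mono (List.subset_append_left _ _) (List.subset_append_left _ _)
  | iteFalse _ _ ih => exact ih.mono (List.subset_append_right _ _) (List.subset_append_right _ _)
  | loopDone _ => exact .refl _ _
  | loopStep _ _ _ ih ih' => exact Frame.trans (p := .loop _ _) ⟨ih.reg, ih.arr⟩ ih'

/-! ### Total correctness with time -/

/-- Started in `s`, the program halts after `k` steps in a state `s'` with `Q s' k`. -/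
def wp (p : RAMProg) (s : RAMState) (Q : RAMState → ℕ → Prop) : Prop :=
  ∃ s' k, Run p s s' k ∧ Q s' k

theorem wp.mono {p : RAMProg} {s : RAMState} {Q Q' : RAMState → ℕ → Prop} (h : wp p s Q)
    (hQ : ∀ s' k, Frame p s s' → Q s' k → Q' s' k) : wp p s Q' := by
  obtain ⟨s', k, h1, h2⟩ := h
  exact ⟨s', k, h1, hQ s' k h1.frame h2⟩

theorem wp_skip {s : RAMState} {Q : RAMState → ℕ → Prop} : wp .skip s Q ↔ Q s 1 :=
  ⟨fun ⟨_, _, h, hq⟩ => by cases h; exact hq, fun h => ⟨_, _, .skip s, h⟩⟩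

theorem wp_assign {s : RAMState} {x : ℕ} {e : RAMExpr} {Q : RAMState → ℕ → Prop} :
    wp (.assign x e) s Q ↔ Q (s.setReg x (e.val s)) (e.cost + 1) :=
  ⟨fun ⟨_, _, h, hq⟩ => by cases h; exact hq, fun h => ⟨_, _, .assign s x e, h⟩⟩

theorem wp_store {s : RAMState} {a : ℕ} {i e : RAMExpr} {Q : RAMState → ℕ → Prop} :
    wp (.store a i e) s Q ↔ Q (s.setArr a (i.val s) (e.val s)) (i.cost + e.cost + 1) :=
  ⟨fun ⟨_, _, h, hq⟩ => by cases h; exact hq, fun h => ⟨_, _, .store s a i e, h⟩⟩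

theorem wp_seq {s : RAMState} {p q : RAMProg} {Q : RAMState → ℕ → Prop} :
    wp (.seq p q) s Q ↔ wp p s fun s' k => wp q s' fun s'' k' => Q s'' (k + k') :=
  ⟨fun ⟨_, _, h, hq⟩ => by cases h with | seq h1 h2 => exact ⟨_, _, h1, _, _, h2, hq⟩,
    fun ⟨_, _, h1, _, _, h2, hq⟩ => ⟨_, _, .seq h1 h2, hq⟩⟩

theorem wp_ite {s : RAMState} {e : RAMExpr} {p q : RAMProg} {Q : RAMState → ℕ → Prop} :
    wp (.ite e p q) s Q ↔ (e.val s ≠ 0 → wp p s fun s' k => Q s' (e.cost + k + 1)) ∧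
      (e.val s = 0 → wp q s fun s' k => Q s' (e.cost + k + 1)) := by
  constructor
  · rintro ⟨_, _, h, hq⟩
    cases h with
    | iteTrue h1 h2 => exact ⟨fun _ => ⟨_, _, h2, hq⟩, fun h => absurd h h1⟩
    | iteFalse h1 h2 => exact ⟨fun h => absurd h1 h, fun _ => ⟨_, _, h2, hq⟩⟩
  · rintro ⟨h1, h2⟩
    by_cases h : e.val s = 0
    · obtain ⟨_, _, h3, hq⟩ := h2 h
      exact ⟨_, _, .iteFalse h h3, hq⟩
    · obtain ⟨_, _, h3, hq⟩ := h1 h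
      exact ⟨_, _, .iteTrue h h3, hq⟩

theorem wp_block_nil {s : RAMState} {Q : RAMState → ℕ → Prop} :
    wp (.block []) s Q ↔ Q s 1 := wp_skip

theorem wp_block_cons {s : RAMState} {p : RAMProg} {l : List RAMProg}
    {Q : RAMState → ℕ → Prop} :
    wp (.block (p :: l)) s Q ↔ wp p s fun s' k => wp (.block l) s' fun s'' k' => Q s'' (k + k') :=
  wp_seq

/-- The number in the invariant is a time budget. Each round lowers it by at least the cost of the
round, which is positive, so the budget bounds the time and also proves termination. -/
theorem wp_loop {e : RAMExpr} {p : RAMProg} {s : RAMState} (I : ℕ → RAMState → Prop) {b : ℕ}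
    (h : ∀ b s', I b s' → Frame p s s' → e.val s' ≠ 0 →
      wp p s' fun s'' k => ∃ b', I b' s'' ∧ k + e.cost + 1 + b' ≤ b)
    (h0 : I b s) :
    wp (.loop e p) s fun s' k => ∃ b', I b' s' ∧ e.val s' = 0 ∧ k + b' ≤ b + e.cost + 1 := by
  suffices H : ∀ b s', I b s' → Frame p s s' → wp (.loop e p) s' fun s'' k =>
      ∃ b', I b' s'' ∧ e.val s'' = 0 ∧ k + b' ≤ b + e.cost + 1 from H b s h0 (.refl _ _)
  intro b
  induction b using Nat.strong_induction_on with
  | _ b ih =>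
    intro s' hI hf
    by_cases he : e.val s' = 0
    · exact ⟨s', _, .loopDone he, b, hI, he, by omega⟩
    · obtain ⟨s1, k1, h1, b1, hI1, hk1⟩ := h b s' hI hf he
      obtain ⟨s2, k2, h2, b2, hI2, he2, hk2⟩ := ih b1 (by omega) s1 hI1 (hf.trans h1.frame)
      exact ⟨s2, _, .loopStep he h1 h2, b2, hI2, he2, by omega⟩

/-- Zero or more iterations of a loop, in time `k` together. -/
inductive Iter (e : RAMExpr) (p : RAMProg) : RAMState → RAMState → ℕ → Prop
  | refl (s : RAMState) : Iter e p s s 0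
  | step {s s' s'' : RAMState} {k k' : ℕ} : e.val s ≠ 0 → Run p s s' k → Iter e p s' s'' k' →
      Iter e p s s'' (e.cost + 1 + k + k')

/-- The evaluation of a subterm is a segment of the run of one main loop; segments are composed
before the loop is known to end. -/
theorem Iter.trans {e : RAMExpr} {p : RAMProg} {s s' s'' : RAMState} {k k' : ℕ}
    (h : Iter e p s s' k) (h' : Iter e p s' s'' k') : Iter e p s s'' (k + k') := by
  induction h with
  | refl s => simpa using h'
  | @step s1 s2 s3 k1 k2 he hr hi ih => rw [add_assoc]; exact .step he hr (ih h')

theorem Iter.run {e : RAMExpr} {p : RAMProg} {s s' : RAMState} {k : ℕ} (h : Iter e p s s' k)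
    (he : e.val s' = 0) : Run (.loop e p) s s' (k + e.cost + 1) := by
  induction h with
  | refl s => simpa using Run.loopDone he
  | @step s1 s2 s3 k1 k2 h1 hr hi ih =>
    have := Run.loopStep h1 hr (ih he)
    convert this using 1
    ring

theorem Iter.frame {e : RAMExpr} {p : RAMProg} {s s' : RAMState} {k : ℕ} (h : Iter e p s s' k) :
    Frame p s s' := by
  induction h with
  | refl s => exact .refl _ _
  | step _ hr _ ih => exact hr.frame.trans ih

-- Simplification rules for states and values of expressions

section

variable (s : RAMState) (x y v a b i : ℕ)

theorem RAMState.setReg_reg : (s.setReg x v).reg y = if y = x then v else s.reg y := by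
  simp [RAMState.setReg, Function.update_apply]

theorem RAMState.setReg_arr : (s.setReg x v).arr = s.arr := rfl

theorem RAMState.setArr_reg : (s.setArr a i v).reg = s.reg := rfl

theorem RAMState.setArr_arr :
    (s.setArr a i v).arr b = if b = a then Function.update (s.arr a) i v else s.arr b := by
  simp [RAMState.setArr, Function.update_apply]

end

/-- The truth value of `a < b`. -/
def ltN (a b : ℕ) : ℕ := if a < b then 1 else 0

/-- The truth value of `a = b`. -/
def eqN (a b : ℕ) : ℕ := if a = b then 1 else 0

theorem ltN_eq_zero {a b : ℕ} : ltN a b = 0 ↔ b ≤ a := by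
  unfold ltN; split <;> simp_all

theorem eqN_eq_zero {a b : ℕ} : eqN a b = 0 ↔ a ≠ b := by
  unfold eqN; split <;> simp_all

theorem ltN_mul {a b : ℕ} (h : a < b) : ltN a b * a = a := by
  rw [ltN, if_pos h, one_mul]

namespace RAMExpr

variable (s : RAMState) (x : ℕ) (e f : RAMExpr)

theorem val_const : (const x).val s = x := rfl
theorem val_reg : (reg x).val s = s.reg x := rfl
theorem val_load : (load x e).val s = s.arr x (e.val s) := rfl
theorem val_add : (add e f).val s = e.val s + f.val s := rfl
theorem val_sub : (sub e f).val s = e.val s - f.val s := rfl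
theorem val_mul : (mul e f).val s = e.val s * f.val s := rfl
theorem val_lt : (lt e f).val s = ltN (e.val s) (f.val s) := rfl
theorem val_eq : (eq e f).val s = eqN (e.val s) (f.val s) := rfl

end RAMExpr

/-! ### Hash-consed binary tries -/

/-- A table of trie nodes `1, …, tc` (`0` is the empty trie): the set stored at a node contains `1`
if its flag is `1`, the doubles of the elements of its left subtrie, and the doubles plus one
of the elements of its right subtrie.  `co` finds the node with given contents. -/
structure Trie where
  tc : ℕ
  fl : ℕ → ℕ
  le : ℕ → ℕ
  ri : ℕ → ℕ
  co : ℕ → ℕ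

/-- The index of a node with given contents in the table `Trie.co`. -/
def Trie.key (f l r : ℕ) : ℕ := (l + l + f + r) * (l + l + f + r) + r

/-- With `a = 2 l + f + r` the key lies between `a ^ 2` and `a ^ 2 + a`, so it determines `a`, then
`r`, and then `l` and the bit `f`. -/
theorem Trie.key_inj {f l r f' l' r' : ℕ} (hf : f ≤ 1) (hf' : f' ≤ 1)
    (h : Trie.key f l r = Trie.key f' l' r') : f = f' ∧ l = l' ∧ r = r' := by
  unfold Trie.key at h
  have h1 : l + l + f + r = l' + l' + f' + r' := by
    rcases lt_trichotomy (l + l + f + r) (l' + l' + f' + r') with h2 | h2 | h2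
    · nlinarith
    · exact h2
    · nlinarith
  rw [h1] at h
  omega

/-- `x` is in the set stored at node `t`. -/
def Trie.Mem (τ : Trie) (t x : ℕ) : Prop :=
  if x ≤ 1 then x = 1 ∧ τ.fl t = 1
  else if x % 2 = 1 then τ.Mem (τ.ri t) (x / 2) else τ.Mem (τ.le t) (x / 2)
termination_by x
decreasing_by all_goals omega

/-- Children have smaller numbers than their parents, which permits induction on nodes. No node
except `0` is empty, and `co` is inverse to taking contents; an entry `0` of `co` means that there
is no such node, so memory filled with zeros is a valid start. -/
structure Trie.WF (τ : Trie) : Prop where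
  fl0 : τ.fl 0 = 0
  le0 : τ.le 0 = 0
  ri0 : τ.ri 0 = 0
  fl_le : ∀ t, t ≤ τ.tc → τ.fl t ≤ 1
  le_lt : ∀ t, t ≠ 0 → t ≤ τ.tc → τ.le t < t
  ri_lt : ∀ t, t ≠ 0 → t ≤ τ.tc → τ.ri t < t
  ne : ∀ t, t ≠ 0 → t ≤ τ.tc → τ.fl t ≠ 0 ∨ τ.le t ≠ 0 ∨ τ.ri t ≠ 0
  co_key : ∀ t, t ≠ 0 → t ≤ τ.tc → τ.co (Trie.key (τ.fl t) (τ.le t) (τ.ri t)) = t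
  key_co : ∀ k, τ.co k ≠ 0 → τ.co k ≤ τ.tc ∧
    Trie.key (τ.fl (τ.co k)) (τ.le (τ.co k)) (τ.ri (τ.co k)) = k

/-- `τ'` has the nodes of `τ` and possibly more. -/
structure Trie.Ext (τ τ' : Trie) : Prop where
  tc : τ.tc ≤ τ'.tc
  fl : ∀ t ≤ τ.tc, τ'.fl t = τ.fl t
  le : ∀ t ≤ τ.tc, τ'.le t = τ.le t
  ri : ∀ t ≤ τ.tc, τ'.ri t = τ.ri t

namespace Trie

theorem Ext.refl (τ : Trie) : Ext τ τ := ⟨le_rfl, fun _ _ => rfl, fun _ _ => rfl, fun _ _ => rfl⟩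

theorem Ext.trans {τ τ' τ'' : Trie} (h : Ext τ τ') (h' : Ext τ' τ'') : Ext τ τ'' :=
  ⟨h.tc.trans h'.tc, fun t ht => (h'.fl t (ht.trans h.tc)).trans (h.fl t ht),
    fun t ht => (h'.le t (ht.trans h.tc)).trans (h.le t ht),
    fun t ht => (h'.ri t (ht.trans h.tc)).trans (h.ri t ht)⟩

theorem WF.le_le {τ : Trie} (h : τ.WF) {t : ℕ} (ht : t ≤ τ.tc) : τ.le t ≤ τ.tc := by
  by_cases h0 : t = 0
  · simp [h0, h.le0]
  · exact (h.le_lt t h0 ht).le.trans ht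

theorem WF.ri_le {τ : Trie} (h : τ.WF) {t : ℕ} (ht : t ≤ τ.tc) : τ.ri t ≤ τ.tc := by
  by_cases h0 : t = 0
  · simp [h0, h.ri0]
  · exact (h.ri_lt t h0 ht).le.trans ht

theorem Ext.mem_iff {τ τ' : Trie} (h : Ext τ τ') (hw : τ.WF) {t : ℕ} (ht : t ≤ τ.tc) (x : ℕ) :
    τ'.Mem t x ↔ τ.Mem t x := by
  induction x using Nat.strong_induction_on generalizing t with
  | _ x ih =>
    rw [Mem, Mem.eq_1 τ]
    by_cases h1 : x ≤ 1
    · rw [if_pos h1, if_pos h1, h.fl t ht]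
    · rw [if_neg h1, if_neg h1]
      split
      · rw [h.ri t ht]
        exact ih _ (by omega) (hw.ri_le ht)
      · rw [h.le t ht]
        exact ih _ (by omega) (hw.le_le ht)

theorem not_mem_zero (τ : Trie) (t : ℕ) : ¬ τ.Mem t 0 := by
  rw [Mem]; simp

theorem mem_one {τ : Trie} {t : ℕ} : τ.Mem t 1 ↔ τ.fl t = 1 := by
  rw [Mem]; simp

theorem mem_double {τ : Trie} {t x : ℕ} (hx : x ≠ 0) : τ.Mem t (2 * x) ↔ τ.Mem (τ.le t) x := by
  rw [Mem, if_neg (by omega), if_neg (by omega), show 2 * x / 2 = x by omega]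

theorem mem_double_add {τ : Trie} {t x : ℕ} (hx : x ≠ 0) :
    τ.Mem t (2 * x + 1) ↔ τ.Mem (τ.ri t) x := by
  rw [Mem, if_neg (by omega), if_pos (by omega), show (2 * x + 1) / 2 = x by omega]

theorem WF.not_mem_empty {τ : Trie} (h : τ.WF) (x : ℕ) : ¬ τ.Mem 0 x := by
  induction x using Nat.strong_induction_on with
  | _ x ih =>
    rw [Mem, h.fl0, h.ri0, h.le0]
    split
    · simp
    · split <;> exact ih _ (by omega)

theorem WF.exists_mem {τ : Trie} (h : τ.WF) {t : ℕ} (ht : t ≤ τ.tc) (h0 : t ≠ 0) :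
    ∃ x, τ.Mem t x := by
  induction t using Nat.strong_induction_on with
  | _ t ih =>
    rcases h.ne t h0 ht with h1 | h1 | h1
    · exact ⟨1, mem_one.2 (by have := h.fl_le t ht; omega)⟩
    · obtain ⟨x, hx⟩ := ih _ (h.le_lt t h0 ht) (h.le_le ht) h1
      exact ⟨2 * x, (mem_double (by rintro rfl; exact not_mem_zero _ _ hx)).2 hx⟩
    · obtain ⟨x, hx⟩ := ih _ (h.ri_lt t h0 ht) (h.ri_le ht) h1
      exact ⟨2 * x + 1, (mem_double_add (by rintro rfl; exact not_mem_zero _ _ hx)).2 hx⟩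

/-- Canonicity: by induction the children agree, and contents determine the node through `co`. An
empty subtrie is always `0`, as any other node has a member. -/
theorem WF.eq_of_mem_iff {τ : Trie} (h : τ.WF) {t t' : ℕ} (ht : t ≤ τ.tc) (ht' : t' ≤ τ.tc)
    (hm : ∀ x, τ.Mem t x ↔ τ.Mem t' x) : t = t' := by
  induction t using Nat.strong_induction_on generalizing t' with
  | _ t ih =>
    by_cases h0 : t = 0
    · by_contra hne
      obtain ⟨x, hx⟩ := h.exists_mem ht' (fun e => hne (h0.trans e.symm))
      exact h.not_mem_empty x (h0 ▸ (hm x).2 hx)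
    · have h0' : t' ≠ 0 := by
        rintro rfl
        obtain ⟨x, hx⟩ := h.exists_mem ht h0
        exact h.not_mem_empty x ((hm x).1 hx)
      have e1 : τ.fl t = τ.fl t' := by
        have := hm 1
        rw [mem_one, mem_one] at this
        have := h.fl_le t ht
        have := h.fl_le t' ht'
        omega
      have e2 : τ.le t = τ.le t' := by
        refine ih _ (h.le_lt t h0 ht) (h.le_le ht) (h.le_le ht') fun x => ?_
        by_cases hx : x = 0
        · simp [hx, not_mem_zero]
        · rw [← mem_double hx, ← mem_double hx]; exact hm _
      have e3 : τ.ri t = τ.ri t' := by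
        refine ih _ (h.ri_lt t h0 ht) (h.ri_le ht) (h.ri_le ht') fun x => ?_
        by_cases hx : x = 0
        · simp [hx, not_mem_zero]
        · rw [← mem_double_add hx, ← mem_double_add hx]; exact hm _
      rw [← h.co_key t h0 ht, ← h.co_key t' h0' ht', e1, e2, e3]

/-- The table with a new node. -/
def push (τ : Trie) (f l r : ℕ) : Trie where
  tc := τ.tc + 1
  fl := Function.update τ.fl (τ.tc + 1) f
  le := Function.update τ.le (τ.tc + 1) l
  ri := Function.update τ.ri (τ.tc + 1) r
  co := Function.update τ.co (key f l r) (τ.tc + 1)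

theorem ext_push (τ : Trie) (f l r : ℕ) : Ext τ (τ.push f l r) := by
  have h : ∀ t, t ≤ τ.tc → t ≠ τ.tc + 1 := fun t ht => by omega
  refine ⟨Nat.le_succ _, fun t ht => ?_, fun t ht => ?_, fun t ht => ?_⟩ <;>
    exact Function.update_of_ne (h t ht) _ _

theorem WF.push {τ : Trie} (h : τ.WF) {f l r : ℕ} (hf : f ≤ 1) (hl : l ≤ τ.tc) (hr : r ≤ τ.tc)
    (hne : f ≠ 0 ∨ l ≠ 0 ∨ r ≠ 0) (hco : τ.co (key f l r) = 0) : (τ.push f l r).WF := by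
  have e := τ.ext_push f l r
  have htc : (τ.push f l r).tc = τ.tc + 1 := rfl
  have efl : (τ.push f l r).fl (τ.tc + 1) = f := Function.update_self ..
  have ele : (τ.push f l r).le (τ.tc + 1) = l := Function.update_self ..
  have eri : (τ.push f l r).ri (τ.tc + 1) = r := Function.update_self ..
  have hc : ∀ t, t ≤ (τ.push f l r).tc → t = τ.tc + 1 ∨ t ≤ τ.tc := fun t ht => by
    rw [htc] at ht; omega
  have eco : ∀ k, k ≠ key f l r → (τ.push f l r).co k = τ.co k :=
    fun k hk => Function.update_of_ne hk _ _
  have eco' : (τ.push f l r).co (key f l r) = τ.tc + 1 := Function.update_self ..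
  refine ⟨by rw [e.fl 0 (Nat.zero_le _), h.fl0], by rw [e.le 0 (Nat.zero_le _), h.le0],
    by rw [e.ri 0 (Nat.zero_le _), h.ri0], ?_, ?_, ?_, ?_, ?_, ?_⟩
  · intro t ht
    rcases hc t ht with rfl | ht
    · rwa [efl]
    · rw [e.fl t ht]; exact h.fl_le t ht
  · intro t h0 ht
    rcases hc t ht with rfl | ht
    · rw [ele]; omega
    · rw [e.le t ht]; exact h.le_lt t h0 ht
  · intro t h0 ht
    rcases hc t ht with rfl | ht
    · rw [eri]; omega
    · rw [e.ri t ht]; exact h.ri_lt t h0 ht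
  · intro t h0 ht
    rcases hc t ht with rfl | ht
    · rwa [efl, ele, eri]
    · rw [e.fl t ht, e.le t ht, e.ri t ht]; exact h.ne t h0 ht
  · intro t h0 ht
    rcases hc t ht with rfl | ht
    · rw [efl, ele, eri, eco']
    · rw [e.fl t ht, e.le t ht, e.ri t ht, eco, h.co_key t h0 ht]
      intro hk
      have := h.co_key t h0 ht
      rw [hk, hco] at this
      exact h0 this.symm
  · intro k hk
    by_cases hkk : k = key f l r
    · rw [hkk, eco', efl, ele, eri]
      exact ⟨le_rfl, rfl⟩
    · rw [eco k hkk] at hk ⊢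
      obtain ⟨h1, h2⟩ := h.key_co k hk
      rw [e.fl _ h1, e.le _ h1, e.ri _ h1]
      exact ⟨h1.trans (Nat.le_succ _), h2⟩

/-- The node at depth `d` on the path of `x` from node `t`. -/
def walk (τ : Trie) (t x : ℕ) : ℕ → ℕ
  | 0 => t
  | d + 1 => if x / 2 ^ d % 2 = 1 then τ.ri (τ.walk t x d) else τ.le (τ.walk t x d)

theorem WF.walk_le {τ : Trie} (h : τ.WF) {t : ℕ} (ht : t ≤ τ.tc) (x d : ℕ) :
    τ.walk t x d ≤ τ.tc := by
  induction d with
  | zero => exact ht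
  | succ d ih =>
    rw [walk]
    split
    · exact h.ri_le ih
    · exact h.le_le ih

/-- Node `t'` of `τ'` stores the set stored at node `t` of `τ`, and the element `x`. -/
structure Inserted (τ τ' : Trie) (t t' x : ℕ) : Prop where
  wf : τ'.WF
  ext : Ext τ τ'
  le : t' ≤ τ'.tc
  mem : ∀ y, τ'.Mem t' y ↔ τ.Mem t y ∨ y = x

/-- Membership is tested by inserting and comparing the roots; canonicity makes this correct. -/
theorem Inserted.eq_iff {τ τ' : Trie} {t t' x : ℕ} (h : Inserted τ τ' t t' x) (hw : τ.WF)
    (ht : t ≤ τ.tc) : t' = t ↔ τ.Mem t x := by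
  constructor
  · intro e
    rw [← h.ext.mem_iff hw ht]
    have := (h.mem x).2 (.inr rfl)
    rwa [e] at this
  · intro hm
    refine h.wf.eq_of_mem_iff h.le (ht.trans h.ext.tc) fun y => ?_
    rw [h.mem, h.ext.mem_iff hw ht]
    exact ⟨fun hy => hy.elim id (fun e => e ▸ hm), .inl⟩

end Trie

/-! ### Insertion into a trie -/

local notation "rTC" => (3 : ℕ)
local notation "rX" => (8 : ℕ)
local notation "rRoot" => (9 : ℕ)
local notation "rD" => (10 : ℕ)
local notation "rN" => (11 : ℕ)
local notation "rY" => (12 : ℕ)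
local notation "rF" => (13 : ℕ)
local notation "rL" => (14 : ℕ)
local notation "rR" => (15 : ℕ)
local notation "aHalf" => (2 : ℕ)
local notation "aFl" => (3 : ℕ)
local notation "aLe" => (4 : ℕ)
local notation "aRi" => (5 : ℕ)
local notation "aCo" => (6 : ℕ)
local notation "aPT" => (7 : ℕ)
local notation "aPB" => (8 : ℕ)

/-- The trie table in memory. -/
def RAMState.trie (s : RAMState) : Trie := ⟨s.reg rTC, s.arr aFl, s.arr aLe, s.arr aRi, s.arr aCo⟩

section
open RAMExpr RAMProg

/-- Index into the table of nodes by contents. -/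
def keyE : RAMExpr :=
  add (mul (add (add (add (reg rL) (reg rL)) (reg rF)) (reg rR))
    (add (add (add (reg rL) (reg rL)) (reg rF)) (reg rR))) (reg rR)

/-- Find or create the node with contents `rF`, `rL`, `rR`; its number is written to `rN`. -/
def consP : RAMProg := block [
  assign rN (load aCo keyE),
  ite (eq (reg rN) (const 0))
    (block [
      assign rTC (add (reg rTC) (const 1)),
      assign rN (reg rTC),
      store aCo keyE (reg rN),
      store aFl (reg rN) (reg rF),
      store aLe (reg rN) (reg rL),
      store aRi (reg rN) (reg rR)])
    skip]

/-- Walk down the path of `rX` from the node `rRoot`. -/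
def descendP : RAMProg := loop (lt (const 1) (reg rY)) (block [
  store aPT (reg rD) (reg rN),
  -- There is no division: halves come from a table, and this difference is the last binary digit.
  store aPB (reg rD) (sub (reg rY) (add (load aHalf (reg rY)) (load aHalf (reg rY)))),
  ite (load aPB (reg rD)) (assign rN (load aRi (reg rN))) (assign rN (load aLe (reg rN))),
  assign rY (load aHalf (reg rY)),
  assign rD (add (reg rD) (const 1))])

/-- Rebuild the nodes of a path. -/
def ascendP : RAMProg := loop (lt (const 0) (reg rD)) (block [
  assign rD (sub (reg rD) (const 1)),
  assign rF (load aFl (load aPT (reg rD))),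
  ite (load aPB (reg rD))
    (block [assign rL (load aLe (load aPT (reg rD))), assign rR (reg rN)])
    (block [assign rL (reg rN), assign rR (load aRi (load aPT (reg rD)))]),
  consP])

/-- Insert `rX` into the set stored at node `rRoot`. -/
def insertP : RAMProg := block [
  assign rD (const 0), assign rN (reg rRoot), assign rY (reg rX),
  descendP,
  assign rF (const 1), assign rL (load aLe (reg rN)), assign rR (load aRi (reg rN)),
  consP,
  ascendP,
  assign rRoot (reg rN)]

end

attribute [local simp] ltN_eq_zero eqN_eq_zero RAMState.setReg_reg RAMState.setReg_arr RAMState.setArr_reg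
  RAMState.setArr_arr RAMExpr.val_const RAMExpr.val_reg RAMExpr.val_load RAMExpr.val_add
  RAMExpr.val_sub RAMExpr.val_mul RAMExpr.val_lt RAMExpr.val_eq RAMExpr.cost wp_skip wp_assign wp_store wp_ite wp_block_nil
  wp_block_cons

/-- A nonzero entry of the table has the required contents because keys are injective; otherwise a
node is pushed. -/
theorem wp_consP {s : RAMState} (h : s.trie.WF) (hf : s.reg rF ≤ 1) (hl : s.reg rL ≤ s.reg rTC)
    (hr : s.reg rR ≤ s.reg rTC) (hne : s.reg rF ≠ 0 ∨ s.reg rL ≠ 0 ∨ s.reg rR ≠ 0) :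
    wp consP s fun s' k => k ≤ 60 ∧ s'.trie.WF ∧ s.trie.Ext s'.trie ∧ s'.reg rN ≠ 0 ∧
      s'.reg rN ≤ s'.trie.tc ∧ s'.trie.fl (s'.reg rN) = s.reg rF ∧
      s'.trie.le (s'.reg rN) = s.reg rL ∧ s'.trie.ri (s'.reg rN) = s.reg rR := by
  have hk : keyE.val s = Trie.key (s.reg rF) (s.reg rL) (s.reg rR) := rfl
  simp only [consP, wp_block_cons, wp_assign, wp_ite]
  constructor
  · intro h0
    have h0' : s.trie.co (Trie.key (s.reg rF) (s.reg rL) (s.reg rR)) = 0 := by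
      simpa [hk, RAMState.trie] using h0
    have hw := h.push hf hl hr hne h0'
    have he := s.trie.ext_push (s.reg rF) (s.reg rL) (s.reg rR)
    simp [keyE]
    refine ⟨?_, ?_, ?_⟩
    · convert hw using 1
      simp [RAMState.trie, Trie.push, Trie.key]
    · convert he using 1
      simp [RAMState.trie, Trie.push, Trie.key]
    · simp [RAMState.trie]
  · intro h0
    have h0' : s.trie.co (Trie.key (s.reg rF) (s.reg rL) (s.reg rR)) ≠ 0 := by
      simpa [hk, RAMState.trie] using h0
    obtain ⟨h1, h2⟩ := h.key_co _ h0'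
    obtain ⟨e1, e2, e3⟩ := Trie.key_inj (h.fl_le _ h1) hf h2
    simp [keyE]
    exact ⟨h, .refl _, h0', h1, e1, e2, e3⟩

theorem wp_descendP {s : RAMState} (hy : 1 ≤ s.reg rY)
    (hhalf : ∀ i ≤ s.reg rY, s.arr aHalf i = i / 2) (hd : s.reg rD = 0) :
    wp descendP s fun s' k => k ≤ 100 * Nat.log 2 (s.reg rY) + 10 ∧
      s'.reg rD = Nat.log 2 (s.reg rY) ∧
      s'.reg rN = s.trie.walk (s.reg rN) (s.reg rY) (Nat.log 2 (s.reg rY)) ∧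
      s.reg rY / 2 ^ Nat.log 2 (s.reg rY) = 1 ∧
      ∀ i < Nat.log 2 (s.reg rY), s'.arr aPT i = s.trie.walk (s.reg rN) (s.reg rY) i ∧
        s'.arr aPB i = s.reg rY / 2 ^ i % 2 := by
  refine (wp_loop (b := 100 * Nat.log 2 (s.reg rY)) (fun b s' => b = 100 * Nat.log 2 (s'.reg rY) ∧
    s'.reg rD + Nat.log 2 (s'.reg rY) = Nat.log 2 (s.reg rY) ∧ 1 ≤ s'.reg rY ∧
    s'.reg rY = s.reg rY / 2 ^ s'.reg rD ∧
    s'.reg rN = s.trie.walk (s.reg rN) (s.reg rY) (s'.reg rD) ∧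
    ∀ i < s'.reg rD, s'.arr aPT i = s.trie.walk (s.reg rN) (s.reg rY) i ∧
        s'.arr aPB i = s.reg rY / 2 ^ i % 2) ?_ ?_).mono ?_
  · rintro b s' ⟨rfl, hD, h1, hY, hN, hP⟩ hf he
    have hlt : 1 < s'.reg rY := by simpa using he
    have hYle : s'.reg rY ≤ s.reg rY := hY ▸ Nat.div_le_self _ _
    have e2 : s'.arr aHalf = s.arr aHalf := hf.arr _ (by decide)
    have e4 : s'.arr aLe = s.arr aLe := hf.arr _ (by decide)
    have e5 : s'.arr aRi = s.arr aRi := hf.arr _ (by decide)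
    have hh : s.arr aHalf (s'.reg rY) = s'.reg rY / 2 := hhalf _ hYle
    have hlog : Nat.log 2 (s'.reg rY / 2) + 1 = Nat.log 2 (s'.reg rY) := by
      rw [Nat.log_div_base]
      have := Nat.log_pos (b := 2) (by norm_num) (show 2 ≤ s'.reg rY from hlt)
      omega
    have hbit : s'.reg rY - (s'.reg rY / 2 + s'.reg rY / 2) = s'.reg rY % 2 := by omega
    have hnext : s'.reg rY / 2 = s.reg rY / 2 ^ (s'.reg rD + 1) := by
      rw [hY, Nat.div_div_eq_div_mul, pow_succ]
    have hPT : ∀ i < s'.reg rD + 1,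
        Function.update (s'.arr aPT) (s'.reg rD) (s'.reg rN) i =
          s.trie.walk (s.reg rN) (s.reg rY) i ∧
        Function.update (s'.arr aPB) (s'.reg rD) (s'.reg rY % 2) i = s.reg rY / 2 ^ i % 2 := by
      intro i hi
      by_cases hi' : i = s'.reg rD
      · subst hi'
        rw [Function.update_self, Function.update_self, hN, ← hY]
        exact ⟨rfl, rfl⟩
      · rw [Function.update_of_ne hi', Function.update_of_ne hi']
        exact hP i (by omega)
    have hw : s.trie.walk (s.reg rN) (s.reg rY) (s'.reg rD + 1) =
        if s'.reg rY % 2 = 1 then s.arr aRi (s'.reg rN) else s.arr aLe (s'.reg rN) := by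
      rw [Trie.walk, ← hY, ← hN]
      rfl
    simp [e2, e4, e5, hh, hbit, -Nat.reducePow]
    constructor <;> intro hb
    · rw [if_pos (by omega)] at hw
      exact ⟨⟨by omega, by omega, hnext, hw.symm, fun i hi => hPT i (by omega)⟩, by omega⟩
    · rw [if_neg (by omega)] at hw
      exact ⟨⟨by omega, by omega, hnext, hw.symm, fun i hi => hPT i (by omega)⟩, by omega⟩
  · refine ⟨rfl, by omega, hy, by simp [hd], by simp [hd, Trie.walk], by simp [hd]⟩
  · rintro s' k hf ⟨b, ⟨rfl, hD, h1, hY, hN, hP⟩, he, hk⟩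
    have hle : s'.reg rY = 1 := by
      have : ¬ 1 < s'.reg rY := by simpa using he
      omega
    have hlog : Nat.log 2 (s'.reg rY) = 0 := by rw [hle]; simp
    have hD' : s'.reg rD = Nat.log 2 (s.reg rY) := by omega
    rw [hD'] at hN hP hY
    simp at hk
    exact ⟨by omega, hD', hN, by omega, hP⟩

/-- One level of path copying: the child on the side of the last digit of `x` receives `x / 2`, and
the other child is the old one. -/
theorem Trie.mem_step {τ τ' : Trie} {w n m x : ℕ} (hx : 2 ≤ x) (hfl : τ'.fl n = τ.fl w)
    (hle : τ'.le n = if x % 2 = 1 then τ.le w else m)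
    (hri : τ'.ri n = if x % 2 = 1 then m else τ.ri w)
    (hle' : x % 2 = 1 → ∀ y, τ'.Mem (τ.le w) y ↔ τ.Mem (τ.le w) y)
    (hri' : x % 2 ≠ 1 → ∀ y, τ'.Mem (τ.ri w) y ↔ τ.Mem (τ.ri w) y)
    (hm : ∀ y, τ'.Mem m y ↔ τ.Mem (if x % 2 = 1 then τ.ri w else τ.le w) y ∨ y = x / 2) (y : ℕ) :
    τ'.Mem n y ↔ τ.Mem w y ∨ y = x := by
  rw [Trie.Mem, Trie.Mem.eq_1 τ]
  by_cases h1 : y ≤ 1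
  · rw [if_pos h1, if_pos h1, hfl]
    constructor
    · exact .inl
    · rintro (h | h)
      · exact h
      · omega
  · rw [if_neg h1, if_neg h1, hle, hri]
    by_cases hb : x % 2 = 1
    · have hm' := hm (y / 2)
      rw [if_pos hb] at hm' ⊢
      rw [if_pos hb]
      by_cases hyb : y % 2 = 1
      · rw [if_pos hyb, if_pos hyb, hm']
        have : y / 2 = x / 2 ↔ y = x := by omega
        rw [this]
      · rw [if_neg hyb, if_neg hyb, hle' hb]
        have : y ≠ x := by rintro rfl; exact hyb hb
        simp [this]
    · have hm' := hm (y / 2)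
      rw [if_neg hb] at hm' ⊢
      rw [if_neg hb]
      by_cases hyb : y % 2 = 1
      · rw [if_pos hyb, if_pos hyb, hri' hb]
        have : y ≠ x := by rintro rfl; exact hb hyb
        simp [this]
      · rw [if_neg hyb, if_neg hyb, hm']
        have : y / 2 = x / 2 ↔ y = x := by omega
        rw [this]

/-- The invariant at depth `d` is that the current node is the old node of the path at this depth
with `x / 2 ^ d` inserted. -/
theorem wp_ascendP {s : RAMState} {τ : Trie} {t x : ℕ} (hw : τ.WF) (ht : t ≤ τ.tc)
    (hn : Trie.Inserted τ s.trie (τ.walk t x (s.reg rD)) (s.reg rN) (x / 2 ^ s.reg rD))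
    (hn0 : s.reg rN ≠ 0) (hx : 1 ≤ x / 2 ^ s.reg rD)
    (hP : ∀ i < s.reg rD, s.arr aPT i = τ.walk t x i ∧ s.arr aPB i = x / 2 ^ i % 2) :
    wp ascendP s fun s' k => k ≤ 150 * s.reg rD + 10 ∧
      Trie.Inserted τ s'.trie t (s'.reg rN) x ∧ s'.reg rN ≠ 0 := by
  refine (wp_loop (b := 150 * s.reg rD) (fun b s' => b = 150 * s'.reg rD ∧
    s'.reg rD ≤ s.reg rD ∧
    Trie.Inserted τ s'.trie (τ.walk t x (s'.reg rD)) (s'.reg rN) (x / 2 ^ s'.reg rD) ∧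
    s'.reg rN ≠ 0 ∧ 1 ≤ x / 2 ^ s'.reg rD) ?_ ?_).mono ?_
  · rintro b s' ⟨rfl, hD, hi, h0, h1⟩ hf he
    have hlt : 0 < s'.reg rD := Nat.pos_of_ne_zero (by simpa using he)
    obtain ⟨d, hd⟩ : ∃ d, s'.reg rD = d + 1 := ⟨s'.reg rD - 1, by omega⟩
    have e7 : s'.arr aPT = s.arr aPT := hf.arr _ (by decide)
    have e8 : s'.arr aPB = s.arr aPB := hf.arr _ (by decide)
    obtain ⟨p1, p2⟩ := hP d (by omega)
    rw [← e7] at p1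
    rw [← e8] at p2
    have hwd := hw.walk_le ht x d
    have hhalf : x / 2 ^ d / 2 = x / 2 ^ (d + 1) := by
      rw [Nat.div_div_eq_div_mul, pow_succ]
    rw [hd] at hi h1
    have hle : s'.arr aLe (τ.walk t x d) = τ.le (τ.walk t x d) := hi.ext.le _ hwd
    have hri : s'.arr aRi (τ.walk t x d) = τ.ri (τ.walk t x d) := hi.ext.ri _ hwd
    have hfl : s'.arr aFl (τ.walk t x d) = τ.fl (τ.walk t x d) := hi.ext.fl _ hwd
    have htc : τ.tc ≤ s'.reg rTC := hi.ext.tc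
    have hN : s'.reg rN ≤ s'.reg rTC := hi.le
    have hll := hw.le_le hwd
    have hrr := hw.ri_le hwd
    simp [hd, p1, p2, hle, hri, hfl, -Nat.reducePow]
    constructor <;> intro hb
    all_goals
      refine (wp_consP ?_ ?_ ?_ ?_ ?_).mono ?_
      · exact hi.wf
      · simpa using hw.fl_le _ hwd
      · simp; omega
      · simp; omega
      · simp [h0]
    · rintro s'' k hf' ⟨hk, w1, w2, n0, n1, n2, n3, n4⟩
      have ed : s''.reg rD = d := (hf'.reg rD (by decide)).trans (by simp)
      have ext' : s'.trie.Ext s''.trie := w2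
      refine ⟨⟨by omega, ⟨w1, hi.ext.trans ext', n1, ?_⟩, n0, by rw [ed]; omega⟩, by omega⟩
      rw [ed]
      simp at n2 n3 n4
      have hbb : x / 2 ^ d % 2 = 1 := by omega
      refine Trie.mem_step (m := s'.reg rN) (by omega) n2 ?_ ?_ ?_ ?_ ?_
      · rw [if_pos hbb, n3]
      · rw [if_pos hbb, n4]
      · exact fun _ => (hi.ext.trans ext').mem_iff hw hll
      · exact fun h => absurd hbb h
      · intro y
        rw [ext'.mem_iff hi.wf hi.le, hi.mem, hhalf, Trie.walk, if_pos hbb]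
    · rintro s'' k hf' ⟨hk, w1, w2, n0, n1, n2, n3, n4⟩
      have ed : s''.reg rD = d := (hf'.reg rD (by decide)).trans (by simp)
      have ext' : s'.trie.Ext s''.trie := w2
      refine ⟨⟨by omega, ⟨w1, hi.ext.trans ext', n1, ?_⟩, n0, by rw [ed]; omega⟩, by omega⟩
      rw [ed]
      simp at n2 n3 n4
      have hbb : ¬ x / 2 ^ d % 2 = 1 := by omega
      refine Trie.mem_step (m := s'.reg rN) (by omega) n2 ?_ ?_ ?_ ?_ ?_
      · rw [if_neg hbb, n3]
      · rw [if_neg hbb, n4]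
      · exact fun h => absurd h hbb
      · exact fun _ => (hi.ext.trans ext').mem_iff hw hrr
      · intro y
        rw [ext'.mem_iff hi.wf hi.le, hi.mem, hhalf, Trie.walk, if_neg hbb]
  · exact ⟨rfl, le_rfl, hn, hn0, hx⟩
  · rintro s' k hf ⟨b, ⟨rfl, hD, hi, h0, h1⟩, he, hk⟩
    have hd : s'.reg rD = 0 := by
      have : ¬ 0 < s'.reg rD := by simpa using he
      omega
    rw [hd] at hi
    simp at hk
    refine ⟨by omega, by simpa [Trie.walk] using hi, h0⟩

theorem wp_insertP {s : RAMState} (hw : s.trie.WF) (ht : s.reg rRoot ≤ s.reg rTC)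
    (hx : 1 ≤ s.reg rX) (hhalf : ∀ i ≤ s.reg rX, s.arr aHalf i = i / 2) :
    wp insertP s fun s' k => k ≤ 250 * Nat.log 2 (s.reg rX) + 150 ∧
      Trie.Inserted s.trie s'.trie (s.reg rRoot) (s'.reg rRoot) (s.reg rX) ∧
      s'.reg rRoot ≠ 0 := by
  simp [insertP]
  refine (wp_descendP ?_ ?_ ?_).mono ?_
  · simpa using hx
  · simpa using hhalf
  · simp
  rintro s1 k1 f1 ⟨hk1, hD, hN, hY, hP⟩
  simp at hk1 hD hN hY hP
  have ht1 : s1.trie = s.trie := by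
    have h1 := f1.reg rTC (by decide)
    have h2 := f1.arr aFl (by decide)
    have h3 := f1.arr aLe (by decide)
    have h4 := f1.arr aRi (by decide)
    have h5 := f1.arr aCo (by decide)
    simp at h1 h2 h3 h4 h5
    simp [RAMState.trie, h1, h2, h3, h4, h5]
  have hwl := hw.walk_le ht (s.reg rX) (Nat.log 2 (s.reg rX))
  have e0 : (((s.setReg rD 0).setReg rN (s.reg rRoot)).setReg rY (s.reg rX)).trie = s.trie := rfl
  rw [e0, ← ht1] at hN hP
  have hll : s1.arr aLe (s1.reg rN) ≤ s1.reg rTC := by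
    have : s1.trie.WF := ht1 ▸ hw
    exact this.le_le (t := s1.reg rN) (by rw [hN, ht1]; exact hwl)
  have hrr : s1.arr aRi (s1.reg rN) ≤ s1.reg rTC := by
    have : s1.trie.WF := ht1 ▸ hw
    exact this.ri_le (t := s1.reg rN) (by rw [hN, ht1]; exact hwl)
  refine (wp_consP ?_ ?_ ?_ ?_ ?_).mono ?_
  · exact (show s1.trie.WF from ht1 ▸ hw)
  · simp
  · simpa using hll
  · simpa using hrr
  · simp
  rintro s2 k2 f2 ⟨hk2, w1, w2, n0, n1, n2, n3, n4⟩
  have w2' : s1.trie.Ext s2.trie := w2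
  rw [ht1] at w2'
  have hD2 : s2.reg rD = Nat.log 2 (s.reg rX) := by
    have := f2.reg rD (by decide)
    simpa [hD] using this
  have h7 := f2.arr aPT (by decide)
  have h8 := f2.arr aPB (by decide)
  simp at n2 n3 n4 h7 h8
  rw [hN] at n3 n4
  refine (wp_ascendP (τ := s.trie) (t := s.reg rRoot) (x := s.reg rX) hw ht ?_ n0 ?_ ?_).mono ?_
  -- At the end of the path only the leading digit `1` of `x` is left, so setting the flag inserts
  -- exactly this number.
  · rw [hD2, hY]
    refine ⟨w1, w2', n1, fun y => ?_⟩
    rw [Trie.Mem, Trie.Mem.eq_1 s.trie]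
    by_cases hy1 : y ≤ 1
    · rw [if_pos hy1, if_pos hy1, n2]
      simp only [and_true]
      exact ⟨.inr, fun h => h.elim And.left id⟩
    · have hy2 : ¬ y = 1 := by omega
      rw [if_neg hy1, if_neg hy1, n3, n4, ht1]
      simp only [hy2, or_false]
      change (if _ then s2.trie.Mem (s1.trie.ri _) _ else s2.trie.Mem (s1.trie.le _) _) ↔ _
      rw [ht1, w2'.mem_iff hw (hw.ri_le hwl), w2'.mem_iff hw (hw.le_le hwl)]
  · rw [hD2, hY]
  · rw [hD2, h7, h8, ← ht1]
    exact hP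
  rintro s3 k3 f3 ⟨hk3, hins, h30⟩
  refine ⟨by rw [hD2] at hk3; omega, hins, h30⟩

/-! ### The table of atoms -/

local notation "rFP" => (2 : ℕ)
local notation "aOut" => (1 : ℕ)
local notation "aAt" => (9 : ℕ)
local notation "aAL" => (10 : ℕ)
local notation "aVar" => (11 : ℕ)

/-- The codes of the arguments stored with the atom at address `x`. -/
noncomputable def RAMState.codes (s : RAMState) (c : ℕ → ℕ) (x : ℕ) : Finset ℕ :=
  (Finset.range (s.arr aAL x)).image fun j => c (s.arr aOut (x + 4 + j))

/-- A variable is stored at address `x`. -/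
structure VarAt (s : RAMState) (c : ℕ → ℕ) (x : ℕ) : Prop where
  lab : s.arr aOut x = 2
  fit : x + 1 < s.reg rFP
  len : s.arr aAL x = 0
  code : c x = varC (s.arr aOut (x + 1))

/-- The complement of a variable or of a reduced join is stored at address `x`. -/
structure NegAt (s : RAMState) (V : Set ℕ) (c : ℕ → ℕ) (x : ℕ) : Prop where
  lab : s.arr aOut x = 3
  len : 1 ≤ s.arr aAL x
  fit : x + 4 + s.arr aAL x ≤ s.reg rFP
  mem : ∀ j < s.arr aAL x, s.arr aOut (x + 4 + j) ∈ V ∧ s.arr aOut (x + 4 + j) < x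
  nodup : ∀ i < s.arr aAL x, ∀ j < s.arr aAL x,
    s.arr aOut (x + 4 + i) = s.arr aOut (x + 4 + j) → i = j
  code : c x = negC (s.codes c x)
  good : Good (s.codes c x)
  ne_neg : ∀ C, s.codes c x ≠ {negC C}
  one : s.arr aAL x = 1 → s.arr aOut (x + 1) = s.arr aOut (x + 4)
  many : s.arr aAL x ≠ 1 → s.arr aOut (x + 1) = x + 2 ∧ s.arr aOut (x + 2) = 4 ∧
    s.arr aOut (x + 3) = s.arr aAL x

/-- The output array contains the atoms with addresses `V` and codes `c`, all different, and they
are found by the tables of variables and of complements. -/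
structure Heap (s : RAMState) (V : Set ℕ) (c : ℕ → ℕ) : Prop where
  fp : 2 ≤ s.reg rFP
  out0 : s.arr aOut 0 = 0
  out1 : s.arr aOut 1 = 1
  half : ∀ i < s.reg rFP, s.arr aHalf i = i / 2
  wf : s.trie.WF
  two_le : ∀ x ∈ V, 2 ≤ x
  lt : ∀ x ∈ V, x < s.reg rFP
  inj : ∀ x ∈ V, ∀ y ∈ V, c x = c y → x = y
  cases : ∀ x ∈ V, VarAt s c x ∨ NegAt s V c x
  var : ∀ v, s.arr aVar v ≠ 0 → s.arr aVar v ∈ V ∧ c (s.arr aVar v) = varC v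
  var' : ∀ x ∈ V, ∀ v, c x = varC v → s.arr aVar v = x
  atom : ∀ R, s.arr aAt R ≠ 0 → R ≤ s.reg rTC ∧ s.arr aAt R ∈ V ∧ NegAt s V c (s.arr aAt R) ∧
    ∀ y, s.trie.Mem R y ↔
      ∃ j < s.arr aAL (s.arr aAt R), y = s.arr aOut (s.arr aAt R + 4 + j)
  atom' : ∀ x ∈ V, s.arr aOut x = 3 → ∃ R, s.arr aAt R = x

/-- The set of codes of a list of atoms. -/
noncomputable def codesL (c : ℕ → ℕ) (L : List ℕ) : Finset ℕ := (L.map c).toFinset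

theorem mem_codesL {c : ℕ → ℕ} {L : List ℕ} {a : ℕ} : a ∈ codesL c L ↔ ∃ x ∈ L, c x = a := by
  simp [codesL]

theorem RAMState.mem_codes {s : RAMState} {c : ℕ → ℕ} {x a : ℕ} :
    a ∈ s.codes c x ↔ ∃ j < s.arr aAL x, c (s.arr aOut (x + 4 + j)) = a := by
  simp [RAMState.codes]

theorem VarAt.congr {s s' : RAMState} {c c' : ℕ → ℕ} {x : ℕ} (h : VarAt s c x)
    (hfp : s.reg rFP ≤ s'.reg rFP) (hout : ∀ i < s.reg rFP, s'.arr aOut i = s.arr aOut i)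
    (hal : s'.arr aAL x = s.arr aAL x) (hc : c' x = c x) : VarAt s' c' x := by
  have := h.fit
  refine ⟨?_, by omega, by rw [hal, h.len], ?_⟩
  · rw [hout x (by omega), h.lab]
  · rw [hc, hout _ (by omega), h.code]

theorem NegAt.codes_congr {s s' : RAMState} {V : Set ℕ} {c c' : ℕ → ℕ} {x : ℕ}
    (h : NegAt s V c x) (hout : ∀ i < s.reg rFP, s'.arr aOut i = s.arr aOut i)
    (hal : s'.arr aAL x = s.arr aAL x) (hc : ∀ y ∈ V, c' y = c y) :
    s'.codes c' x = s.codes c x := by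
  have := h.fit
  ext a
  rw [RAMState.mem_codes, RAMState.mem_codes, hal]
  refine exists_congr fun j => and_congr_right fun hj => ?_
  rw [hout _ (by omega), hc _ (h.mem j hj).1]

theorem NegAt.congr {s s' : RAMState} {V V' : Set ℕ} {c c' : ℕ → ℕ} {x : ℕ} (h : NegAt s V c x)
    (hfp : s.reg rFP ≤ s'.reg rFP) (hout : ∀ i < s.reg rFP, s'.arr aOut i = s.arr aOut i)
    (hal : s'.arr aAL x = s.arr aAL x) (hc : ∀ y ∈ V, c' y = c y) (hV : V ⊆ V') (hx : x ∈ V) :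
    NegAt s' V' c' x := by
  have h1 := h.fit
  have h2 := h.len
  have hj : ∀ j < s.arr aAL x, s'.arr aOut (x + 4 + j) = s.arr aOut (x + 4 + j) :=
    fun j hj => hout _ (by omega)
  refine ⟨?_, by rw [hal]; exact h2, by rw [hal]; omega, ?_, ?_, ?_, ?_, ?_, ?_, ?_⟩
  · rw [hout x (by omega), h.lab]
  · rw [hal]
    intro j hj'
    rw [hj j hj']
    exact ⟨hV (h.mem j hj').1, (h.mem j hj').2⟩
  · rw [hal]
    intro i hi j hj' e
    rw [hj i hi, hj j hj'] at e
    exact h.nodup i hi j hj' e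
  · rw [h.codes_congr hout hal hc, hc x hx, h.code]
  · rw [h.codes_congr hout hal hc]; exact h.good
  · rw [h.codes_congr hout hal hc]; exact h.ne_neg
  · rw [hal, hout _ (by omega), hout _ (by omega)]; exact h.one
  · rw [hal, hout _ (by omega), hout _ (by omega), hout _ (by omega)]; exact h.many

/-- A state with the same atoms, and possibly more trie nodes. -/
theorem Heap.congr {s s' : RAMState} {V : Set ℕ} {c : ℕ → ℕ} (h : Heap s V c)
    (hfp : s'.reg rFP = s.reg rFP) (hout : s'.arr aOut = s.arr aOut)
    (hhalf : s'.arr aHalf = s.arr aHalf) (hat : s'.arr aAt = s.arr aAt)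
    (hal : s'.arr aAL = s.arr aAL) (hvar : s'.arr aVar = s.arr aVar)
    (hwf : s'.trie.WF) (hext : s.trie.Ext s'.trie) : Heap s' V c := by
  have hneg : ∀ x ∈ V, NegAt s V c x → NegAt s' V c x := fun x hx hn =>
    hn.congr hfp.ge (fun i _ => by rw [hout]) (by rw [hal]) (fun _ _ => rfl) subset_rfl hx
  refine ⟨by rw [hfp]; exact h.fp, by rw [hout]; exact h.out0, by rw [hout]; exact h.out1,
    by rw [hfp, hhalf]; exact h.half, hwf, h.two_le, by rw [hfp]; exact h.lt, h.inj,
    fun x hx => (h.cases x hx).imp (fun hv => hv.congr hfp.ge (fun i _ => by rw [hout])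
      (by rw [hal]) rfl) (hneg x hx), by rw [hvar]; exact h.var, by rw [hvar]; exact h.var', ?_,
    by rw [hat, hout]; exact h.atom'⟩
  rw [hat, hal, hout]
  intro R hR
  obtain ⟨h1, h2, h3, h4⟩ := h.atom R hR
  exact ⟨h1.trans hext.tc, h2, hneg _ h2 h3, fun y => (hext.mem_iff h.wf h1 y).trans (h4 y)⟩

theorem Trie.congr_frame {p : RAMProg} {s s' : RAMState} (f : Frame p s s')
    (h : rTC ∉ p.regs ∧ aFl ∉ p.arrs ∧ aLe ∉ p.arrs ∧ aRi ∉ p.arrs ∧ aCo ∉ p.arrs) :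
    s'.trie = s.trie := by
  simp only [RAMState.trie, f.reg _ h.1, f.arr _ h.2.1, f.arr _ h.2.2.1, f.arr _ h.2.2.2.1,
    f.arr _ h.2.2.2.2]

/-- `Heap.congr` for a program that does not write the table of atoms. -/
theorem Heap.frame {p : RAMProg} {s s' : RAMState} {V : Set ℕ} {c : ℕ → ℕ} (h : Heap s V c)
    (f : Frame p s s') (hp : rFP ∉ p.regs ∧ aOut ∉ p.arrs ∧ aHalf ∉ p.arrs ∧ aAt ∉ p.arrs ∧
      aAL ∉ p.arrs ∧ aVar ∉ p.arrs)
    (hwf : s'.trie.WF) (hext : s.trie.Ext s'.trie) : Heap s' V c :=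
  h.congr (f.reg _ hp.1) (f.arr _ hp.2.1) (f.arr _ hp.2.2.1) (f.arr _ hp.2.2.2.1)
    (f.arr _ hp.2.2.2.2.1) (f.arr _ hp.2.2.2.2.2) hwf hext

/-- The atoms of `s` are atoms of `s'`. -/
structure HExt (s : RAMState) (V : Set ℕ) (c : ℕ → ℕ) (s' : RAMState) (V' : Set ℕ)
    (c' : ℕ → ℕ) : Prop where
  sub : V ⊆ V'
  code : ∀ x ∈ V, c' x = c x
  len : ∀ x ∈ V, s'.arr aAL x = s.arr aAL x

theorem HExt.refl {s s' : RAMState} {V : Set ℕ} {c : ℕ → ℕ} (h : s'.arr aAL = s.arr aAL) :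
    HExt s V c s' V c := ⟨subset_rfl, fun _ _ => rfl, fun _ _ => by rw [h]⟩

theorem HExt.trans {s s' s'' : RAMState} {V V' V'' : Set ℕ} {c c' c'' : ℕ → ℕ}
    (h : HExt s V c s' V' c') (h' : HExt s' V' c' s'' V'' c'') : HExt s V c s'' V'' c'' :=
  ⟨h.sub.trans h'.sub, fun x hx => (h'.code x (h.sub hx)).trans (h.code x hx),
    fun x hx => (h'.len x (h.sub hx)).trans (h.len x hx)⟩

theorem HExt.codesL_eq {s s' : RAMState} {V V' : Set ℕ} {c c' : ℕ → ℕ} (h : HExt s V c s' V' c')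
    {L : List ℕ} (hL : ∀ x ∈ L, x ∈ V) : codesL c' L = codesL c L := by
  rw [codesL, codesL, List.map_congr_left fun x hx => h.code x (hL x hx)]

/-- The set of atoms `L` is consistent if it does not contain the complement of a join of some of
its elements. -/
theorem Heap.good_iff {s : RAMState} {V : Set ℕ} {c : ℕ → ℕ} (h : Heap s V c) {L : List ℕ}
    (hL : ∀ x ∈ L, x ∈ V) : Good (codesL c L) ↔
      ¬ ∃ x ∈ L, 0 < s.arr aAL x ∧ ∀ j < s.arr aAL x, s.arr aOut (x + 4 + j) ∈ L := by
  constructor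
  · rintro hg ⟨x, hx, h0, hj⟩
    rcases h.cases x (hL x hx) with hv | hn
    · rw [hv.len] at h0; omega
    · refine hg.noclash (B := s.codes c x) (mem_codesL.2 ⟨x, hx, hn.code⟩) fun a ha => ?_
      obtain ⟨j, hjl, rfl⟩ := RAMState.mem_codes.1 ha
      exact mem_codesL.2 ⟨_, hj j hjl, rfl⟩
  · intro hbad
    have key : ∀ B, negC B ∈ codesL c L → ∃ x ∈ L, NegAt s V c x ∧ B = s.codes c x := by
      intro B hB
      obtain ⟨x, hx, e⟩ := mem_codesL.1 hB
      rcases h.cases x (hL x hx) with hv | hn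
      · exact absurd (hv.code.symm.trans e) (varC_ne_negC _ _)
      · exact ⟨x, hx, hn, negC_inj (e.symm.trans hn.code)⟩
    refine .mk _ (fun B hB => ?_) (fun B hB => ?_)
    · obtain ⟨x, hx, hn, rfl⟩ := key B hB
      refine ⟨fun hs => hbad ⟨x, hx, hn.len, fun j hj => ?_⟩, ?_, hn.ne_neg⟩
      -- Different atoms have different codes, so an inclusion of codes is an inclusion of
      -- addresses.
      · obtain ⟨y, hy, e⟩ := mem_codesL.1 (hs (RAMState.mem_codes.2 ⟨j, hj, rfl⟩))
        rwa [h.inj _ (hn.mem j hj).1 y (hL y hy) e.symm]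
      · exact ⟨_, RAMState.mem_codes.2 ⟨0, hn.len, rfl⟩⟩
    · obtain ⟨x, hx, hn, rfl⟩ := key B hB
      exact hn.good

/-- Addition of the complement of the join of `El 0, …, El (n - 1)`, which are the members of the
set stored at the trie node `R`. -/
theorem Heap.addNeg {s s' : RAMState} {V : Set ℕ} {c : ℕ → ℕ} (h : Heap s V c) {R n : ℕ}
    {El : ℕ → ℕ} {A : Finset ℕ} (hR : R ≤ s.reg rTC) (hat : s.arr aAt R = 0) (hn : 1 ≤ n)
    (hEl : ∀ i < n, El i ∈ V) (hnd : ∀ i < n, ∀ j < n, El i = El j → i = j)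
    (hmem : ∀ y, s.trie.Mem R y ↔ ∃ i < n, y = El i)
    (hA : A = (Finset.range n).image fun i => c (El i)) (hg : Good A) (hne : ∀ C, A ≠ {negC C})
    (hfp : s'.reg rFP = s.reg rFP + 4 + n)
    (hout : ∀ i < s.reg rFP, s'.arr aOut i = s.arr aOut i)
    (hq : s'.arr aOut (s.reg rFP) = 3)
    (hq1 : s'.arr aOut (s.reg rFP + 1) = if n = 1 then El 0 else s.reg rFP + 2)
    (hq2 : s'.arr aOut (s.reg rFP + 2) = 4) (hq3 : s'.arr aOut (s.reg rFP + 3) = n)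
    (hq4 : ∀ i < n, s'.arr aOut (s.reg rFP + 4 + i) = El i)
    (hhalf : ∀ i < s'.reg rFP, s'.arr aHalf i = i / 2)
    (hal : s'.arr aAL = Function.update (s.arr aAL) (s.reg rFP) n)
    (hat' : s'.arr aAt = Function.update (s.arr aAt) R (s.reg rFP))
    (hvar : s'.arr aVar = s.arr aVar) (htrie : s'.trie = s.trie) :
    Heap s' (insert (s.reg rFP) V) (Function.update c (s.reg rFP) (negC A)) ∧
      HExt s V c s' (insert (s.reg rFP) V) (Function.update c (s.reg rFP) (negC A)) := by
  obtain ⟨q, hqe⟩ : ∃ q, q = s.reg rFP := ⟨_, rfl⟩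
  rw [← hqe] at hfp hout hq hq1 hq2 hq3 hq4 hal hat' ⊢
  have hlt : ∀ x ∈ V, x < q := fun x hx => hqe ▸ h.lt x hx
  have hqV : q ∉ V := fun hx => lt_irrefl _ (hlt q hx)
  have h2q : 2 ≤ q := hqe ▸ h.fp
  have hc : ∀ x ∈ V, Function.update c q (negC A) x = c x := fun x hx =>
    Function.update_of_ne (hlt x hx).ne _ _
  have hcq : Function.update c q (negC A) q = negC A := Function.update_self ..
  have hl : ∀ x ∈ V, s'.arr aAL x = s.arr aAL x := fun x hx => by
    rw [hal, Function.update_of_ne (hlt x hx).ne]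
  have hlq : s'.arr aAL q = n := by rw [hal, Function.update_self]
  have hsub : V ⊆ insert q V := Set.subset_insert _ _
  have hneg : ∀ x ∈ V, NegAt s V c x → NegAt s' (insert q V) (Function.update c q (negC A)) x :=
    fun x hx hn => hn.congr (by omega) (by rwa [← hqe]) (hl x hx) hc hsub hx
  have hcodes : s'.codes (Function.update c q (negC A)) q = A := by
    ext a
    have hAm : a ∈ A ↔ ∃ j < n, c (El j) = a := by rw [hA]; simp
    rw [RAMState.mem_codes, hlq, hAm]
    exact exists_congr fun j => and_congr_right fun hj => by rw [hq4 j hj, hc _ (hEl j hj)]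
  have hnew : NegAt s' (insert q V) (Function.update c q (negC A)) q := by
    refine ⟨hq, by rw [hlq]; exact hn, by rw [hlq, hfp], ?_, ?_, by rw [hcq, hcodes],
      by rw [hcodes]; exact hg, by rw [hcodes]; exact hne, ?_, ?_⟩
    · rw [hlq]
      intro j hj
      rw [hq4 j hj]
      exact ⟨hsub (hEl j hj), hlt _ (hEl j hj)⟩
    · rw [hlq]
      intro i hi j hj e
      rw [hq4 i hi, hq4 j hj] at e
      exact hnd i hi j hj e
    · rw [hlq]
      intro e
      rw [hq1, if_pos e]
      exact (hq4 0 (by omega)).symm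
    · rw [hlq]
      intro e
      rw [hq1, if_neg e]
      exact ⟨rfl, hq2, hq3⟩
  -- If the code were present, the trie node of its atom would have the same members as `R`, hence
  -- be `R` by canonicity, but `R` has no atom yet.
  have hold : ∀ x ∈ V, c x ≠ negC A := by
    intro x hx e
    rcases h.cases x hx with hv | hn
    · exact varC_ne_negC _ _ (hv.code.symm.trans e)
    · have hAx : A = s.codes c x := negC_inj (e.symm.trans hn.code)
      obtain ⟨R', hR'⟩ := h.atom' x hx hn.lab
      have h0 : s.arr aAt R' ≠ 0 := by
        rw [hR']; have := h.two_le x hx; omega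
      obtain ⟨a1, a2, a3, a4⟩ := h.atom R' h0
      rw [hR'] at a4
      have : R' = R := by
        refine h.wf.eq_of_mem_iff a1 hR fun y => ?_
        rw [a4, hmem]
        constructor
        · rintro ⟨j, hj, rfl⟩
          have : c (s.arr aOut (x + 4 + j)) ∈ A := hAx ▸ RAMState.mem_codes.2 ⟨j, hj, rfl⟩
          rw [hA, Finset.mem_image] at this
          obtain ⟨i, hi, e⟩ := this
          have hi' := Finset.mem_range.1 hi
          exact ⟨i, hi', h.inj _ (hn.mem j hj).1 _ (hEl i hi') e.symm⟩
        · rintro ⟨i, hi, rfl⟩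
          have : c (El i) ∈ s.codes c x := by
            rw [← hAx, hA]
            exact Finset.mem_image_of_mem _ (Finset.mem_range.2 hi)
          obtain ⟨j, hj, e⟩ := RAMState.mem_codes.1 this
          exact ⟨j, hj, h.inj _ (hEl i hi) _ (hn.mem j hj).1 e.symm⟩
      rw [this] at h0
      exact h0 hat
  have htc : s'.reg rTC = s.reg rTC := congrArg Trie.tc htrie
  refine ⟨⟨by omega, by rw [hout 0 (by omega)]; exact h.out0, by rw [hout 1 (by omega)]; exact h.out1,
    hhalf, htrie ▸ h.wf, ?_, ?_, ?_, ?_, ?_, ?_, ?_, ?_⟩, ⟨hsub, hc, hl⟩⟩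
  · rintro x (rfl | hx)
    · exact h2q
    · exact h.two_le x hx
  · rintro x (rfl | hx)
    · omega
    · have := hlt x hx; omega
  · rintro x (rfl | hx) y (rfl | hy) e
    · rfl
    · rw [hcq, hc y hy] at e; exact absurd e.symm (hold y hy)
    · rw [hcq, hc x hx] at e; exact absurd e (hold x hx)
    · rw [hc x hx, hc y hy] at e; exact h.inj x hx y hy e
  · rintro x (rfl | hx)
    · exact .inr hnew
    · exact (h.cases x hx).imp (fun hv => hv.congr (by omega) (by rwa [← hqe]) (hl x hx)
        (hc x hx)) (hneg x hx)
  · rw [hvar]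
    intro v hv
    obtain ⟨h1, h2⟩ := h.var v hv
    exact ⟨hsub h1, by rw [hc _ h1, h2]⟩
  · rw [hvar]
    rintro x (rfl | hx) v e
    · rw [hcq] at e; exact absurd e.symm (varC_ne_negC _ _)
    · rw [hc x hx] at e; exact h.var' x hx v e
  · rw [hat', htc, htrie]
    intro R' hR'
    by_cases hRR : R' = R
    · subst hRR
      rw [Function.update_self, hlq]
      refine ⟨hR, .inl rfl, hnew, fun y => ?_⟩
      rw [hmem]
      exact exists_congr fun i => and_congr_right fun hi => by rw [hq4 i hi]
    · rw [Function.update_of_ne hRR] at hR' ⊢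
      obtain ⟨h1, h2, h3, h4⟩ := h.atom R' hR'
      refine ⟨h1, hsub h2, hneg _ h2 h3, fun y => ?_⟩
      rw [h4, hl _ h2]
      refine exists_congr fun i => and_congr_right fun hi => ?_
      have := h3.fit
      rw [hout _ (by omega)]
  · rw [hat']
    rintro x (rfl | hx) e
    · exact ⟨R, Function.update_self ..⟩
    · rw [hout x (hlt x hx)] at e
      obtain ⟨R', hR'⟩ := h.atom' x hx e
      refine ⟨R', ?_⟩
      rw [Function.update_of_ne, hR']
      rintro rfl
      have := h.two_le x hx
      omega

/-- Addition of a variable. -/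
theorem Heap.addVar {s s' : RAMState} {V : Set ℕ} {c : ℕ → ℕ} (h : Heap s V c) {v : ℕ}
    (hv0 : s.arr aVar v = 0) (hfp : s'.reg rFP = s.reg rFP + 2)
    (hout : ∀ i < s.reg rFP, s'.arr aOut i = s.arr aOut i)
    (hq : s'.arr aOut (s.reg rFP) = 2) (hq1 : s'.arr aOut (s.reg rFP + 1) = v)
    (hhalf : ∀ i < s'.reg rFP, s'.arr aHalf i = i / 2)
    (hal : s'.arr aAL = Function.update (s.arr aAL) (s.reg rFP) 0)
    (hvar : s'.arr aVar = Function.update (s.arr aVar) v (s.reg rFP))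
    (hat : s'.arr aAt = s.arr aAt) (htrie : s'.trie = s.trie) :
    Heap s' (insert (s.reg rFP) V) (Function.update c (s.reg rFP) (varC v)) ∧
      HExt s V c s' (insert (s.reg rFP) V) (Function.update c (s.reg rFP) (varC v)) := by
  obtain ⟨q, hqe⟩ : ∃ q, q = s.reg rFP := ⟨_, rfl⟩
  rw [← hqe] at hfp hout hq hq1 hal hvar ⊢
  have hlt : ∀ x ∈ V, x < q := fun x hx => hqe ▸ h.lt x hx
  have h2q : 2 ≤ q := hqe ▸ h.fp
  have hc : ∀ x ∈ V, Function.update c q (varC v) x = c x := fun x hx =>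
    Function.update_of_ne (hlt x hx).ne _ _
  have hcq : Function.update c q (varC v) q = varC v := Function.update_self ..
  have hl : ∀ x ∈ V, s'.arr aAL x = s.arr aAL x := fun x hx => by
    rw [hal, Function.update_of_ne (hlt x hx).ne]
  have hlq : s'.arr aAL q = 0 := by rw [hal, Function.update_self]
  have hsub : V ⊆ insert q V := Set.subset_insert _ _
  have hneg : ∀ x ∈ V, NegAt s V c x → NegAt s' (insert q V) (Function.update c q (varC v)) x :=
    fun x hx hn => hn.congr (by omega) (by rwa [← hqe]) (hl x hx) hc hsub hx
  have hold : ∀ x ∈ V, c x ≠ varC v := by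
    intro x hx e
    have := h.var' x hx v e
    have := h.two_le x hx
    omega
  have htc : s'.reg rTC = s.reg rTC := congrArg Trie.tc htrie
  refine ⟨⟨by omega, by rw [hout 0 (by omega)]; exact h.out0, by rw [hout 1 (by omega)]; exact h.out1,
    hhalf, htrie ▸ h.wf, ?_, ?_, ?_, ?_, ?_, ?_, ?_, ?_⟩, ⟨hsub, hc, hl⟩⟩
  · rintro x (rfl | hx)
    · exact h2q
    · exact h.two_le x hx
  · rintro x (rfl | hx)
    · omega
    · have := hlt x hx; omega
  · rintro x (rfl | hx) y (rfl | hy) e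
    · rfl
    · rw [hcq, hc y hy] at e; exact absurd e.symm (hold y hy)
    · rw [hcq, hc x hx] at e; exact absurd e (hold x hx)
    · rw [hc x hx, hc y hy] at e; exact h.inj x hx y hy e
  · rintro x (rfl | hx)
    · exact .inl ⟨hq, by omega, hlq, by rw [hcq, hq1]⟩
    · exact (h.cases x hx).imp (fun hv => hv.congr (by omega) (by rwa [← hqe]) (hl x hx)
        (hc x hx)) (hneg x hx)
  · rw [hvar]
    intro w hw
    by_cases hwv : w = v
    · subst hwv
      rw [Function.update_self]
      exact ⟨.inl rfl, hcq⟩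
    · rw [Function.update_of_ne hwv] at hw ⊢
      obtain ⟨h1, h2⟩ := h.var w hw
      exact ⟨hsub h1, by rw [hc _ h1, h2]⟩
  · rw [hvar]
    rintro x (rfl | hx) w e
    · rw [hcq] at e
      rw [varC_inj e, Function.update_self]
    · rw [hc x hx] at e
      rw [Function.update_of_ne, h.var' x hx w e]
      rintro rfl
      exact hold x hx e
  · rw [hat, htc, htrie]
    intro R' hR'
    obtain ⟨h1, h2, h3, h4⟩ := h.atom R' hR'
    refine ⟨h1, hsub h2, hneg _ h2 h3, fun y => ?_⟩
    rw [h4, hl _ h2]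
    refine exists_congr fun i => and_congr_right fun hi => ?_
    have := h3.fit
    rw [hout _ (by omega)]
  · rw [hat]
    rintro x (rfl | hx) e
    · omega
    · rw [hout x (hlt x hx)] at e
      exact h.atom' x hx e

local notation "rRC" => (4 : ℕ)
local notation "rIn" => (17 : ℕ)
local notation "rQ" => (18 : ℕ)
local notation "rCnt" => (19 : ℕ)
local notation "rRS" => (20 : ℕ)
local notation "rI" => (21 : ℕ)
local notation "rJ" => (22 : ℕ)
local notation "rOk" => (23 : ℕ)
local notation "rBad" => (24 : ℕ)
local notation "rE" => (25 : ℕ)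
local notation "rSet" => (26 : ℕ)
local notation "aRA" => (12 : ℕ)
local notation "aRB" => (13 : ℕ)
local notation "aRM" => (14 : ℕ)
local notation "aRS" => (15 : ℕ)
local notation "aEl" => (16 : ℕ)

/-! ### Lists of atoms -/

/-- The list of atoms `L` is stored as a rope with number `r`: the empty list has number `0`, the
other ropes are single atoms and concatenations of nonempty ropes. -/
inductive Rope (s : RAMState) (V : Set ℕ) : ℕ → List ℕ → Prop
  | nil : Rope s V 0 []
  | leaf {r : ℕ} : r ≠ 0 → r ≤ s.reg rRC → s.arr aRB r = 0 → s.arr aRA r ∈ V →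
      s.arr aRM r = 2 + s.arr aAL (s.arr aRA r) → Rope s V r [s.arr aRA r]
  | node {r : ℕ} {L L' : List ℕ} : r ≠ 0 → r ≤ s.reg rRC → s.arr aRB r ≠ 0 → s.arr aRA r ≠ 0 →
      Rope s V (s.arr aRA r) L → Rope s V (s.arr aRB r) L' →
      s.arr aRM r = s.arr aRM (s.arr aRA r) + s.arr aRM (s.arr aRB r) → Rope s V r (L ++ L')

/-- The measure of a list of atoms. -/
def RAMState.meas (s : RAMState) (L : List ℕ) : ℕ := (L.map fun x => 2 + s.arr aAL x).sum

theorem RAMState.meas_append (s : RAMState) (L L' : List ℕ) :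
    s.meas (L ++ L') = s.meas L + s.meas L' := by simp [RAMState.meas]

theorem RAMState.two_le_meas (s : RAMState) {L : List ℕ} (h : L ≠ []) : 2 ≤ s.meas L := by
  cases L with
  | nil => exact absurd rfl h
  | cons x L => simp only [RAMState.meas, List.map_cons, List.sum_cons]; omega

theorem Rope.mem {s : RAMState} {V : Set ℕ} {r : ℕ} {L : List ℕ} (h : Rope s V r L) :
    ∀ x ∈ L, x ∈ V := by
  induction h with
  | nil => simp
  | leaf _ _ _ h => simpa using h
  | node _ _ _ _ _ _ _ ih ih' =>
    intro x hx
    exact (List.mem_append.1 hx).elim (ih x) (ih' x)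

theorem Rope.ne_nil {s : RAMState} {V : Set ℕ} {r : ℕ} {L : List ℕ} (h : Rope s V r L)
    (hr : r ≠ 0) : L ≠ [] := by
  induction h with
  | nil => exact absurd rfl hr
  | leaf => simp
  | node _ _ _ h _ _ _ ih => simp [ih h]

theorem Rope.eq_nil {s : RAMState} {V : Set ℕ} {L : List ℕ} (h : Rope s V 0 L) : L = [] := by
  cases h with
  | nil => rfl
  | leaf h => exact absurd rfl h
  | node h => exact absurd rfl h

/-- Since the measure is stored with each rope, the smaller of two ropes is found in constant time.
-/
theorem Rope.meas_eq {s : RAMState} {V : Set ℕ} {r : ℕ} {L : List ℕ} (h : Rope s V r L)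
    (hr : r ≠ 0) : s.arr aRM r = s.meas L := by
  induction h with
  | nil => exact absurd rfl hr
  | leaf _ _ _ _ h => simpa [RAMState.meas] using h
  | node _ _ h1 h2 _ _ h ih ih' => rw [h, ih h2, ih' h1, RAMState.meas_append]

theorem Rope.le {s : RAMState} {V : Set ℕ} {r : ℕ} {L : List ℕ} (h : Rope s V r L) :
    r ≤ s.reg rRC := by
  cases h with
  | nil => exact Nat.zero_le _
  | leaf _ h => exact h
  | node _ h => exact h

/-- The ropes of `s` are ropes of `s'`. -/
structure RExt (s s' : RAMState) : Prop where
  rc : s.reg rRC ≤ s'.reg rRC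
  ra : ∀ r ≤ s.reg rRC, s'.arr aRA r = s.arr aRA r
  rb : ∀ r ≤ s.reg rRC, s'.arr aRB r = s.arr aRB r
  rm : ∀ r ≤ s.reg rRC, s'.arr aRM r = s.arr aRM r

theorem RExt.refl (s : RAMState) : RExt s s :=
  ⟨le_rfl, fun _ _ => rfl, fun _ _ => rfl, fun _ _ => rfl⟩

theorem RExt.trans {s s' s'' : RAMState} (h : RExt s s') (h' : RExt s' s'') : RExt s s'' :=
  ⟨h.rc.trans h'.rc, fun r hr => (h'.ra r (hr.trans h.rc)).trans (h.ra r hr),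
    fun r hr => (h'.rb r (hr.trans h.rc)).trans (h.rb r hr),
    fun r hr => (h'.rm r (hr.trans h.rc)).trans (h.rm r hr)⟩

theorem RExt.frame {p : RAMProg} {s s' : RAMState} (f : Frame p s s')
    (h : rRC ∉ p.regs ∧ aRA ∉ p.arrs ∧ aRB ∉ p.arrs ∧ aRM ∉ p.arrs) : RExt s s' :=
  ⟨(f.reg _ h.1).ge, fun _ _ => by rw [f.arr _ h.2.1], fun _ _ => by rw [f.arr _ h.2.2.1],
    fun _ _ => by rw [f.arr _ h.2.2.2]⟩

/-- Ropes and atoms are never changed once created, so values on the stack survive all later steps.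
-/
theorem Rope.mono {s s' : RAMState} {V V' : Set ℕ} {c c' : ℕ → ℕ} (hr : RExt s s')
    (hh : HExt s V c s' V' c') {r : ℕ} {L : List ℕ} (h : Rope s V r L) : Rope s' V' r L := by
  induction h with
  | nil => exact .nil
  | @leaf r h1 h2 h3 h4 h5 =>
    have e := hr.ra r h2
    rw [← e]
    refine .leaf h1 (h2.trans hr.rc) ?_ ?_ ?_
    · rw [hr.rb r h2, h3]
    · rw [e]; exact hh.sub h4
    · rw [hr.rm r h2, h5, e, hh.len _ h4]
  | @node r L L' h1 h2 h3 h4 hL hL' h5 ih ih' =>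
    have e := hr.ra r h2
    have e' := hr.rb r h2
    refine .node h1 (h2.trans hr.rc) ?_ ?_ ?_ ?_ ?_
    · rwa [e']
    · rwa [e]
    · rwa [e]
    · rwa [e']
    · rw [hr.rm r h2, h5, e, e', hr.rm _ hL.le, hr.rm _ hL'.le]

theorem HExt.meas_eq {s s' : RAMState} {V V' : Set ℕ} {c c' : ℕ → ℕ} (h : HExt s V c s' V' c')
    {L : List ℕ} (hL : ∀ x ∈ L, x ∈ V) : s'.meas L = s.meas L := by
  unfold RAMState.meas
  rw [List.map_congr_left fun x hx => by rw [h.len x (hL x hx)]]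

/-- The stack `rs` of height `n` contains nonempty ropes with lists `st`, the top one first. -/
inductive RStack (s : RAMState) (V : Set ℕ) (rs : ℕ → ℕ) : ℕ → List (List ℕ) → Prop
  | nil : RStack s V rs 0 []
  | cons {n : ℕ} {L : List ℕ} {st : List (List ℕ)} : rs n ≠ 0 → Rope s V (rs n) L →
      RStack s V rs n st → RStack s V rs (n + 1) (L :: st)

theorem RStack.congr {s : RAMState} {V : Set ℕ} {rs rs' : ℕ → ℕ} {n : ℕ} {st : List (List ℕ)}
    (h : RStack s V rs n st) (he : ∀ i < n, rs' i = rs i) : RStack s V rs' n st := by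
  induction h with
  | nil => exact .nil
  | @cons n L st h1 h2 h3 ih =>
    refine .cons ?_ ?_ (ih fun i hi => he i (by omega))
    · rwa [he n (by omega)]
    · rwa [he n (by omega)]

/-! ### Sealing a list: the programs -/

section
open RAMExpr RAMProg

/-- Write the value of `e` to the next free place of the output. -/
def emitP (e : RAMExpr) : RAMProg := block [
  store aOut (reg rFP) e,
  -- The table of halves grows with the output, so that every address in use can be inserted into a
  -- trie.
  store aHalf (reg rFP) (add (load aHalf (sub (reg rFP) (const 2))) (const 1)),
  assign rFP (add (reg rFP) (const 1))]

/-- Treat the next entry of the stack of ropes. -/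
def collectStepP : RAMProg := block [
  assign rRS (sub (reg rRS) (const 1)),
  assign rI (load aRS (reg rRS)),
  ite (load aRB (reg rI))
    (block [
      store aRS (reg rRS) (load aRA (reg rI)),
      store aRS (add (reg rRS) (const 1)) (load aRB (reg rI)),
      assign rRS (add (reg rRS) (const 2))])
    (block [
      assign rX (load aRA (reg rI)),
      assign rSet (reg rRoot),
      insertP,
      ite (eq (reg rRoot) (reg rSet)) skip
        (block [store aEl (reg rCnt) (reg rX), assign rCnt (add (reg rCnt) (const 1))])])]

/-- Compute the trie node `rRoot` of the set of atoms of the rope `rIn`, and the list of its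
elements in `aEl`. -/
def collectP : RAMProg := block [
  assign rRoot (const 0), assign rCnt (const 0), store aRS (const 0) (reg rIn),
  assign rRS (const 1),
  loop (reg rRS) collectStepP]

/-- Compute in `rOk` whether all arguments of the atom `rE` are in the set `rSet`. -/
def checkAtomP : RAMProg := block [
  assign rOk (lt (const 0) (load aAL (reg rE))),
  assign rJ (const 0),
  loop (lt (reg rJ) (load aAL (reg rE))) (block [
    assign rX (load aOut (add (add (reg rE) (const 4)) (reg rJ))),
    assign rRoot (reg rSet),
    insertP,
    ite (eq (reg rRoot) (reg rSet)) skip (assign rOk (const 0)),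
    assign rJ (add (reg rJ) (const 1))])]

/-- Compute in `rBad` whether the set `rRoot` is inconsistent. -/
def checkP : RAMProg := block [
  assign rSet (reg rRoot), assign rBad (const 0), assign rI (const 0),
  loop (lt (reg rI) (reg rCnt)) (block [
    assign rE (load aEl (reg rI)),
    checkAtomP,
    ite (reg rOk) (assign rBad (const 1)) skip,
    assign rI (add (reg rI) (const 1))])]

/-- Write the complement of the join of the elements of `aEl` to the output. -/
def emitAtomP : RAMProg := block [
  assign rQ (reg rFP),
  emitP (const 3),
  ite (eq (reg rCnt) (const 1)) (emitP (load aEl (const 0))) (emitP (add (reg rFP) (const 1))),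
  emitP (const 4),
  emitP (reg rCnt),
  assign rI (const 0),
  loop (lt (reg rI) (reg rCnt)) (block [
    emitP (load aEl (reg rI)),
    assign rI (add (reg rI) (const 1))]),
  store aAL (reg rQ) (reg rCnt),
  store aAt (reg rSet) (reg rQ)]

/-- Find or create the complement of the join of the rope `rIn`; its address is written to `rQ`,
or `0` if the rope is inconsistent. -/
def sealP : RAMProg := block [
  collectP,
  assign rQ (load aAt (reg rRoot)),
  ite (reg rQ) skip (block [checkP, ite (reg rBad) skip emitAtomP])]

end

/-! ### Sealing a list: correctness -/

theorem Nat.log_two_lt {x D : ℕ} (h : x < 2 ^ D) (hD : 1 ≤ D) : Nat.log 2 x + 1 ≤ D := by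
  by_cases h0 : x = 0
  · simpa [h0] using hD
  · exact Nat.log_lt_of_lt_pow h0 h

/-- An atom is recorded exactly when its insertion changes the root, so `aEl` lists the set without
repetitions. The last bound prepares the cost of the consistency check. -/
theorem wp_collectP {s : RAMState} {V : Set ℕ} {c : ℕ → ℕ} (h : Heap s V c) {L : List ℕ}
    (hr0 : s.reg rIn ≠ 0) (hr : Rope s V (s.reg rIn) L) {D : ℕ} (hD : 1 ≤ D)
    (hfp : s.reg rFP ≤ 2 ^ D) :
    wp collectP s fun s' k => k ≤ 320 * D * s.meas L ∧ s'.trie.WF ∧ s.trie.Ext s'.trie ∧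
      s'.reg rRoot ≤ s'.reg rTC ∧ (∀ i < s'.reg rCnt, s'.arr aEl i ∈ L) ∧
      (∀ i < s'.reg rCnt, ∀ j < s'.reg rCnt, s'.arr aEl i = s'.arr aEl j → i = j) ∧
      (∀ y, s'.trie.Mem (s'.reg rRoot) y ↔ y ∈ L) ∧
      (∀ y, y ∈ L ↔ ∃ i < s'.reg rCnt, y = s'.arr aEl i) ∧
      ∑ i ∈ Finset.range (s'.reg rCnt), (2 + s.arr aAL (s'.arr aEl i)) ≤ s.meas L := by
  have h2 := s.two_le_meas (hr.ne_nil hr0)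
  simp [collectP]
  -- Each list on the stack holds its measure minus one as budget: splitting a rope releases one
  -- unit, and a single atom still holds at least one, which pays for its insertion.
  refine (wp_loop (b := 320 * D * (s.meas L - 1)) (fun b s' => ∃ st,
    b = 320 * D * (st.map fun l => s.meas l - 1).sum ∧
    RStack s V (s'.arr aRS) (s'.reg rRS) st ∧ s'.trie.WF ∧ s.trie.Ext s'.trie ∧
    s'.reg rRoot ≤ s'.reg rTC ∧ (∀ i < s'.reg rCnt, s'.arr aEl i ∈ L) ∧
    (∀ i < s'.reg rCnt, ∀ j < s'.reg rCnt, s'.arr aEl i = s'.arr aEl j → i = j) ∧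
    (∀ y, s'.trie.Mem (s'.reg rRoot) y ↔ ∃ i < s'.reg rCnt, y = s'.arr aEl i) ∧
    (∀ y, y ∈ L ↔ s'.trie.Mem (s'.reg rRoot) y ∨ ∃ l ∈ st, y ∈ l) ∧
    ∑ i ∈ Finset.range (s'.reg rCnt), (2 + s.arr aAL (s'.arr aEl i)) +
      (st.map fun l => s.meas l).sum ≤ s.meas L) ?_ ?_).mono ?_
  · rintro b s' ⟨st, rfl, hst, hwf, hext, hroot, hEl, hnd, hmem, hL, hsum⟩ hf he
    have hRS0 : s'.reg rRS ≠ 0 := he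
    obtain ⟨n, hn⟩ : ∃ n, s'.reg rRS = n + 1 := ⟨s'.reg rRS - 1, by omega⟩
    rw [hn] at hst
    have e10 : s'.arr aAL = s.arr aAL := (hf.arr _ (by decide)).trans (by simp)
    have e12 : s'.arr aRA = s.arr aRA := (hf.arr _ (by decide)).trans (by simp)
    have e13 : s'.arr aRB = s.arr aRB := (hf.arr _ (by decide)).trans (by simp)
    have e2 : s'.arr aHalf = s.arr aHalf := (hf.arr _ (by decide)).trans (by simp)
    cases hst with
    | @cons _ l st h1 h2 h3 =>
    simp only [List.map_cons, List.sum_cons] at hsum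
    have hl2 := s.two_le_meas (h2.ne_nil h1)
    simp only [collectStepP, wp_block_cons, wp_assign, wp_ite]
    simp only [RAMExpr.val_load, RAMExpr.val_reg, RAMExpr.val_sub, RAMExpr.val_const,
      RAMState.setReg_reg, RAMState.setReg_arr, if_true, hn, Nat.add_sub_cancel, e13, e12]
    generalize hrr : s'.arr aRS n = r at h1 h2
    cases h2 with
    | nil => exact absurd rfl h1
    | leaf g1 g2 g3 g4 g5 =>
      have hxV := h.two_le _ g4
      have hxlt := h.lt _ g4
      refine ⟨fun hb => absurd g3 (by simpa [hrr] using hb), fun _ => ?_⟩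
      simp
      refine (wp_insertP ?_ ?_ ?_ ?_).mono ?_
      · exact hwf
      · simpa using hroot
      · simp; omega
      · intro i hi
        simp at hi ⊢
        rw [e2, h.half i (by omega)]
      rintro s2 k2 f2 ⟨hk2, hins, -⟩
      have hlog := Nat.log_two_lt (x := s.arr aRA r) (D := D) (by omega) hD
      have hX : s2.reg rX = s.arr aRA r := (f2.reg _ (by decide)).trans (by simp)
      have hCnt : s2.reg rCnt = s'.reg rCnt := (f2.reg _ (by decide)).trans (by simp)
      have hRS : s2.reg rRS = n := (f2.reg _ (by decide)).trans (by simp)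
      have hSet : s2.reg rSet = s'.reg rRoot := (f2.reg _ (by decide)).trans (by simp)
      have hEl2 : s2.arr aEl = s'.arr aEl := (f2.arr _ (by decide)).trans (by simp)
      have hRS2 : s2.arr aRS = s'.arr aRS := (f2.arr _ (by decide)).trans (by simp)
      simp at hk2 hins
      have hins' : Trie.Inserted s'.trie s2.trie (s'.reg rRoot) (s2.reg rRoot) (s.arr aRA r) := hins
      have hmul : 320 * D * ((s.meas [s.arr aRA r] - 1) + (st.map fun l => s.meas l - 1).sum) =
        320 * D * (s.meas [s.arr aRA r] - 1) + 320 * D * (st.map fun l => s.meas l - 1).sum :=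
        mul_add _ _ _
      have hge : 320 * D ≤ 320 * D * (s.meas [s.arr aRA r] - 1) :=
        Nat.le_mul_of_pos_right _ (by omega)
      have hLx : s.arr aRA r ∈ L := (hL _).2 (.inr ⟨_, List.mem_cons_self, by simp⟩)
      have hle := hins'.le
      have heq := hins'.eq_iff hwf hroot
      simp [hX, hCnt, hSet, hRS]
      constructor
      · intro hee
        have hm := heq.1 hee
        refine ⟨st, ⟨?_, hins'.wf, hext.trans hins'.ext, hle, ?_, ?_, ?_, ?_, ?_⟩, by omega⟩
        · rw [hRS2]; exact h3
        · rw [hEl2]; exact hEl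
        · rw [hEl2]; exact hnd
        · intro y
          rw [hins'.mem, hEl2, ← hmem]
          exact ⟨fun hy => hy.elim id (fun e => e ▸ hm), .inl⟩
        · intro y
          rw [hins'.mem, hL]
          simp only [List.mem_cons, exists_eq_or_imp, List.not_mem_nil, or_false, or_assoc]
        · rw [hEl2]; omega
      · intro hne
        have hnm : ¬ ∃ i < s'.reg rCnt, s.arr aRA r = s'.arr aEl i := by
          rw [← hmem]; exact fun hm => hne (heq.2 hm)
        refine ⟨st, ⟨?_, hins'.wf, hext.trans hins'.ext, hle, ?_, ?_, ?_, ?_, ?_⟩, by omega⟩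
        · rw [hRS2]; exact h3
        · rw [hEl2]
          intro i hi
          by_cases hi' : i = s'.reg rCnt
          · rw [hi', Function.update_self]; exact hLx
          · rw [Function.update_of_ne hi']; exact hEl i (by omega)
        · rw [hEl2]
          intro i hi j hj hij
          by_cases hi' : i = s'.reg rCnt
          · by_cases hj' : j = s'.reg rCnt
            · omega
            · rw [hi', Function.update_self, Function.update_of_ne hj'] at hij
              exact absurd ⟨j, by omega, hij⟩ hnm
          · by_cases hj' : j = s'.reg rCnt
            · rw [hj', Function.update_self, Function.update_of_ne hi'] at hij
              exact absurd ⟨i, by omega, hij.symm⟩ hnm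
            · rw [Function.update_of_ne hj', Function.update_of_ne hi'] at hij
              exact hnd i (by omega) j (by omega) hij
        · intro y
          change s2.trie.Mem _ _ ↔ _
          rw [hins'.mem, hmem, hEl2]
          constructor
          · rintro (⟨i, hi, rfl⟩ | rfl)
            · exact ⟨i, by omega, (Function.update_of_ne (by omega) _ _).symm⟩
            · exact ⟨s'.reg rCnt, by omega, by rw [Function.update_self]⟩
          · rintro ⟨i, hi, rfl⟩
            by_cases hi' : i = s'.reg rCnt
            · right; rw [hi', Function.update_self]
            · left; exact ⟨i, by omega, Function.update_of_ne hi' _ _⟩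
        · intro y
          change _ ↔ s2.trie.Mem _ _ ∨ _
          rw [hins'.mem, hL]
          simp only [List.mem_cons, exists_eq_or_imp, List.not_mem_nil, or_false, or_assoc]
        · rw [Finset.sum_range_succ, hEl2, Function.update_self]
          rw [Finset.sum_congr rfl fun i hi => by
            rw [Function.update_of_ne (Finset.mem_range.1 hi).ne]]
          simp only [RAMState.meas, List.map_cons, List.map_nil, List.sum_cons, List.sum_nil]
            at hsum ⊢
          omega
    | @node _ l1 l2 g1 g2 g3 g4 g5 g6 g7 =>
      refine ⟨fun _ => ?_, fun hb => absurd (by simpa [hrr] using hb) g3⟩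
      simp [e12, e13]
      have q1 := s.two_le_meas (g5.ne_nil g4)
      have q2 := s.two_le_meas (g6.ne_nil g3)
      rw [RAMState.meas_append] at hsum ⊢
      have hmul : 320 * D * ((s.meas l1 + s.meas l2 - 1) + (st.map fun l => s.meas l - 1).sum) =
          320 * D + 320 * D * ((s.meas l2 - 1) + ((s.meas l1 - 1) +
            (st.map fun l => s.meas l - 1).sum)) := by
        rw [← mul_one_add]
        congr 1
        omega
      refine ⟨l2 :: l1 :: st, ⟨?_, hwf, hext, hroot, hEl, hnd, hmem, ?_, ?_⟩, ?_⟩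
      · refine .cons (n := n + 1) ?_ ?_ (.cons (n := n) ?_ ?_ (h3.congr fun i hi => ?_))
        · simpa using g3
        · simpa using g6
        · simpa [Function.update_apply] using g4
        · simpa [Function.update_apply] using g5
        · rw [Function.update_of_ne (by omega), Function.update_of_ne (by omega)]
      · intro y
        change _ ↔ s'.trie.Mem _ _ ∨ _
        rw [hL]
        simp only [List.mem_cons, exists_eq_or_imp, List.mem_append]
        tauto
      · simp only [List.map_cons, List.sum_cons]; omega
      · simp only [List.map_cons, List.sum_cons]; omega
  · refine ⟨[L], by simp, ?_, h.wf, .refl _, by simp, by simp, by simp, ?_, ?_, by simp⟩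
    · exact .cons (n := 0) (by simpa using hr0) (by simpa using hr) .nil
    · intro y
      simp
      exact h.wf.not_mem_empty y
    · intro y
      simp
      exact fun hy => absurd hy (h.wf.not_mem_empty y)
  · rintro s' k hf ⟨b, ⟨st, rfl, hst, hwf, hext, hroot, hEl, hnd, hmem, hL, hsum⟩, he, hk⟩
    have hRS0 : s'.reg rRS = 0 := he
    rw [hRS0] at hst
    cases hst
    simp at hk hL hsum
    have hmul : 320 * D * s.meas L = 320 * D * (s.meas L - 1) + 320 * D := by
      rw [← Nat.mul_succ]; congr 1; omega
    refine ⟨by omega, hwf, hext, hroot, hEl, hnd, fun y => (hL y).symm,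
      fun y => (hL y).trans (hmem y), ?_⟩
    simpa using hsum

/-- The set itself is left alone: insertions only serve as membership tests, and the nodes that they
create merely extend the table. A variable has no arguments and must not count as a clash. -/
theorem wp_checkAtomP {s : RAMState} {V : Set ℕ} {c : ℕ → ℕ} (h : Heap s V c) {L : List ℕ}
    (hset : s.reg rSet ≤ s.reg rTC) (hmem : ∀ y, s.trie.Mem (s.reg rSet) y ↔ y ∈ L)
    (hE : s.reg rE ∈ V) {D : ℕ} (hD : 1 ≤ D) (hfp : s.reg rFP ≤ 2 ^ D) :
    wp checkAtomP s fun s' k => k ≤ 320 * D * s.arr aAL (s.reg rE) + 20 ∧ s'.trie.WF ∧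
      s.trie.Ext s'.trie ∧ (s'.reg rOk ≠ 0 ↔ 0 < s.arr aAL (s.reg rE) ∧
        ∀ j < s.arr aAL (s.reg rE), s.arr aOut (s.reg rE + 4 + j) ∈ L) := by
  simp [checkAtomP]
  refine (wp_loop (b := 320 * D * s.arr aAL (s.reg rE)) (fun b s' =>
    b = 320 * D * (s.arr aAL (s.reg rE) - s'.reg rJ) ∧ s'.reg rJ ≤ s.arr aAL (s.reg rE) ∧
    s'.trie.WF ∧ s.trie.Ext s'.trie ∧ (s'.reg rOk ≠ 0 ↔ 0 < s.arr aAL (s.reg rE) ∧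
        ∀ j < s'.reg rJ, s.arr aOut (s.reg rE + 4 + j) ∈ L)) ?_ ?_).mono ?_
  · rintro b s' ⟨rfl, hJ, hwf, hext, hok⟩ hf he
    have e10 : s'.arr aAL = s.arr aAL := (hf.arr _ (by decide)).trans (by simp)
    have e1 : s'.arr aOut = s.arr aOut := (hf.arr _ (by decide)).trans (by simp)
    have e2 : s'.arr aHalf = s.arr aHalf := (hf.arr _ (by decide)).trans (by simp)
    have eE : s'.reg rE = s.reg rE := (hf.reg _ (by decide)).trans (by simp)
    have eS : s'.reg rSet = s.reg rSet := (hf.reg _ (by decide)).trans (by simp)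
    have hlt : s'.reg rJ < s.arr aAL (s.reg rE) := by
      simpa [e10, eE] using he
    have hneg : NegAt s V c (s.reg rE) := (h.cases _ hE).resolve_left fun hv => by
      rw [hv.len] at hlt; omega
    obtain ⟨hyV, -⟩ := hneg.mem _ hlt
    have hy2 := h.two_le _ hyV
    have hylt := h.lt _ hyV
    have hsetle : s.reg rSet ≤ s'.reg rTC := hset.trans hext.tc
    simp [e1, eE, eS]
    refine (wp_insertP ?_ ?_ ?_ ?_).mono ?_
    · exact hwf
    · simpa using hsetle
    · simp; omega
    · intro i hi
      simp at hi ⊢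
      rw [e2, h.half i (by omega)]
    rintro s2 k2 f2 ⟨hk2, hins, -⟩
    have hlog := Nat.log_two_lt (x := s.arr aOut (s.reg rE + 4 + s'.reg rJ)) (D := D)
      (by omega) hD
    simp at hk2 hins
    have hins' : Trie.Inserted s'.trie s2.trie (s.reg rSet) (s2.reg rRoot)
      (s.arr aOut (s.reg rE + 4 + s'.reg rJ)) := hins
    have heq := hins'.eq_iff hwf hsetle
    rw [hext.mem_iff h.wf hset, hmem] at heq
    have hSet : s2.reg rSet = s.reg rSet := (f2.reg _ (by decide)).trans (by simp [eS])
    have hJ2 : s2.reg rJ = s'.reg rJ := (f2.reg _ (by decide)).trans (by simp)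
    have hOk2 : s2.reg rOk = s'.reg rOk := (f2.reg _ (by decide)).trans (by simp)
    have hmul : 320 * D * (s.arr aAL (s.reg rE) - s'.reg rJ) =
        320 * D * (s.arr aAL (s.reg rE) - (s'.reg rJ + 1)) + 320 * D := by
      rw [← Nat.mul_succ]; congr 1; omega
    simp [hSet, hJ2, hOk2]
    constructor
    · intro e
      refine ⟨⟨hlt, hins'.wf, hext.trans hins'.ext, ?_⟩, by omega⟩
      rw [← ne_eq, hok]
      refine and_congr_right fun _ => ⟨fun H j hj => ?_, fun H j hj => H j (by omega)⟩
      by_cases hj' : j = s'.reg rJ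
      · subst hj'; exact heq.1 e
      · exact H j (by omega)
    · intro e
      refine ⟨⟨hlt, hins'.wf, hext.trans hins'.ext, fun _ => ?_⟩, by omega⟩
      exact ⟨s'.reg rJ, by omega, fun hm => e (heq.2 hm)⟩
  · refine ⟨by simp, by simp, h.wf, .refl _, ?_⟩
    simp
  · rintro s' k hf ⟨b, ⟨rfl, hJ, hwf, hext, hok⟩, he, hk⟩
    have e10 : s'.arr aAL = s.arr aAL := (hf.arr _ (by decide)).trans (by simp)
    have eE : s'.reg rE = s.reg rE := (hf.reg _ (by decide)).trans (by simp)
    have hge : s.arr aAL (s.reg rE) ≤ s'.reg rJ := by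
      simpa [e10, eE] using he
    have hJe : s'.reg rJ = s.arr aAL (s.reg rE) := le_antisymm hJ hge
    simp at hk
    refine ⟨by omega, hwf, hext, ?_⟩
    rw [← hJe, ← ne_eq, hok, hJe]

/-- The cost is one insertion for each argument of each distinct member, which explains the
contribution of the number of arguments to the measure. -/
theorem wp_checkP {s : RAMState} {V : Set ℕ} {c : ℕ → ℕ} (h : Heap s V c) {L : List ℕ}
    (hset : s.reg rRoot ≤ s.reg rTC) (hmem : ∀ y, s.trie.Mem (s.reg rRoot) y ↔ y ∈ L)
    (hEl : ∀ i < s.reg rCnt, s.arr aEl i ∈ V)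
    {D : ℕ} (hD : 1 ≤ D) (hfp : s.reg rFP ≤ 2 ^ D) :
    wp checkP s fun s' k => k ≤ 320 * D *
        ∑ i ∈ Finset.range (s.reg rCnt), (2 + s.arr aAL (s.arr aEl i)) + 20 ∧ s'.trie.WF ∧
      s.trie.Ext s'.trie ∧ s'.reg rSet = s.reg rRoot ∧
      (s'.reg rBad ≠ 0 ↔ ∃ i < s.reg rCnt, 0 < s.arr aAL (s.arr aEl i) ∧
        ∀ j < s.arr aAL (s.arr aEl i), s.arr aOut (s.arr aEl i + 4 + j) ∈ L) := by
  set f : ℕ → ℕ := fun i => 2 + s.arr aAL (s.arr aEl i) with hfdef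
  simp [checkP]
  refine (wp_loop (b := 320 * D * ∑ i ∈ Finset.range (s.reg rCnt), f i) (fun b s' =>
    320 * D * ∑ i ∈ Finset.range (s.reg rCnt), f i =
      b + 320 * D * ∑ i ∈ Finset.range (s'.reg rI), f i ∧ s'.reg rI ≤ s.reg rCnt ∧
    s'.trie.WF ∧ s.trie.Ext s'.trie ∧ (s'.reg rBad ≠ 0 ↔ ∃ i < s'.reg rI,
      0 < s.arr aAL (s.arr aEl i) ∧
        ∀ j < s.arr aAL (s.arr aEl i), s.arr aOut (s.arr aEl i + 4 + j) ∈ L)) ?_ ?_).mono ?_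
  · rintro b s' ⟨hb, hI, hwf, hext, hbad⟩ hf he
    have e10 : s'.arr aAL = s.arr aAL := (hf.arr _ (by decide)).trans (by simp)
    have e1 : s'.arr aOut = s.arr aOut := (hf.arr _ (by decide)).trans (by simp)
    have e16 : s'.arr aEl = s.arr aEl := (hf.arr _ (by decide)).trans (by simp)
    have eC : s'.reg rCnt = s.reg rCnt := (hf.reg _ (by decide)).trans (by simp)
    have eS : s'.reg rSet = s.reg rRoot := (hf.reg _ (by decide)).trans (by simp)
    have eFP : s'.reg rFP = s.reg rFP := (hf.reg _ (by decide)).trans (by simp)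
    have hlt : s'.reg rI < s.reg rCnt := by simpa [eC] using he
    have hH : Heap s' V c := h.congr eFP e1 ((hf.arr _ (by decide)).trans (by simp))
      ((hf.arr _ (by decide)).trans (by simp)) e10 ((hf.arr _ (by decide)).trans (by simp)) hwf hext
    simp [e16]
    refine (wp_checkAtomP (V := V) (c := c) (L := L) (D := D) ?_ ?_ ?_ ?_ hD ?_).mono ?_
    · exact hH.congr rfl rfl rfl rfl rfl rfl hwf (.refl _)
    · simp [eS]; exact hset.trans hext.tc
    · intro y
      simp [eS]
      exact (hext.mem_iff h.wf hset y).trans (hmem y)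
    · simpa using hEl _ hlt
    · simpa [eFP] using hfp
    rintro s2 k2 f2 ⟨hk2, w2, x2, hok⟩
    simp [e10, e1] at hk2 hok
    have hI2 : s2.reg rI = s'.reg rI := (f2.reg _ (by decide)).trans (by simp)
    have hB2 : s2.reg rBad = s'.reg rBad := (f2.reg _ (by decide)).trans (by simp)
    have x2' : s'.trie.Ext s2.trie := x2
    have hsum : ∑ i ∈ Finset.range (s'.reg rI + 1), f i ≤
        ∑ i ∈ Finset.range (s.reg rCnt), f i :=
      Finset.sum_le_sum_of_subset (Finset.range_subset_range.2 hlt)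
    have hsum' := Nat.mul_le_mul_left (320 * D) hsum
    have hstep : 320 * D * ∑ i ∈ Finset.range (s'.reg rI + 1), f i =
        320 * D * ∑ i ∈ Finset.range (s'.reg rI), f i + 320 * D * f (s'.reg rI) := by
      rw [Finset.sum_range_succ, mul_add]
    have hf2 : 320 * D * f (s'.reg rI) =
        320 * D * 2 + 320 * D * s.arr aAL (s.arr aEl (s'.reg rI)) := by
      rw [← mul_add]
    simp [hI2, hB2]
    constructor
    · intro hne
      have hok' := hok.1 hne
      refine ⟨b - 320 * D * f (s'.reg rI), ⟨by omega, hlt, w2, hext.trans x2',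
        ⟨s'.reg rI, by omega, hok'⟩⟩, by omega⟩
    · intro hz
      refine ⟨b - 320 * D * f (s'.reg rI), ⟨by omega, hlt, w2, hext.trans x2', ?_⟩, by omega⟩
      rw [← ne_eq, hbad]
      constructor
      · rintro ⟨i, hi, H⟩; exact ⟨i, by omega, H⟩
      · rintro ⟨i, hi, H⟩
        by_cases hi' : i = s'.reg rI
        · subst hi'
          exact absurd hz (hok.2 H)
        · exact ⟨i, by omega, H⟩
  · exact ⟨by simp, by simp, h.wf, .refl _, by simp⟩
  · rintro s' k hf ⟨b, ⟨hb, hI, hwf, hext, hbad⟩, he, hk⟩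
    have eC : s'.reg rCnt = s.reg rCnt := (hf.reg _ (by decide)).trans (by simp)
    have eS : s'.reg rSet = s.reg rRoot := (hf.reg _ (by decide)).trans (by simp)
    have hge : s.reg rCnt ≤ s'.reg rI := by simpa [eC] using he
    have hIe : s'.reg rI = s.reg rCnt := le_antisymm hI hge
    simp at hk
    rw [hIe] at hbad hb
    have hb' : b = 0 := by omega
    subst hb'
    refine ⟨?_, hwf, hext, eS, hbad⟩
    change _ ≤ 320 * D * ∑ i ∈ Finset.range (s.reg rCnt), f i + 20
    omega

theorem wp_emitP {s : RAMState} {e : RAMExpr} (hfp : 2 ≤ s.reg rFP)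
    (hhalf : ∀ i < s.reg rFP, s.arr aHalf i = i / 2) :
    wp (emitP e) s fun s' k => k = e.cost + 15 ∧ s'.reg rFP = s.reg rFP + 1 ∧
      s'.arr aOut = Function.update (s.arr aOut) (s.reg rFP) (e.val s) ∧
      ∀ i < s.reg rFP + 1, s'.arr aHalf i = i / 2 := by
  simp [emitP]
  refine ⟨by omega, fun i hi => ?_⟩
  by_cases h : i = s.reg rFP
  · rw [h, Function.update_self, hhalf _ (by omega)]; omega
  · rw [Function.update_of_ne h, hhalf _ (by omega)]

/-- Layout: label `3`, pointer, label `4`, number of arguments, arguments. From the third cell on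
this is the stored join. A join of one element must not appear in a normal form, so then the pointer
leads to the element directly. -/
theorem wp_emitAtomP {s : RAMState} (hfp : 2 ≤ s.reg rFP)
    (hhalf : ∀ i < s.reg rFP, s.arr aHalf i = i / 2) :
    wp emitAtomP s fun s' k => k ≤ 60 * s.reg rCnt + 150 ∧
      s'.reg rFP = s.reg rFP + 4 + s.reg rCnt ∧ s'.reg rQ = s.reg rFP ∧
      (∀ i < s.reg rFP, s'.arr aOut i = s.arr aOut i) ∧ s'.arr aOut (s.reg rFP) = 3 ∧
      s'.arr aOut (s.reg rFP + 1) =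
        (if s.reg rCnt = 1 then s.arr aEl 0 else s.reg rFP + 2) ∧
      s'.arr aOut (s.reg rFP + 2) = 4 ∧ s'.arr aOut (s.reg rFP + 3) = s.reg rCnt ∧
      (∀ i < s.reg rCnt, s'.arr aOut (s.reg rFP + 4 + i) = s.arr aEl i) ∧
      (∀ i < s'.reg rFP, s'.arr aHalf i = i / 2) ∧
      s'.arr aAL = Function.update (s.arr aAL) (s.reg rFP) (s.reg rCnt) ∧
      s'.arr aAt = Function.update (s.arr aAt) (s.reg rSet) (s.reg rFP) := by
  simp only [emitAtomP, wp_block_cons, wp_assign]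
  refine (wp_emitP ?_ ?_).mono ?_
  · simpa using hfp
  · simpa using hhalf
  rintro s1 k1 f1 ⟨rfl, fp1, out1, half1⟩
  have cnt1 : s1.reg rCnt = s.reg rCnt := (f1.reg _ (by decide)).trans (by simp)
  have el1 : s1.arr aEl = s.arr aEl := (f1.arr _ (by decide)).trans (by simp)
  have al1 : s1.arr aAL = s.arr aAL := (f1.arr _ (by decide)).trans (by simp)
  have at1 : s1.arr aAt = s.arr aAt := (f1.arr _ (by decide)).trans (by simp)
  have set1 : s1.reg rSet = s.reg rSet := (f1.reg _ (by decide)).trans (by simp)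
  have q1 : s1.reg rQ = s.reg rFP := (f1.reg _ (by decide)).trans (by simp)
  simp at fp1 out1 half1
  refine wp.mono (Q := fun s2 k => k ≤ 30 ∧ s2.reg rFP = s.reg rFP + 2 ∧
    s2.arr aOut = Function.update (s1.arr aOut) (s.reg rFP + 1)
      (if s.reg rCnt = 1 then s.arr aEl 0 else s.reg rFP + 2) ∧
    ∀ i < s.reg rFP + 2, s2.arr aHalf i = i / 2) ?_ ?_
  · rw [wp_ite]
    constructor
    · intro h
      have h' : s.reg rCnt = 1 := by simpa [cnt1] using h
      refine (wp_emitP ?_ ?_).mono ?_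
      · omega
      · exact fun i hi => half1 i (by omega)
      rintro s2 k2 f2 ⟨rfl, fp2, out2, half2⟩
      rw [fp1] at fp2 out2 half2
      refine ⟨by simp, fp2, ?_, half2⟩
      rw [out2, if_pos h', RAMExpr.val_load, RAMExpr.val_const, el1]
    · intro h
      have h' : s.reg rCnt ≠ 1 := by simpa [cnt1] using h
      refine (wp_emitP ?_ ?_).mono ?_
      · omega
      · exact fun i hi => half1 i (by omega)
      rintro s2 k2 f2 ⟨rfl, fp2, out2, half2⟩
      rw [fp1] at fp2 out2 half2
      refine ⟨by simp, fp2, ?_, half2⟩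
      rw [out2, if_neg h', RAMExpr.val_add, RAMExpr.val_const, RAMExpr.val_reg, fp1]
  rintro s2 k2 f2 ⟨hk2, fp2, out2, half2⟩
  refine (wp_emitP ?_ ?_).mono ?_
  · omega
  · rwa [fp2]
  rintro s3 k3 f3 ⟨rfl, fp3, out3, half3⟩
  rw [fp2] at fp3 out3 half3
  refine (wp_emitP ?_ ?_).mono ?_
  · omega
  · rwa [fp3]
  rintro s4 k4 f4 ⟨rfl, fp4, out4, half4⟩
  rw [fp3] at fp4 out4 half4
  have cnt3 : s3.reg rCnt = s.reg rCnt :=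
    (f3.reg _ (by decide)).trans ((f2.reg _ (by decide)).trans cnt1)
  have cnt4 : s4.reg rCnt = s.reg rCnt := (f4.reg _ (by decide)).trans cnt3
  have el4 : s4.arr aEl = s.arr aEl := (f4.arr _ (by decide)).trans
    ((f3.arr _ (by decide)).trans ((f2.arr _ (by decide)).trans el1))
  have al4 : s4.arr aAL = s.arr aAL := (f4.arr _ (by decide)).trans
    ((f3.arr _ (by decide)).trans ((f2.arr _ (by decide)).trans al1))
  have at4 : s4.arr aAt = s.arr aAt := (f4.arr _ (by decide)).trans
    ((f3.arr _ (by decide)).trans ((f2.arr _ (by decide)).trans at1))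
  have set4 : s4.reg rSet = s.reg rSet := (f4.reg _ (by decide)).trans
    ((f3.reg _ (by decide)).trans ((f2.reg _ (by decide)).trans set1))
  have q4 : s4.reg rQ = s.reg rFP := (f4.reg _ (by decide)).trans
    ((f3.reg _ (by decide)).trans ((f2.reg _ (by decide)).trans q1))
  simp only [RAMExpr.val_reg, RAMExpr.val_const, cnt3] at out3 out4
  have o : (∀ i < s.reg rFP, s4.arr aOut i = s.arr aOut i) ∧ s4.arr aOut (s.reg rFP) = 3 ∧
      s4.arr aOut (s.reg rFP + 1) =
        (if s.reg rCnt = 1 then s.arr aEl 0 else s.reg rFP + 2) ∧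
      s4.arr aOut (s.reg rFP + 2) = 4 ∧ s4.arr aOut (s.reg rFP + 3) = s.reg rCnt := by
    rw [out4, out3, out2, out1]
    refine ⟨fun i hi => ?_, ?_, ?_, ?_, ?_⟩
    · rw [Function.update_of_ne (by omega), Function.update_of_ne (by omega),
        Function.update_of_ne (by omega), Function.update_of_ne (by omega)]
    · rw [Function.update_of_ne (by omega), Function.update_of_ne (by omega),
        Function.update_of_ne (by omega), Function.update_self]
    · rw [Function.update_of_ne (by omega), Function.update_of_ne (by omega),
        Function.update_self]
    · rw [Function.update_of_ne (by omega), Function.update_self]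
    · rw [Function.update_self]
  refine (wp_loop (b := 50 * s.reg rCnt) (fun b s' =>
    b = 50 * (s.reg rCnt - s'.reg rI) ∧ s'.reg rI ≤ s.reg rCnt ∧
    s'.reg rFP = s.reg rFP + 4 + s'.reg rI ∧
    (∀ i < s.reg rFP + 4, s'.arr aOut i = s4.arr aOut i) ∧
    (∀ i < s'.reg rI, s'.arr aOut (s.reg rFP + 4 + i) = s.arr aEl i) ∧
    (∀ i < s'.reg rFP, s'.arr aHalf i = i / 2)) ?_ ?_).mono ?_
  · rintro b s' ⟨rfl, hI, hFP, hout, hel, hhalf'⟩ hf he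
    have eC : s'.reg rCnt = s.reg rCnt := (hf.reg _ (by decide)).trans (by simp [cnt4])
    have eE : s'.arr aEl = s.arr aEl := (hf.arr _ (by decide)).trans (by simp [el4])
    have hlt : s'.reg rI < s.reg rCnt := by simpa [eC] using he
    simp only [wp_block_cons]
    refine (wp_emitP ?_ ?_).mono ?_
    · omega
    · exact hhalf'
    rintro s5 k5 f5 ⟨rfl, fp5, out5, half5⟩
    have hI5 : s5.reg rI = s'.reg rI := f5.reg _ (by decide)
    simp only [RAMExpr.val_load, RAMExpr.val_reg, eE] at out5
    simp [hI5, fp5, out5]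
    refine ⟨⟨hlt, by omega, fun i hi => ?_, fun i hi => ?_, fun i hi => half5 i (by omega)⟩, by omega⟩
    · rw [Function.update_of_ne (by omega), hout i hi]
    · by_cases hi' : i = s'.reg rI
      · subst hi'; rw [hFP, Function.update_self]
      · rw [Function.update_of_ne (by omega), hel i (by omega)]
  · refine ⟨by simp, by simp, by simp [fp4], by simp, by simp, ?_⟩
    simpa [fp4] using half4
  · rintro s5 k5 f5 ⟨b, ⟨rfl, hI, hFP, hout, hel, hhalf'⟩, he, hk⟩
    have eC : s5.reg rCnt = s.reg rCnt := (f5.reg _ (by decide)).trans (by simp [cnt4])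
    have eA : s5.arr aAL = s.arr aAL := (f5.arr _ (by decide)).trans (by simp [al4])
    have eT : s5.arr aAt = s.arr aAt := (f5.arr _ (by decide)).trans (by simp [at4])
    have eS : s5.reg rSet = s.reg rSet := (f5.reg _ (by decide)).trans (by simp [set4])
    have eQ : s5.reg rQ = s.reg rFP := (f5.reg _ (by decide)).trans (by simp [q4])
    have hge : s.reg rCnt ≤ s5.reg rI := by simpa [eC] using he
    have hIe : s5.reg rI = s.reg rCnt := le_antisymm hI hge
    rw [hIe] at hFP hel
    simp at hk
    simp [eA, eT, eS, eQ, eC]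
    obtain ⟨o1, o2, o3, o4, o5⟩ := o
    refine ⟨by omega, hFP, fun i hi => (hout i (by omega)).trans (o1 i hi),
      (hout _ (by omega)).trans o2, (hout _ (by omega)).trans o3,
      (hout _ (by omega)).trans o4, (hout _ (by omega)).trans o5, hel, hhalf'⟩

/-- The atom has at most half as many arguments as the measure of the list. This loss of measure is
the source of the amortized time bound. The answer `0` is unambiguous, since atoms have addresses at
least `2`. -/
theorem wp_sealP {s : RAMState} {V : Set ℕ} {c : ℕ → ℕ} (h : Heap s V c) {L : List ℕ}
    (hr0 : s.reg rIn ≠ 0) (hr : Rope s V (s.reg rIn) L) (hne : ∀ C, codesL c L ≠ {negC C})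
    {D : ℕ} (hD : 1 ≤ D) (hfp : s.reg rFP ≤ 2 ^ D) :
    wp sealP s fun s' k => ∃ V' c', Heap s' V' c' ∧ HExt s V c s' V' c' ∧
      k ≤ 800 * D * s.meas L ∧ s.reg rFP ≤ s'.reg rFP ∧
      2 * s'.reg rFP ≤ 2 * s.reg rFP + 8 + s.meas L ∧
      (¬ Good (codesL c L) → s'.reg rQ = 0) ∧
      (Good (codesL c L) → s'.reg rQ ∈ V' ∧ c' (s'.reg rQ) = negC (codesL c L) ∧
        2 * s'.arr aAL (s'.reg rQ) ≤ s.meas L) := by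
  have h2 := s.two_le_meas (hr.ne_nil hr0)
  have hDm : s.meas L ≤ D * s.meas L := Nat.le_mul_of_pos_left _ hD
  have hmulD : ∀ a, a * D * s.meas L = a * (D * s.meas L) := fun a => mul_assoc _ _ _
  simp only [sealP, wp_block_cons]
  refine (wp_collectP h hr0 hr hD hfp).mono ?_
  rintro s1 k1 f1 ⟨hk1, hwf1, hext1, hroot1, hElL, hnd, hmem, hEl, hsum⟩
  have h1 : Heap s1 V c := h.frame f1 (by decide) hwf1 hext1
  have al1 : s1.arr aAL = s.arr aAL := f1.arr _ (by decide)
  have fp1 : s1.reg rFP = s.reg rFP := f1.reg _ (by decide)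
  have hElV : ∀ i < s1.reg rCnt, s1.arr aEl i ∈ V := fun i hi => hr.mem _ (hElL i hi)
  have hcnt1 : 1 ≤ s1.reg rCnt := by
    obtain ⟨x, hx⟩ := List.exists_mem_of_ne_nil _ (hr.ne_nil hr0)
    obtain ⟨i, hi, -⟩ := (hEl x).1 hx
    omega
  have hcnt2 : 2 * s1.reg rCnt ≤ s.meas L := by
    have : ∑ i ∈ Finset.range (s1.reg rCnt), 2 ≤
        ∑ i ∈ Finset.range (s1.reg rCnt), (2 + s.arr aAL (s1.arr aEl i)) :=
      Finset.sum_le_sum fun i _ => by omega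
    simp only [Finset.sum_const, Finset.card_range, smul_eq_mul] at this
    omega
  have hcodes : codesL c L = (Finset.range (s1.reg rCnt)).image fun i => c (s1.arr aEl i) := by
    ext a
    simp only [mem_codesL, Finset.mem_image, Finset.mem_range]
    constructor
    · rintro ⟨x, hx, rfl⟩
      obtain ⟨i, hi, rfl⟩ := (hEl x).1 hx
      exact ⟨i, hi, rfl⟩
    · rintro ⟨i, hi, rfl⟩
      exact ⟨_, hElL i hi, rfl⟩
  rw [wp_assign]
  simp only [wp_block_nil, wp_ite]
  constructor
  · intro hq
    have hq' : s1.arr aAt (s1.reg rRoot) ≠ 0 := by simpa using hq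
    obtain ⟨a1, a2, a3, a4⟩ := h1.atom _ hq'
    set q := s1.arr aAt (s1.reg rRoot) with hqdef
    have hA : s1.codes c q = codesL c L := by
      ext a
      rw [RAMState.mem_codes, mem_codesL]
      constructor
      · rintro ⟨j, hj, rfl⟩
        exact ⟨_, (hmem _).1 ((a4 _).2 ⟨j, hj, rfl⟩), rfl⟩
      · rintro ⟨x, hx, rfl⟩
        obtain ⟨j, hj, e⟩ := (a4 _).1 ((hmem x).2 hx)
        exact ⟨j, hj, by rw [e]⟩
    -- The length bound is needed also for an atom found in the table: its arguments are distinct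
    -- and all lie in the collected set.
    have hlen : s1.arr aAL q ≤ s1.reg rCnt := by
      have hc : ((Finset.range (s1.arr aAL q)).image fun j => s1.arr aOut (q + 4 + j)).card =
          s1.arr aAL q := by
        rw [Finset.card_image_of_injOn, Finset.card_range]
        intro i hi j hj e
        exact a3.nodup i (by simpa using hi) j (by simpa using hj) e
      have hs : (Finset.range (s1.arr aAL q)).image (fun j => s1.arr aOut (q + 4 + j)) ⊆
          (Finset.range (s1.reg rCnt)).image (s1.arr aEl) := by
        intro y hy
        obtain ⟨j, hj, rfl⟩ := Finset.mem_image.1 hy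
        obtain ⟨i, hi, e⟩ := (hEl _).1 ((hmem _).1 ((a4 _).2 ⟨j, Finset.mem_range.1 hj, rfl⟩))
        exact Finset.mem_image.2 ⟨i, Finset.mem_range.2 hi, e.symm⟩
      have := (Finset.card_le_card hs).trans Finset.card_image_le
      rw [hc, Finset.card_range] at this
      exact this
    have hg : Good (codesL c L) := hA ▸ a3.good
    simp [← hqdef]
    refine ⟨V, c, h1.congr rfl rfl rfl rfl rfl rfl h1.wf (.refl _), .refl al1, ?_, by omega,
      by omega, fun hg' => absurd hg hg', fun _ => ⟨a2, by rw [a3.code, hA], by omega⟩⟩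
    rw [hmulD] at hk1 ⊢
    omega
  · intro hq
    have hq' : s1.arr aAt (s1.reg rRoot) = 0 := by simpa using hq
    simp only [wp_block_cons, wp_block_nil, wp_ite, wp_skip]
    refine (wp_checkP (V := V) (c := c) (L := L) (D := D) ?_ ?_ ?_ ?_ hD ?_).mono ?_
    · exact h1.congr rfl rfl rfl rfl rfl rfl h1.wf (.refl _)
    · simpa using hroot1
    · exact hmem
    · simpa using hElV
    · simpa [fp1] using hfp
    rintro s2 k2 f2 ⟨hk2, hwf2, hext2, hset2, hbad⟩
    simp only [RAMState.setReg_reg, RAMState.setReg_arr, al1] at hk2 hset2 hbad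
    simp at hk2 hset2 hbad
    have hwf2' : s2.trie.WF := hwf2
    have hext2' : s1.trie.Ext s2.trie := hext2
    have h2' : Heap s2 V c := h1.congr ((f2.reg _ (by decide)).trans (by simp))
      ((f2.arr _ (by decide)).trans (by simp)) ((f2.arr _ (by decide)).trans (by simp))
      ((f2.arr _ (by decide)).trans (by simp)) ((f2.arr _ (by decide)).trans (by simp))
      ((f2.arr _ (by decide)).trans (by simp)) hwf2' hext2'
    have al2 : s2.arr aAL = s.arr aAL := (f2.arr _ (by decide)).trans (by simp [al1])
    have el2 : s2.arr aEl = s1.arr aEl := (f2.arr _ (by decide)).trans (by simp)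
    have at2 : s2.arr aAt = s1.arr aAt := (f2.arr _ (by decide)).trans (by simp)
    have fp2 : s2.reg rFP = s.reg rFP := (f2.reg _ (by decide)).trans (by simp [fp1])
    have cnt2 : s2.reg rCnt = s1.reg rCnt := (f2.reg _ (by decide)).trans (by simp)
    have q2 : s2.reg rQ = 0 := (f2.reg _ (by decide)).trans (by simp [hq'])
    have hbad' : s2.reg rBad ≠ 0 ↔ ¬ Good (codesL c L) := by
      rw [h1.good_iff hr.mem, not_not, al1, ne_eq, hbad]
      constructor
      · rintro ⟨i, hi, H⟩; exact ⟨_, hElL i hi, H⟩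
      · rintro ⟨x, hx, H⟩
        obtain ⟨i, hi, rfl⟩ := (hEl x).1 hx
        exact ⟨i, hi, H⟩
    have hmul2 : 320 * D * ∑ i ∈ Finset.range (s1.reg rCnt), (2 + s.arr aAL (s1.arr aEl i)) ≤
        320 * D * s.meas L := Nat.mul_le_mul_left _ hsum
    rw [hmulD] at hk1 hmul2
    constructor
    · intro hb
      refine ⟨V, c, h2', .refl al2, ?_, by omega, by omega, fun _ => q2,
        fun hg => absurd hg (hbad'.1 hb)⟩
      rw [hmulD]
      simp
      omega
    · intro hb
      have hg : Good (codesL c L) := by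
        by_contra hg
        exact hbad'.2 hg hb
      refine (wp_emitAtomP h2'.fp h2'.half).mono ?_
      rintro s3 k3 f3 ⟨hk3, fp3, q3, o0, o1, o2, o3, o4, o5, half3, al3, at3⟩
      have hroot2 : s2.reg rSet ≤ s2.reg rTC := by
        rw [hset2]; exact hroot1.trans hext2'.tc
      have hmem2 : ∀ y, s2.trie.Mem (s2.reg rSet) y ↔ ∃ i < s2.reg rCnt, y = s2.arr aEl i := by
        intro y
        rw [hset2, cnt2, el2, hext2'.mem_iff h1.wf hroot1, hmem, hEl]
      obtain ⟨H, E⟩ := h2'.addNeg (s' := s3) (R := s2.reg rSet) (n := s2.reg rCnt)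
        (El := s2.arr aEl) (A := codesL c L) hroot2 (by rw [hset2, at2, hq']) (by omega)
        (by rwa [cnt2, el2]) (by rwa [cnt2, el2]) hmem2 (by rw [cnt2, el2, hcodes]) hg hne
        fp3 o0 o1 o2 o3 o4 o5 half3 al3 at3 (f3.arr _ (by decide))
        (Trie.congr_frame f3 (by decide))
      refine ⟨_, _, H, ?_, ?_, by omega, by omega, fun hg' => absurd hg hg', fun _ => ?_⟩
      · exact (HExt.refl (s := s) (s' := s2) al2).trans E
      · rw [hmulD]
        simp
        omega
      · rw [q3, al3, Function.update_self, Function.update_self]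
        exact ⟨Set.mem_insert _ _, rfl, by omega⟩

local notation "rT" => (5 : ℕ)
local notation "rSP" => (6 : ℕ)
local notation "rVP" => (7 : ℕ)
local notation "rGa" => (30 : ℕ)
local notation "rRa" => (31 : ℕ)
local notation "rGb" => (32 : ℕ)
local notation "rRb" => (33 : ℕ)
local notation "rQa" => (34 : ℕ)
local notation "rItem" => (35 : ℕ)
local notation "rP" => (36 : ℕ)
local notation "rLen" => (37 : ℕ)
local notation "rLab" => (38 : ℕ)
local notation "aIn" => (0 : ℕ)
local notation "aWS" => (17 : ℕ)
local notation "aVS" => (18 : ℕ)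
local notation "aVR" => (19 : ℕ)

/-! ### Values -/

/-- The state `s'` with atoms `V'` extends the state `s` with atoms `V`. -/
structure Step (s : RAMState) (V : Set ℕ) (c : ℕ → ℕ) (s' : RAMState) (V' : Set ℕ)
    (c' : ℕ → ℕ) : Prop where
  heap : Heap s' V' c'
  hext : HExt s V c s' V' c'
  rext : RExt s s'

theorem Step.refl {s : RAMState} {V : Set ℕ} {c : ℕ → ℕ} (h : Heap s V c) : Step s V c s V c :=
  ⟨h, .refl rfl, .refl s⟩

theorem Step.trans {s s' s'' : RAMState} {V V' V'' : Set ℕ} {c c' c'' : ℕ → ℕ}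
    (h : Step s V c s' V' c') (h' : Step s' V' c' s'' V'' c'') : Step s V c s'' V'' c'' :=
  ⟨h'.heap, h.hext.trans h'.hext, h.rext.trans h'.rext⟩

theorem Step.of_frame {p : RAMProg} {s s' : RAMState} {V : Set ℕ} {c : ℕ → ℕ} (h : Heap s V c)
    (f : Frame p s s') (hp : (rFP ∉ p.regs ∧ aOut ∉ p.arrs ∧ aHalf ∉ p.arrs ∧ aAt ∉ p.arrs ∧
      aAL ∉ p.arrs ∧ aVar ∉ p.arrs) ∧
      rTC ∉ p.regs ∧ aFl ∉ p.arrs ∧ aLe ∉ p.arrs ∧ aRi ∉ p.arrs ∧ aCo ∉ p.arrs)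
    (hr : RExt s s') : Step s V c s' V c := by
  have e := Trie.congr_frame f hp.2
  exact ⟨h.frame f hp.1 (e ▸ h.wf) (e ▸ .refl _), .refl (f.arr _ hp.1.2.2.2.2.1), hr⟩

theorem Step.setReg {s : RAMState} {V : Set ℕ} {c : ℕ → ℕ} (h : Heap s V c) {x : ℕ} (v : ℕ)
    (hx : rFP ≠ x ∧ rTC ≠ x ∧ rRC ≠ x) : Step s V c (s.setReg x v) V c := by
  have f : Frame (.assign x (.const v)) s (s.setReg x v) := (Run.assign s x (.const v)).frame
  exact .of_frame h f (by simp [RAMProg.regs, RAMProg.arrs, hx])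
    (.frame f (by simp [RAMProg.regs, RAMProg.arrs, hx]))

/-- The list `L` of atoms is the rope `r`, and is not a single complement. -/
structure IsRope (s : RAMState) (V : Set ℕ) (c : ℕ → ℕ) (r : ℕ) (L : List ℕ) : Prop where
  rope : Rope s V r L
  ne_neg : ∀ C, codesL c L ≠ {negC C}

theorem IsRope.step {s s' : RAMState} {V V' : Set ℕ} {c c' : ℕ → ℕ} {r : ℕ} {L : List ℕ}
    (h : IsRope s V c r L) (hs : Step s V c s' V' c') : IsRope s' V' c' r L :=
  ⟨h.rope.mono hs.rext hs.hext, by rw [hs.hext.codesL_eq h.rope.mem]; exact h.ne_neg⟩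

theorem IsRope.codesL_nonempty {s : RAMState} {V : Set ℕ} {c : ℕ → ℕ} {r : ℕ} {L : List ℕ}
    (h : IsRope s V c r L) (hr : r ≠ 0) : (codesL c L).Nonempty := by
  obtain ⟨x, hx⟩ := List.exists_mem_of_ne_nil _ (h.rope.ne_nil hr)
  exact ⟨c x, mem_codesL.2 ⟨x, hx, rfl⟩⟩

theorem codesL_append (c : ℕ → ℕ) (L L' : List ℕ) :
    codesL c (L ++ L') = codesL c L ∪ codesL c L' := by
  simp [codesL]

theorem codesL_singleton (c : ℕ → ℕ) (x : ℕ) : codesL c [x] = {c x} := by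
  simp [codesL]

/-- The sign `g` and the rope `r` represent the element `X` with measure `m`. -/
def IsVal (s : RAMState) (V : Set ℕ) (c : ℕ → ℕ) (g r : ℕ) (X : FreeB) (m : ℕ) : Prop :=
  ∃ L, IsRope s V c r L ∧ s.meas L = m ∧
    (g = 0 ∧ X = .norm (codesL c L) ∨ g = 1 ∧ X = .compl (.norm (codesL c L)))

theorem IsVal.step {s s' : RAMState} {V V' : Set ℕ} {c c' : ℕ → ℕ} {g r m : ℕ} {X : FreeB}
    (h : IsVal s V c g r X m) (hs : Step s V c s' V' c') : IsVal s' V' c' g r X m := by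
  obtain ⟨L, h1, rfl, h3⟩ := h
  refine ⟨L, h1.step hs, hs.hext.meas_eq h1.rope.mem, ?_⟩
  rwa [hs.hext.codesL_eq h1.rope.mem]

theorem IsVal.nil (s : RAMState) (V : Set ℕ) (c : ℕ → ℕ) {g : ℕ} (hg : g = 0 ∨ g = 1) :
    IsVal s V c g 0 (if g = 0 then .norm ∅ else .top) 0 := by
  refine ⟨[], ⟨.nil, fun C h => ?_⟩, rfl, hg.imp (fun h => ⟨h, by simp [h, codesL]⟩)
    fun h => ⟨h, by simp [h, codesL, FreeB.compl_empty]⟩⟩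
  exact absurd h.symm (by simp [codesL])

-- Joining two values: the programs

section
open RAMExpr RAMProg

/-- Create the rope consisting of the atom `rQ`. -/
def leafP : RAMProg := block [
  assign rRC (add (reg rRC) (const 1)),
  store aRA (reg rRC) (reg rQ),
  store aRB (reg rRC) (const 0),
  store aRM (reg rRC) (add (load aAL (reg rQ)) (const 2))]

/-- Concatenate the ropes `rRa` and `rRb`. -/
def concatP : RAMProg := block [
  assign rRC (add (reg rRC) (const 1)),
  store aRA (reg rRC) (reg rRa),
  store aRB (reg rRC) (reg rRb),
  -- The factor is a test that always succeeds, because the credit `rT` bounds the measure. It only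
  -- makes the stored expression satisfy `RAMExpr.Lin`, which a plain sum of two words does not.
  store aRM (reg rRC) (mul (lt (add (load aRM (reg rRa)) (load aRM (reg rRb)))
    (add (reg rT) (const 1))) (add (load aRM (reg rRa)) (load aRM (reg rRb)))),
  assign rRa (reg rRC)]

/-- Join of the join of the nonempty rope `rRa` with the complement of the join of the nonempty
rope `rRb`. -/
def posnegP : RAMProg := block [
  assign rIn (reg rRb),
  sealP,
  ite (reg rQ) (block [leafP, assign rRb (reg rRC), concatP]) skip]

/-- Exchange the ropes `rRa` and `rRb`. -/
def swapP : RAMProg := block [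
  assign rQa (reg rRa),
  assign rRa (reg rRb),
  assign rRb (reg rQa)]

/-- Join of the complements of the joins of the nonempty ropes `rRa` and `rRb`, where `rRa` is not
larger than `rRb`. -/
def negnegLeP : RAMProg := block [
  assign rIn (reg rRa),
  sealP,
  ite (reg rQ)
    (block [
      assign rQa (reg rQ),
      assign rIn (reg rRb),
      sealP,
      ite (reg rQ)
        (ite (eq (reg rQ) (reg rQa)) skip
          (block [leafP, assign rRb (reg rRC), assign rQ (reg rQa), leafP, assign rRa (reg rRC),
            concatP, assign rGa (const 0)]))
        skip])
    (assign rRa (reg rRb))]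

/-- Join of the complements of the joins of the nonempty ropes `rRa` and `rRb`. -/
def negnegP : RAMProg := block [
  ite (lt (load aRM (reg rRb)) (load aRM (reg rRa))) swapP skip,
  negnegLeP]

/-- Join of two values. -/
def joinP : RAMProg :=
  ite (reg rRa)
    (ite (reg rRb)
      (ite (reg rGa)
        (ite (reg rGb) negnegP (block [swapP, assign rGa (const 0), posnegP]))
        (ite (reg rGb) posnegP concatP))
      (ite (reg rGb) (block [assign rGa (const 1), assign rRa (const 0)]) skip))
    (ite (reg rGa) skip (block [assign rGa (reg rGb), assign rRa (reg rRb)]))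

end

-- Joining two values: correctness and cost

theorem wp_leafP {s : RAMState} {V : Set ℕ} {c : ℕ → ℕ} (h : Heap s V c)
    (hq : s.reg rQ ∈ V) : wp leafP s fun s' k => k ≤ 30 ∧ Step s V c s' V c ∧
      s'.reg rRC ≠ 0 ∧ Rope s' V (s'.reg rRC) [s.reg rQ] := by
  refine wp.mono (Q := fun s' k => k ≤ 30 ∧ s'.reg rRC = s.reg rRC + 1 ∧
    s'.arr aRA = Function.update (s.arr aRA) (s.reg rRC + 1) (s.reg rQ) ∧
    s'.arr aRB = Function.update (s.arr aRB) (s.reg rRC + 1) 0 ∧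
    s'.arr aRM = Function.update (s.arr aRM) (s.reg rRC + 1) (s.arr aAL (s.reg rQ) + 2))
    (by simp [leafP]) ?_
  rintro s' k f ⟨hk, hrc, hra, hrb, hrm⟩
  have hr : RExt s s' := by
    refine ⟨by omega, ?_, ?_, ?_⟩
    · intro r hr; rw [hra, Function.update_of_ne (by omega)]
    · intro r hr; rw [hrb, Function.update_of_ne (by omega)]
    · intro r hr; rw [hrm, Function.update_of_ne (by omega)]
  refine ⟨hk, .of_frame h f (by decide) hr, by omega, ?_⟩
  have e : s'.arr aRA (s'.reg rRC) = s.reg rQ := by rw [hra, hrc, Function.update_self]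
  rw [← e]
  refine .leaf (by omega) le_rfl ?_ (by rw [e]; exact hq) ?_
  · rw [hrb, hrc, Function.update_self]
  · rw [e, hrm, hrc, Function.update_self, f.arr aAL (by decide), add_comm]

theorem wp_concatP {s : RAMState} {V : Set ℕ} {c : ℕ → ℕ} (h : Heap s V c) {L L' : List ℕ}
    (ha : s.reg rRa ≠ 0) (hb : s.reg rRb ≠ 0) (hL : Rope s V (s.reg rRa) L)
    (hL' : Rope s V (s.reg rRb) L') (hT : s.meas L + s.meas L' ≤ s.reg rT) :
    wp concatP s fun s' k => k ≤ 50 ∧ Step s V c s' V c ∧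
      s'.reg rRa ≠ 0 ∧ Rope s' V (s'.reg rRa) (L ++ L') := by
  refine wp.mono (Q := fun s' k => k ≤ 50 ∧ s'.reg rRC = s.reg rRC + 1 ∧
    s'.arr aRA = Function.update (s.arr aRA) (s.reg rRC + 1) (s.reg rRa) ∧
    s'.arr aRB = Function.update (s.arr aRB) (s.reg rRC + 1) (s.reg rRb) ∧
    s'.arr aRM = Function.update (s.arr aRM) (s.reg rRC + 1)
      (s.arr aRM (s.reg rRa) + s.arr aRM (s.reg rRb)) ∧ s'.reg rRa = s'.reg rRC) ?_ ?_
  · simp [concatP]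
    rw [ltN_mul]
    rw [hL.meas_eq ha, hL'.meas_eq hb]
    omega
  rintro s' k f ⟨hk, hrc, hra, hrb, hrm, hres⟩
  have hr : RExt s s' := by
    refine ⟨by omega, ?_, ?_, ?_⟩
    · intro r hr; rw [hra, Function.update_of_ne (by omega)]
    · intro r hr; rw [hrb, Function.update_of_ne (by omega)]
    · intro r hr; rw [hrm, Function.update_of_ne (by omega)]
  have hs : Step s V c s' V c := .of_frame h f (by decide) hr
  refine ⟨hk, hs, by omega, ?_⟩
  have e : s'.arr aRA (s'.reg rRC) = s.reg rRa := by rw [hra, hrc, Function.update_self]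
  have e' : s'.arr aRB (s'.reg rRC) = s.reg rRb := by rw [hrb, hrc, Function.update_self]
  rw [hres]
  refine .node (by omega) le_rfl (by rwa [e']) (by rwa [e]) ?_ ?_ ?_
  · rw [e]; exact hL.mono hs.rext hs.hext
  · rw [e']; exact hL'.mono hs.rext hs.hext
  · rw [e, e', hr.rm _ hL.le, hr.rm _ hL'.le, hrm, hrc, Function.update_self]

/-- The value `X` has been computed in `rGa`, `rRa`. -/
def JoinPost (s : RAMState) (V : Set ℕ) (c : ℕ → ℕ) (D e m₀ : ℕ) (X : FreeB) (s' : RAMState)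
    (k : ℕ) : Prop :=
  ∃ V' c' m, Step s V c s' V' c' ∧ IsVal s' V' c' (s'.reg rGa) (s'.reg rRa) X m ∧
    -- The price `1600 * D` of a unit of measure is twice the cost `800 * D` of sealing it, since
    -- sealing may release only about half of the measure.
    k + 1600 * D * m ≤ 1600 * D * (m₀ + e) ∧ s'.reg rFP + m ≤ s.reg rFP + m₀ + 12 ∧
    s.reg rFP ≤ s'.reg rFP

/-- This preserves the invariant that no list is a lone complement, so that a sign `1` never
produces a double negation. -/
theorem union_ne_neg {A : Finset ℕ} (h : A.Nonempty) (hA : ∀ C, A ≠ {negC C}) (B C : Finset ℕ) :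
    A ∪ B ≠ {negC C} := fun e => by
  rcases Finset.subset_singleton_iff.1 (e ▸ Finset.subset_union_left : A ⊆ {negC C}) with h' | h'
  · exact h.ne_empty h'
  · exact hA C h'

/-- Only the complemented list is sealed, and it disappears, so its measure pays. If it is
inconsistent its complement is `0` and drops out. -/
theorem wp_posnegP {s : RAMState} {V : Set ℕ} {c : ℕ → ℕ} (h : Heap s V c) {L L' : List ℕ}
    (ha : s.reg rRa ≠ 0) (hb : s.reg rRb ≠ 0) (hL : IsRope s V c (s.reg rRa) L)
    (hL' : IsRope s V c (s.reg rRb) L') (hG : s.reg rGa = 0)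
    (hT : s.meas L + s.meas L' + 2 ≤ s.reg rT) {D : ℕ} (hD : 1 ≤ D) (hfp : s.reg rFP ≤ 2 ^ D) :
    wp posnegP s (JoinPost s V c D 4 (s.meas L + s.meas L')
      (.join (.norm (codesL c L)) (.compl (.norm (codesL c L'))))) := by
  simp only [posnegP, wp_block_cons, wp_assign]
  have hs0 := Step.setReg h (x := rIn) ((RAMExpr.reg rRb).val s) (by decide)
  refine (wp_sealP (V := V) (c := c) (L := L') hs0.heap ?_ ?_ ?_ hD ?_).mono ?_
  · simpa using hb
  · exact (hL'.step hs0).rope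
  · exact hL'.ne_neg
  · simpa using hfp
  rintro s1 k1 f1 ⟨V1, c1, H1, E1, hk1, hfp1, hfp1', hbad, hgood⟩
  have hst1 : Step s V c s1 V1 c1 :=
    hs0.trans ⟨H1, E1, RExt.frame f1 (by decide)⟩
  have ra1 : s1.reg rRa = s.reg rRa := (f1.reg _ (by decide)).trans (by simp)
  have ga1 : s1.reg rGa = 0 := (f1.reg _ (by decide)).trans (by simp [hG])
  have t1 : s1.reg rT = s.reg rT := (f1.reg _ (by decide)).trans (by simp)
  have hm : (s.setReg rIn (RAMExpr.val s (.reg rRb))).meas L' = s.meas L' := rfl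
  rw [hm] at hk1 hfp1' hgood
  simp at hfp1 hfp1'
  have hL1 := hL.step hst1
  have hmL : s1.meas L = s.meas L := hst1.hext.meas_eq hL.rope.mem
  have hcL : codesL c1 L = codesL c L := hst1.hext.codesL_eq hL.rope.mem
  simp only [wp_block_nil, wp_ite, wp_skip]
  constructor
  · intro hq
    have hq' : s1.reg rQ ≠ 0 := by simpa using hq
    have hg : Good (codesL c L') := by
      by_contra hg
      exact hq' (hbad hg)
    obtain ⟨hqV, hqc, hql⟩ := hgood hg
    simp only [wp_block_cons]
    refine (wp_leafP H1 hqV).mono ?_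
    rintro s2 k2 f2 ⟨hk2, hst2, hrc2, hr2⟩
    have ra2 : s2.reg rRa = s.reg rRa := (f2.reg _ (by decide)).trans ra1
    have t2 : s2.reg rT = s.reg rT := (f2.reg _ (by decide)).trans t1
    have fp2 : s2.reg rFP = s1.reg rFP := f2.reg _ (by decide)
    have ga2 : s2.reg rGa = 0 := (f2.reg _ (by decide)).trans ga1
    have hL2 := hL1.step hst2
    have hmL2 : s2.meas L = s.meas L := (hst2.hext.meas_eq hL1.rope.mem).trans hmL
    have hmq : s2.meas [s1.reg rQ] = 2 + s1.arr aAL (s1.reg rQ) := by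
      rw [hst2.hext.meas_eq (by simpa using hqV)]
      simp [RAMState.meas]
    rw [wp_assign]
    have hs2 := Step.setReg hst2.heap (x := rRb) ((RAMExpr.reg rRC).val s2) (by decide)
    refine (wp_concatP (L := L) (L' := [s1.reg rQ]) hs2.heap ?_ ?_ ?_ ?_ ?_).mono ?_
    · simpa [ra2] using ha
    · simpa using hrc2
    · simpa [ra2] using (hL2.step hs2).rope
    · exact hr2.mono hs2.rext hs2.hext
    · have e1 : ∀ l, (s2.setReg rRb (RAMExpr.val s2 (.reg rRC))).meas l = s2.meas l :=
        fun _ => rfl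
      rw [e1, e1, hmL2, hmq]
      simp [t2]
      omega
    rintro s3 k3 f3 ⟨hk3, hst3, hra3, hr3⟩
    have ga3 : s3.reg rGa = 0 := (f3.reg _ (by decide)).trans (by simp [ga2])
    have fp3 : s3.reg rFP = s1.reg rFP := (f3.reg _ (by decide)).trans (by simp [fp2])
    have hst3' : Step s2 V1 c1 s3 V1 c1 := hs2.trans hst3
    have hst : Step s1 V1 c1 s3 V1 c1 := hst2.trans hst3'
    have hm3 : s3.meas (L ++ [s1.reg rQ]) = s.meas L + (2 + s1.arr aAL (s1.reg rQ)) := by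
      rw [RAMState.meas_append, hst3'.hext.meas_eq hL2.rope.mem, hmL2,
        hst3'.hext.meas_eq hr2.mem, hmq]
    have hcod : codesL c1 (L ++ [s1.reg rQ]) = codesL c L ∪ {negC (codesL c L')} := by
      rw [codesL_append, codesL_singleton, hqc, hcL]
    rw [wp_block_nil]
    refine ⟨V1, c1, _, hst1.trans hst, ⟨L ++ [s1.reg rQ], ⟨hr3, ?_⟩, hm3, .inl ⟨ga3, ?_⟩⟩,
      ?_, ?_, ?_⟩
    · rw [hcod]
      exact union_ne_neg (hL.codesL_nonempty ha) hL.ne_neg _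
    · rw [hcod, FreeB.compl_norm hg (hL'.codesL_nonempty hb) hL'.ne_neg, FreeB.join_norm]
    · have hql' := Nat.mul_le_mul_left D hql
      simp only [RAMExpr.cost]
      have x1 : 1600 * D * (s.meas L + (2 + s1.arr aAL (s1.reg rQ))) =
        1600 * (D * s.meas L) + 3200 * D + 800 * (D * (2 * s1.arr aAL (s1.reg rQ))) := by ring
      have x2 : 1600 * D * (s.meas L + s.meas L' + 4) =
        1600 * (D * s.meas L) + 1600 * (D * s.meas L') + 6400 * D := by ring
      rw [mul_assoc] at hk1
      omega
    · omega
    · omega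
  · intro hq
    have hq' : s1.reg rQ = 0 := by simpa using hq
    have hg : ¬ Good (codesL c L') := fun hg => by
      have := H1.two_le _ (hgood hg).1
      omega
    refine ⟨V1, c1, s.meas L, hst1, ⟨L, by rw [ra1]; exact hL1, hmL, .inl ⟨ga1, ?_⟩⟩, ?_, ?_, ?_⟩
    · rw [hcL, FreeB.norm_bad hg, FreeB.compl_top, FreeB.join_bot]
    · simp only [RAMExpr.cost]
      have x2 : 1600 * D * (s.meas L + s.meas L' + 4) =
        1600 * (D * s.meas L) + 1600 * (D * s.meas L') + 6400 * D := by ring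
      have x1 : 1600 * D * s.meas L = 1600 * (D * s.meas L) := by ring
      rw [mul_assoc] at hk1
      omega
    · omega
    · omega

/-- Four outcomes. If `L` is inconsistent, `L'` is returned untouched and `L` pays for itself. If
`L'` is inconsistent or has the same set, `L` is returned with its sign, and `L'`, being at least as
large, pays for both sealings. Otherwise both lists are replaced by atoms and each pays for itself.
-/
theorem wp_negnegLeP {s : RAMState} {V : Set ℕ} {c : ℕ → ℕ} (h : Heap s V c) {L L' : List ℕ}
    (ha : s.reg rRa ≠ 0) (hb : s.reg rRb ≠ 0) (hL : IsRope s V c (s.reg rRa) L)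
    (hL' : IsRope s V c (s.reg rRb) L') (hG : s.reg rGa = 1) (hle : s.meas L ≤ s.meas L')
    (hT : s.meas L + s.meas L' + 4 ≤ s.reg rT) {D : ℕ} (hD : 1 ≤ D)
    (hfp : s.reg rFP + (s.meas L + s.meas L') + 12 ≤ 2 ^ D) :
    wp negnegLeP s (JoinPost s V c D 5 (s.meas L + s.meas L')
      (.join (.compl (.norm (codesL c L))) (.compl (.norm (codesL c L'))))) := by
  have x2 : 1600 * D * (s.meas L + s.meas L' + 5) =
    1600 * (D * s.meas L) + 1600 * (D * s.meas L') + 8000 * D := by ring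
  have x3 : D * s.meas L ≤ D * s.meas L' := Nat.mul_le_mul_left D hle
  simp only [negnegLeP, wp_block_cons, wp_assign]
  have hs0 := Step.setReg h (x := rIn) ((RAMExpr.reg rRa).val s) (by decide)
  refine (wp_sealP (V := V) (c := c) (L := L) hs0.heap ?_ ?_ ?_ hD ?_).mono ?_
  · simpa using ha
  · exact (hL.step hs0).rope
  · exact hL.ne_neg
  · simp
    omega
  rintro s1 k1 f1 ⟨V1, c1, H1, E1, hk1, hfp1, hfp1', hbad1, hgood1⟩
  have hst1 : Step s V c s1 V1 c1 := hs0.trans ⟨H1, E1, RExt.frame f1 (by decide)⟩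
  have ra1 : s1.reg rRa = s.reg rRa := (f1.reg _ (by decide)).trans (by simp)
  have rb1 : s1.reg rRb = s.reg rRb := (f1.reg _ (by decide)).trans (by simp)
  have ga1 : s1.reg rGa = 1 := (f1.reg _ (by decide)).trans (by simp [hG])
  have t1 : s1.reg rT = s.reg rT := (f1.reg _ (by decide)).trans (by simp)
  have hm : (s.setReg rIn (RAMExpr.val s (.reg rRa))).meas L = s.meas L := rfl
  rw [hm] at hk1 hfp1' hgood1
  simp at hfp1 hfp1'
  have hL1 := hL.step hst1
  have hL1' := hL'.step hst1
  have hmL1 : s1.meas L = s.meas L := hst1.hext.meas_eq hL.rope.mem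
  have hmL1' : s1.meas L' = s.meas L' := hst1.hext.meas_eq hL'.rope.mem
  have hcL1 : codesL c1 L = codesL c L := hst1.hext.codesL_eq hL.rope.mem
  have hcL1' : codesL c1 L' = codesL c L' := hst1.hext.codesL_eq hL'.rope.mem
  rw [mul_assoc] at hk1
  simp only [wp_block_nil, wp_ite, wp_assign]
  constructor
  swap
  · intro hq
    have hq' : s1.reg rQ = 0 := by simpa using hq
    have hg : ¬ Good (codesL c L) := fun hg => by
      have := H1.two_le _ (hgood1 hg).1
      omega
    have hs1 := Step.setReg H1 (x := rRa) ((RAMExpr.reg rRb).val s1) (by decide)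
    have hm1 := hs1.hext.meas_eq hL1'.rope.mem
    refine ⟨V1, c1, s.meas L', hst1.trans hs1, ⟨L', ?_, hm1.trans hmL1', .inr ⟨?_, ?_⟩⟩, ?_,
      ?_, ?_⟩
    · simpa [rb1] using hL1'.step hs1
    · simpa using ga1
    · rw [hcL1', FreeB.norm_bad hg, FreeB.compl_top, FreeB.join_comm, FreeB.join_bot]
    · simp only [RAMExpr.cost]
      have x1 : 1600 * D * s.meas L' = 1600 * (D * s.meas L') := by ring
      omega
    · simp
      omega
    · simpa using hfp1
  intro hq
  have hq' : s1.reg rQ ≠ 0 := by simpa using hq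
  have hg : Good (codesL c L) := by
    by_contra hg
    exact hq' (hbad1 hg)
  obtain ⟨hqV, hqc, hql⟩ := hgood1 hg
  simp only [wp_block_cons, wp_assign]
  have hs1 := Step.setReg H1 (x := rQa) ((RAMExpr.reg rQ).val s1) (by decide)
  have hs1' := hs1.trans (Step.setReg hs1.heap (x := rIn)
    ((RAMExpr.reg rRb).val (s1.setReg rQa ((RAMExpr.reg rQ).val s1))) (by decide))
  have hmL1a := hs1'.hext.meas_eq hL1'.rope.mem
  refine (wp_sealP (L := L') hs1'.heap ?_ ?_ ?_ hD ?_).mono ?_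
  · simpa [rb1] using hb
  · simpa [rb1] using (hL1'.step hs1').rope
  · rw [hcL1']; exact hL'.ne_neg
  · simp
    omega
  rintro s2 k2 f2 ⟨V2, c2, H2, E2, hk2, hfp2, hfp2', hbad2, hgood2⟩
  rw [hmL1a, hmL1', hcL1'] at hgood2
  rw [hmL1a, hmL1', mul_assoc] at hk2
  rw [hmL1a, hmL1'] at hfp2'
  rw [hcL1'] at hbad2
  simp at hfp2 hfp2'
  have hst2 : Step s1 V1 c1 s2 V2 c2 := hs1'.trans ⟨H2, E2, RExt.frame f2 (by decide)⟩
  have ra2 : s2.reg rRa = s.reg rRa := (f2.reg _ (by decide)).trans (by simp [ra1])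
  have ga2 : s2.reg rGa = 1 := (f2.reg _ (by decide)).trans (by simp [ga1])
  have t2 : s2.reg rT = s.reg rT := (f2.reg _ (by decide)).trans (by simp [t1])
  have qa2 : s2.reg rQa = s1.reg rQ := (f2.reg _ (by decide)).trans (by simp)
  have hL2 := hL1.step hst2
  have hmL2 : s2.meas L = s.meas L := (hst2.hext.meas_eq hL1.rope.mem).trans hmL1
  have hcL2 : codesL c2 L = codesL c L := (hst2.hext.codesL_eq hL1.rope.mem).trans hcL1
  have hqV2 : s1.reg rQ ∈ V2 := hst2.hext.sub hqV
  have hqc2 : c2 (s1.reg rQ) = negC (codesL c L) := (hst2.hext.code _ hqV).trans hqc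
  have hql2 : s2.arr aAL (s1.reg rQ) = s1.arr aAL (s1.reg rQ) := hst2.hext.len _ hqV
  have x1 : 1600 * D * s.meas L = 1600 * (D * s.meas L) := by ring
  simp only [wp_block_nil, wp_ite, wp_skip]
  constructor
  swap
  · intro hq2
    have hq2' : s2.reg rQ = 0 := by simpa using hq2
    have hg' : ¬ Good (codesL c L') := fun hg => by
      have := H2.two_le _ (hgood2 hg).1
      omega
    refine ⟨V2, c2, s.meas L, hst1.trans hst2, ⟨L, by rw [ra2]; exact hL2, hmL2,
      .inr ⟨ga2, ?_⟩⟩, ?_, by omega, by omega⟩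
    · rw [hcL2, FreeB.norm_bad hg', FreeB.compl_top, FreeB.join_bot]
    · simp only [RAMExpr.cost]
      omega
  intro hq2
  have hq2' : s2.reg rQ ≠ 0 := by simpa using hq2
  have hg' : Good (codesL c L') := by
    by_contra hg
    exact hq2' (hbad2 hg)
  obtain ⟨hrV, hrc, hrl⟩ := hgood2 hg'
  constructor
  · intro he
    have he' : s2.reg rQ = s1.reg rQ := by simpa [qa2] using he
    have hAA : codesL c L' = codesL c L := negC_inj (by rw [← hrc, he', hqc2])
    refine ⟨V2, c2, s.meas L, hst1.trans hst2, ⟨L, by rw [ra2]; exact hL2, hmL2,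
      .inr ⟨ga2, ?_⟩⟩, ?_, by omega, by omega⟩
    · rw [hcL2, hAA, FreeB.join_idem]
    · simp only [RAMExpr.cost]
      omega
  intro he
  have he' : s2.reg rQ ≠ s1.reg rQ := by simpa [qa2] using he
  simp only [wp_block_cons]
  refine (wp_leafP H2 hrV).mono ?_
  rintro s3 k3 f3 ⟨hk3, hst3, hrc3, hr3⟩
  have qa3 : s3.reg rQa = s1.reg rQ := (f3.reg _ (by decide)).trans qa2
  simp only [wp_assign]
  have hs3 := Step.setReg hst3.heap (x := rRb) ((RAMExpr.reg rRC).val s3) (by decide)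
  have hs3' := hs3.trans (Step.setReg hs3.heap (x := rQ)
    ((RAMExpr.reg rQa).val (s3.setReg rRb ((RAMExpr.reg rRC).val s3))) (by decide))
  refine (wp_leafP hs3'.heap ?_).mono ?_
  · simpa [qa3] using hqV2
  rintro s4 k4 f4 ⟨hk4, hst4, hrc4, hr4⟩
  simp [qa3] at hr4
  have hst34 := hs3'.trans hst4
  have hr3' := hr3.mono hst34.rext hst34.hext
  have rb4 : s4.reg rRb = s3.reg rRC := (f4.reg _ (by decide)).trans (by simp)
  have t4 : s4.reg rT = s.reg rT :=
    (f4.reg _ (by decide)).trans (by simp [f3.reg rT (by decide), t2])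
  have hst24 : Step s2 V2 c2 s4 V2 c2 := hst3.trans hst34
  have hs4 := Step.setReg hst4.heap (x := rRa) ((RAMExpr.reg rRC).val s4) (by decide)
  have m1 : s4.meas [s1.reg rQ] = 2 + s1.arr aAL (s1.reg rQ) := by
    rw [hst24.hext.meas_eq (by simpa using hqV2), ← hql2]
    simp [RAMState.meas]
  have m2 : s4.meas [s2.reg rQ] = 2 + s2.arr aAL (s2.reg rQ) := by
    rw [hst24.hext.meas_eq (by simpa using hrV)]
    simp [RAMState.meas]
  refine (wp_concatP (L := [s1.reg rQ]) (L' := [s2.reg rQ]) hs4.heap ?_ ?_ ?_ ?_ ?_).mono ?_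
  · simpa using hrc4
  · simpa [rb4] using hrc3
  · simpa using hr4.mono hs4.rext hs4.hext
  · simpa [rb4] using hr3'.mono hs4.rext hs4.hext
  · rw [hs4.hext.meas_eq (by simpa using hqV2), hs4.hext.meas_eq (by simpa using hrV), m1, m2]
    simp [t4]
    omega
  rintro s5 k5 f5 ⟨hk5, hst5, hra5, hr5⟩
  have fp5 : s5.reg rFP = s2.reg rFP := by
    rw [f5.reg _ (by decide)]
    simp
    rw [f4.reg _ (by decide)]
    simp
    rw [f3.reg _ (by decide)]
  have hs5 := Step.setReg hst5.heap (x := rGa) ((RAMExpr.const 0).val s5) (by decide)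
  have hst45 := hs4.trans (hst5.trans hs5)
  have hst25 := hst24.trans hst45
  simp only [wp_block_nil]
  have hcod : codesL c2 [s1.reg rQ, s2.reg rQ] = {negC (codesL c L)} ∪ {negC (codesL c L')} := by
    rw [show [s1.reg rQ, s2.reg rQ] = [s1.reg rQ] ++ [s2.reg rQ] from rfl, codesL_append,
      codesL_singleton, codesL_singleton, hqc2, hrc]
  -- Two different atoms, so the new list is again not a lone complement. Equal atoms had to be
  -- treated separately for this reason.
  have hdiff : negC (codesL c L) ≠ negC (codesL c L') := fun e => by
    rw [← hqc2, ← hrc] at e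
    exact he' (H2.inj _ hqV2 _ hrV e).symm
  refine ⟨V2, c2, 4 + s1.arr aAL (s1.reg rQ) + s2.arr aAL (s2.reg rQ),
    hst1.trans (hst2.trans hst25), ⟨[s1.reg rQ, s2.reg rQ], ⟨?_, fun C hC => ?_⟩, ?_,
    .inl ⟨?_, ?_⟩⟩, ?_, ?_, ?_⟩
  · simpa using hr5.mono hs5.rext hs5.hext
  · rw [hcod] at hC
    have a1 : negC (codesL c L) ∈ ({negC C} : Finset ℕ) := hC ▸ by simp
    have a2 : negC (codesL c L') ∈ ({negC C} : Finset ℕ) := hC ▸ by simp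
    exact hdiff ((Finset.mem_singleton.1 a1).trans (Finset.mem_singleton.1 a2).symm)
  · rw [show [s1.reg rQ, s2.reg rQ] = [s1.reg rQ] ++ [s2.reg rQ] from rfl, RAMState.meas_append,
      hst45.hext.meas_eq (by simpa using hqV2), hst45.hext.meas_eq (by simpa using hrV), m1, m2]
    omega
  · simp
  · rw [hcod, FreeB.compl_norm hg (hL.codesL_nonempty ha) hL.ne_neg,
      FreeB.compl_norm hg' (hL'.codesL_nonempty hb) hL'.ne_neg, FreeB.join_norm]
  · have y1 := Nat.mul_le_mul_left D hql
    have y2 := Nat.mul_le_mul_left D hrl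
    have y3 : 1600 * D * (4 + s1.arr aAL (s1.reg rQ) + s2.arr aAL (s2.reg rQ)) =
      6400 * D + 800 * (D * (2 * s1.arr aAL (s1.reg rQ))) +
        800 * (D * (2 * s2.arr aAL (s2.reg rQ))) := by ring
    simp only [RAMExpr.cost]
    omega
  · simp
    omega
  · simp
    omega

theorem JoinPost.mono {s s' : RAMState} {V : Set ℕ} {c : ℕ → ℕ} {D e e' m k k' : ℕ} {X : FreeB}
    (h : JoinPost s V c D e m X s' k) (hD : 1 ≤ D) (he : e < e') (hk : k' ≤ k + 1600) :
    JoinPost s V c D e' m X s' k' := by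
  obtain ⟨V', c', n, h1, h2, h3, h4⟩ := h
  refine ⟨V', c', n, h1, h2, ?_, h4⟩
  have x1 : 1600 * D * (m + e) + 1600 * D * 1 = 1600 * D * (m + (e + 1)) := by ring
  have x2 : 1600 * D * (m + (e + 1)) ≤ 1600 * D * (m + e') := Nat.mul_le_mul_left _ (by omega)
  omega

theorem JoinPost.step {s₀ s s' : RAMState} {V : Set ℕ} {c : ℕ → ℕ} {D e m k : ℕ} {X : FreeB}
    (hs : Step s₀ V c s V c) (hfp : s.reg rFP = s₀.reg rFP)
    (h : JoinPost s V c D e m X s' k) : JoinPost s₀ V c D e m X s' k := by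
  obtain ⟨V', c', n, h1, h2, h3, h4⟩ := h
  exact ⟨V', c', n, hs.trans h1, h2, h3, by rwa [hfp] at h4⟩

theorem wp_swapP {s : RAMState} {V : Set ℕ} {c : ℕ → ℕ} (h : Heap s V c) :
    wp swapP s fun s' k => k ≤ 10 ∧ Step s V c s' V c ∧ s'.reg rRa = s.reg rRb ∧
      s'.reg rRb = s.reg rRa := by
  refine wp.mono (Q := fun s' k => k ≤ 10 ∧ s'.reg rRa = s.reg rRb ∧ s'.reg rRb = s.reg rRa) ?_ ?_
  · simp [swapP]
  · rintro s' k f ⟨h1, h2, h3⟩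
    exact ⟨h1, .of_frame h f (by decide) (.frame f (by decide)), h2, h3⟩

theorem wp_negnegP {s : RAMState} {V : Set ℕ} {c : ℕ → ℕ} (h : Heap s V c) {L L' : List ℕ}
    (ha : s.reg rRa ≠ 0) (hb : s.reg rRb ≠ 0) (hL : IsRope s V c (s.reg rRa) L)
    (hL' : IsRope s V c (s.reg rRb) L') (hG : s.reg rGa = 1)
    (hT : s.meas L + s.meas L' + 4 ≤ s.reg rT) {D : ℕ} (hD : 1 ≤ D)
    (hfp : s.reg rFP + (s.meas L + s.meas L') + 12 ≤ 2 ^ D) :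
    wp negnegP s (JoinPost s V c D 6 (s.meas L + s.meas L')
      (.join (.compl (.norm (codesL c L))) (.compl (.norm (codesL c L'))))) := by
  simp only [negnegP, wp_block_cons, wp_ite, wp_block_nil, wp_skip]
  constructor
  · intro hlt
    have hlt' : s.meas L' < s.meas L := by
      simpa [hL.rope.meas_eq ha, hL'.rope.meas_eq hb] using hlt
    refine (wp_swapP h).mono ?_
    rintro s1 k1 f1 ⟨hk1, hst1, ra1, rb1⟩
    have e1 := hst1.hext.meas_eq hL.rope.mem
    have e2 := hst1.hext.meas_eq hL'.rope.mem
    have fp1 : s1.reg rFP = s.reg rFP := f1.reg _ (by decide)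
    have key := wp_negnegLeP (L := L') (L' := L) hst1.heap (by rwa [ra1]) (by rwa [rb1])
      (by rw [ra1]; exact hL'.step hst1) (by rw [rb1]; exact hL.step hst1)
      ((f1.reg _ (by decide)).trans hG) (by omega)
      (by rw [e1, e2, f1.reg rT (by decide)]; omega) hD (by rw [e1, e2, fp1]; omega)
    rw [e1, e2, add_comm (s.meas L'), FreeB.join_comm] at key
    refine key.mono fun s' k _ hk => (hk.step hst1 fp1).mono hD (by omega) ?_
    simp only [RAMExpr.cost]
    omega
  · intro hle
    have hle' : s.meas L ≤ s.meas L' := by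
      simpa [hL.rope.meas_eq ha, hL'.rope.meas_eq hb] using hle
    refine (wp_negnegLeP h ha hb hL hL' hG hle' hT hD hfp).mono fun s' k _ hk =>
      hk.mono hD (by omega) ?_
    simp only [RAMExpr.cost]
    omega

/-- An empty rope means `0` or `1` according to the sign, which settles the cases outside the four
combinations of signs. -/
theorem wp_joinP {s : RAMState} {V : Set ℕ} {c : ℕ → ℕ} (h : Heap s V c) {m m' : ℕ}
    {X X' : FreeB} (hX : IsVal s V c (s.reg rGa) (s.reg rRa) X m)
    (hX' : IsVal s V c (s.reg rGb) (s.reg rRb) X' m')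
    (hT : m + m' + 4 ≤ s.reg rT) {D : ℕ} (hD : 1 ≤ D)
    (hfp : s.reg rFP + (m + m') + 12 ≤ 2 ^ D) :
    wp joinP s (JoinPost s V c D 8 (m + m') (.join X X')) := by
  obtain ⟨L, hL, rfl, hXL⟩ := hX
  obtain ⟨L', hL', rfl, hXL'⟩ := hX'
  simp only [joinP, wp_ite, wp_skip]
  refine ⟨fun ha => ⟨fun hb => ⟨fun hg => ⟨fun hg' => ?_, fun hg' => ?_⟩,
    fun hg => ⟨fun hg' => ?_, fun hg' => ?_⟩⟩, fun hb => ⟨fun hg' => ?_, fun hg' => ?_⟩⟩,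
    fun ha => ⟨fun hg => ?_, fun hg => ?_⟩⟩
  all_goals simp only [RAMExpr.val_reg] at *
  · obtain ⟨g, rfl⟩ := hXL.resolve_left fun H => hg H.1
    obtain ⟨g', rfl⟩ := hXL'.resolve_left fun H => hg' H.1
    refine (wp_negnegP h ha hb hL hL' g hT hD hfp).mono fun s' k _ hk =>
      hk.mono hD (by omega) ?_
    simp only [RAMExpr.cost]
    omega
  · obtain ⟨g, rfl⟩ := hXL.resolve_left fun H => hg H.1
    obtain ⟨g', rfl⟩ := hXL'.resolve_right fun H => by omega
    simp only [wp_block_cons, wp_block_nil, wp_assign]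
    refine (wp_swapP h).mono ?_
    rintro s1 k1 f1 ⟨hk1, hst1, ra1, rb1⟩
    have hs1 := hst1.trans (Step.setReg hst1.heap (x := rGa) ((RAMExpr.const 0).val s1)
      (by decide))
    have e1 := hs1.hext.meas_eq hL.rope.mem
    have e2 := hs1.hext.meas_eq hL'.rope.mem
    have fp1 : (s1.setReg rGa ((RAMExpr.const 0).val s1)).reg rFP = s.reg rFP := by
      simp [f1.reg rFP (by decide)]
    have key := wp_posnegP (L := L') (L' := L) hs1.heap (by simpa [ra1] using hb)
      (by simpa [rb1] using ha) (by simpa [ra1] using hL'.step hs1)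
      (by simpa [rb1] using hL.step hs1) (by simp)
      (by rw [e1, e2]; simp [f1.reg rT (by decide)]; omega) hD (by rw [fp1]; omega)
    rw [e1, e2, add_comm (s.meas L'), FreeB.join_comm] at key
    refine key.mono fun s' k _ hk => (hk.step hs1 fp1).mono hD (by omega) ?_
    simp only [RAMExpr.cost]
    omega
  · obtain ⟨g, rfl⟩ := hXL.resolve_right fun H => by omega
    obtain ⟨g', rfl⟩ := hXL'.resolve_left fun H => hg' H.1
    refine (wp_posnegP h ha hb hL hL' g (by omega) hD (by omega)).mono fun s' k _ hk =>
      hk.mono hD (by omega) ?_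
    simp only [RAMExpr.cost]
    omega
  · obtain ⟨g, rfl⟩ := hXL.resolve_right fun H => by omega
    obtain ⟨g', rfl⟩ := hXL'.resolve_right fun H => by omega
    refine (wp_concatP h ha hb hL.rope hL'.rope (by omega)).mono ?_
    rintro s1 k1 f1 ⟨hk1, hst1, ra1, hr1⟩
    have hcod : codesL c (L ++ L') = codesL c L ∪ codesL c L' := codesL_append _ _ _
    refine ⟨V, c, s.meas L + s.meas L', hst1, ⟨L ++ L', ⟨hr1, ?_⟩, ?_, .inl ⟨?_, ?_⟩⟩, ?_, ?_, ?_⟩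
    · rw [hcod]; exact union_ne_neg (hL.codesL_nonempty ha) hL.ne_neg _
    · rw [RAMState.meas_append, hst1.hext.meas_eq hL.rope.mem, hst1.hext.meas_eq hL'.rope.mem]
    · rw [f1.reg _ (by decide), g]
    · rw [hcod, FreeB.join_norm]
    · simp only [RAMExpr.cost]
      have : 1600 * D * (s.meas L + s.meas L' + 8) =
        1600 * D * (s.meas L + s.meas L') + 12800 * D := by ring
      omega
    · rw [f1.reg _ (by decide)]; omega
    · rw [f1.reg _ (by decide)]
  · obtain ⟨g', rfl⟩ := hXL'.resolve_left fun H => hg' H.1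
    have hL0 : L' = [] := by rw [hb] at hL'; exact hL'.rope.eq_nil
    subst hL0
    simp only [wp_block_cons, wp_block_nil, wp_assign]
    have hs1 := Step.setReg h (x := rGa) ((RAMExpr.const 1).val s) (by decide)
    have hs2 := hs1.trans (Step.setReg hs1.heap (x := rRa)
      ((RAMExpr.const 0).val (s.setReg rGa ((RAMExpr.const 1).val s))) (by decide))
    refine ⟨V, c, 0, hs2, ?_, ?_, ?_, ?_⟩
    · have := IsVal.nil ((s.setReg rGa 1).setReg rRa 0) V c (g := 1) (.inr rfl)
      simpa [codesL, FreeB.compl_empty, FreeB.join_top] using this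
    · simp only [RAMExpr.cost]
      have : 1600 * D * (s.meas L + s.meas [] + 8) =
        1600 * D * (s.meas L + s.meas []) + 12800 * D := by ring
      omega
    · simp
      omega
    · simp
  · obtain ⟨g', rfl⟩ := hXL'.resolve_right fun H => by omega
    have hL0 : L' = [] := by rw [hb] at hL'; exact hL'.rope.eq_nil
    subst hL0
    refine ⟨V, c, s.meas L, .refl h, ⟨L, hL, rfl, ?_⟩, ?_, by omega, le_rfl⟩
    · simpa [codesL, FreeB.join_bot] using hXL
    · simp only [RAMExpr.cost]
      have : 1600 * D * (s.meas L + s.meas [] + 8) =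
        1600 * D * s.meas L + 1600 * D * s.meas [] + 12800 * D := by ring
      omega
  · obtain ⟨g, rfl⟩ := hXL.resolve_left fun H => hg H.1
    have hL0 : L = [] := by rw [ha] at hL; exact hL.rope.eq_nil
    subst hL0
    refine ⟨V, c, 0, .refl h, ?_, ?_, by omega, le_rfl⟩
    · have := IsVal.nil s V c (g := 1) (.inr rfl)
      rw [ha, g]
      simpa [codesL, FreeB.compl_empty, FreeB.join_top, FreeB.join_comm .top] using this
    · simp only [RAMExpr.cost]
      have : 1600 * D * (s.meas [] + s.meas L' + 8) =
        1600 * D * (s.meas [] + s.meas L') + 12800 * D := by ring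
      omega
  · obtain ⟨g, rfl⟩ := hXL.resolve_right fun H => by omega
    have hL0 : L = [] := by rw [ha] at hL; exact hL.rope.eq_nil
    subst hL0
    simp only [wp_block_cons, wp_block_nil, wp_assign]
    have hs1 := Step.setReg h (x := rGa) ((RAMExpr.reg rGb).val s) (by decide)
    have hs2 := hs1.trans (Step.setReg hs1.heap (x := rRa)
      ((RAMExpr.reg rRb).val (s.setReg rGa ((RAMExpr.reg rGb).val s))) (by decide))
    have hv : IsVal s V c (s.reg rGb) (s.reg rRb) X' (s.meas L') := ⟨L', hL', rfl, hXL'⟩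
    refine ⟨V, c, s.meas L', hs2, ?_, ?_, ?_, ?_⟩
    · have := hv.step hs2
      simpa [codesL, FreeB.join_bot, FreeB.join_comm (.norm ∅)] using this
    · simp only [RAMExpr.cost]
      have : 1600 * D * (s.meas [] + s.meas L' + 8) =
        1600 * D * s.meas [] + 1600 * D * s.meas L' + 12800 * D := by ring
      omega
    · simp
      omega
    · simp

/-! ### The stack machine -/

section
open RAMExpr RAMProg

/-- Increase the credit `rT` and fetch the next item. -/
def fetchP : RAMProg := block [
  -- The free pointer plus the total measure grows by at most `12` in a join and by `4` for a
  -- variable, so the credit `rT` remains an upper bound.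
  assign rT (add (reg rT) (const 16)),
  assign rSP (sub (reg rSP) (const 1)),
  assign rItem (load aWS (reg rSP))]

/-- Replace the top value by its complement. -/
def negOpP : RAMProg :=
  store aVS (sub (reg rVP) (const 1)) (sub (const 1) (load aVS (sub (reg rVP) (const 1))))

/-- Load the top two values. -/
def loadValsP : RAMProg := block [
  assign rVP (sub (reg rVP) (const 1)),
  assign rGb (load aVS (reg rVP)),
  assign rRb (load aVR (reg rVP)),
  assign rGa (load aVS (sub (reg rVP) (const 1))),
  assign rRa (load aVR (sub (reg rVP) (const 1)))]

/-- Replace the top value by the one in `rGa`, `rRa`. -/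
def storeValP : RAMProg := block [
  store aVS (sub (reg rVP) (const 1)) (reg rGa),
  store aVR (sub (reg rVP) (const 1)) (reg rRa)]

/-- Replace the top two values by their join. -/
def joinOpP : RAMProg := block [loadValsP, joinP, storeValP]

/-- Treat an item: `0` complements the top value, `1` joins the top two values, and `p + 2` is
treated by `ev`. -/
def bodyP (ev : RAMProg) : RAMProg := block [
  fetchP,
  ite (reg rItem) (ite (sub (reg rItem) (const 1)) ev joinOpP) negOpP]

/-- Push a value. -/
def pushP (g r : RAMExpr) : RAMProg := block [
  store aVS (reg rVP) g,
  store aVR (reg rVP) r,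
  assign rVP (add (reg rVP) (const 1))]

/-- Push an item. -/
def pushItemP (e : RAMExpr) : RAMProg := block [
  store aWS (reg rSP) e,
  assign rSP (add (reg rSP) (const 1))]

end

-- Segments of runs of the main loop

/-- From `s` to `s'`, values of measure `m₀` on the stack of values have been replaced by the
value `X` of measure `m` at place `v`, and the stack of items has become `w` high. -/
structure TopVal (s : RAMState) (V : Set ℕ) (c : ℕ → ℕ) (w v m₀ n : ℕ) (X : FreeB)
    (s' : RAMState) (V' : Set ℕ) (c' : ℕ → ℕ) (m : ℕ) : Prop where
  step : Step s V c s' V' c'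
  sp : s'.reg rSP = w
  vp : s'.reg rVP = v + 1
  ws : ∀ i < w, s'.arr aWS i = s.arr aWS i
  vs : ∀ i < v, s'.arr aVS i = s.arr aVS i
  vr : ∀ i < v, s'.arr aVR i = s.arr aVR i
  val : IsVal s' V' c' (s'.arr aVS v) (s'.arr aVR v) X m
  -- The output and the measure together grow no faster than the credit.
  fp : s'.reg rFP + m + s.reg rT ≤ s.reg rFP + m₀ + s'.reg rT
  t : s'.reg rT ≤ s.reg rT + 16 * n

/-- A state as in `TopVal` is reached. -/
def Reach (ev : RAMProg) (D : ℕ) (s : RAMState) (V : Set ℕ) (c : ℕ → ℕ) (w v m₀ n : ℕ)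
    (X : FreeB) : Prop :=
  ∃ s' V' c' m k, Iter (.reg rSP) (bodyP ev) s s' k ∧ TopVal s V c w v m₀ n X s' V' c' m ∧
    k + 1600 * D * m ≤ 1600 * D * m₀ + 16000 * D * n

theorem Reach.mono {ev : RAMProg} {D : ℕ} {s : RAMState} {V : Set ℕ} {c : ℕ → ℕ}
    {w v m₀ n n' : ℕ} {X : FreeB} (h : Reach ev D s V c w v m₀ n X) (hn : n ≤ n') :
    Reach ev D s V c w v m₀ n' X := by
  obtain ⟨s', V', c', m, k, h1, h2, h3⟩ := h
  refine ⟨s', V', c', m, k, h1, { h2 with t := h2.t.trans (by omega) }, h3.trans ?_⟩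
  have := Nat.mul_le_mul_left (16000 * D) hn
  omega

/-- The inequalities for time, credit and output are linear, so they add up along segments; `m₂` is
the measure of values lower on the stack, carried along unchanged. -/
theorem Reach.bind {ev : RAMProg} {D : ℕ} {s : RAMState} {V : Set ℕ} {c : ℕ → ℕ}
    {w v m₀ n w₁ v₁ m₁ n₁ m₂ n₂ : ℕ} {X X₁ : FreeB} (h : Reach ev D s V c w₁ v₁ m₁ n₁ X₁)
    (hw : w ≤ w₁) (hv : v ≤ v₁) (hm : m₁ + m₂ = m₀) (hn : n₁ + n₂ = n)
    (hi : aIn ∉ (bodyP ev).arrs)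
    (H : ∀ s' V' c' m, TopVal s V c w₁ v₁ m₁ n₁ X₁ s' V' c' m → s'.arr aIn = s.arr aIn →
      Reach ev D s' V' c' w v (m + m₂) n₂ X) : Reach ev D s V c w v m₀ n X := by
  obtain ⟨s', V', c', m, k, h1, h2, h3⟩ := h
  obtain ⟨s'', V'', c'', m', k', h1', h2', h3'⟩ := H s' V' c' m h2 (h1.frame.arr _ hi)
  refine ⟨s'', V'', c'', m', k + k', h1.trans h1', ⟨h2.step.trans h2'.step, h2'.sp, h2'.vp,
    fun i hi => (h2'.ws i hi).trans (h2.ws i (by omega)),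
    fun i hi => (h2'.vs i hi).trans (h2.vs i (by omega)),
    fun i hi => (h2'.vr i hi).trans (h2.vr i (by omega)), h2'.val, ?_, ?_⟩, ?_⟩
  · have := h2.fp
    have := h2'.fp
    omega
  · have := h2.t
    have := h2'.t
    omega
  · subst hm hn
    rw [mul_add] at h3' ⊢
    rw [mul_add]
    omega

theorem Reach.of_wp {ev : RAMProg} {D : ℕ} {s : RAMState} {V : Set ℕ} {c : ℕ → ℕ}
    {w v m₀ n : ℕ} {X : FreeB} (hs : s.reg rSP ≠ 0)
    (h : wp (bodyP ev) s fun s' k => ∃ V' c' m, TopVal s V c w v m₀ n X s' V' c' m ∧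
      k + 2 + 1600 * D * m ≤ 1600 * D * m₀ + 16000 * D * n) : Reach ev D s V c w v m₀ n X := by
  obtain ⟨s', k, hr, V', c', m, h1, h2⟩ := h
  refine ⟨s', V', c', m, _, .step hs hr (.refl _), h1, ?_⟩
  simp only [RAMExpr.cost]
  omega

theorem Reach.head {ev : RAMProg} {D : ℕ} {s : RAMState} {V : Set ℕ} {c : ℕ → ℕ}
    {w v m₀ n n₁ n₂ : ℕ} {X : FreeB} (hs : s.reg rSP ≠ 0) (hn : n₁ + n₂ = n) (hn₁ : 1 ≤ n₁)
    (h : wp (bodyP ev) s fun s' k => k + 2 ≤ 16000 * D * n₁ ∧ Step s V c s' V c ∧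
      s'.reg rT = s.reg rT + 16 ∧ s'.reg rFP = s.reg rFP ∧
      (∀ i < w, s'.arr aWS i = s.arr aWS i) ∧ (∀ i < v, s'.arr aVS i = s.arr aVS i) ∧
      (∀ i < v, s'.arr aVR i = s.arr aVR i) ∧ Reach ev D s' V c w v m₀ n₂ X) :
    Reach ev D s V c w v m₀ n X := by
  obtain ⟨s₁, k₁, hr, hk, hst, hT, hF, hws, hvs, hvr, s', V', c', m, k, h1, h2, h3⟩ := h
  refine ⟨s', V', c', m, _, .step hs hr h1, ⟨hst.trans h2.step, h2.sp, h2.vp,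
    fun i hi => (h2.ws i hi).trans (hws i hi), fun i hi => (h2.vs i hi).trans (hvs i hi),
    fun i hi => (h2.vr i hi).trans (hvr i hi), h2.val, ?_, ?_⟩, ?_⟩
  · have := h2.fp
    omega
  · have := h2.t
    omega
  · subst hn
    rw [mul_add]
    simp only [RAMExpr.cost]
    omega

theorem wp_fetchP {s : RAMState} {V : Set ℕ} {c : ℕ → ℕ} (h : Heap s V c) {w : ℕ}
    (hw : s.reg rSP = w + 1) : wp fetchP s fun s' k => k ≤ 20 ∧ Step s V c s' V c ∧
      s'.reg rT = s.reg rT + 16 ∧ s'.reg rSP = w ∧ s'.reg rItem = s.arr aWS w := by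
  refine wp.mono (Q := fun s' k => k ≤ 20 ∧ s'.reg rT = s.reg rT + 16 ∧ s'.reg rSP = w ∧
    s'.reg rItem = s.arr aWS w) (by simp [fetchP, hw]) ?_
  rintro s' k f ⟨h1, h2⟩
  exact ⟨h1, .of_frame h f (by decide) (.frame f (by decide)), h2⟩

/-- Complements are lazy: the list is kept, and double negations cancel in the sign. -/
theorem IsVal.compl {s : RAMState} {V : Set ℕ} {c : ℕ → ℕ} {g r m : ℕ} {X : FreeB}
    (h : IsVal s V c g r X m) : IsVal s V c (1 - g) r X.compl m := by
  obtain ⟨L, h1, h2, ⟨rfl, rfl⟩ | ⟨rfl, rfl⟩⟩ := h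
  · exact ⟨L, h1, h2, .inr ⟨rfl, rfl⟩⟩
  · exact ⟨L, h1, h2, .inl ⟨rfl, FreeB.compl_compl _⟩⟩

theorem Reach.negOp {ev : RAMProg} {D : ℕ} {s : RAMState} {V : Set ℕ} {c : ℕ → ℕ} {w v m : ℕ}
    {X : FreeB} (h : Heap s V c) (hD : 1 ≤ D) (hw : s.reg rSP = w + 1) (hi : s.arr aWS w = 0)
    (hv : s.reg rVP = v + 1) (hX : IsVal s V c (s.arr aVS v) (s.arr aVR v) X m) :
    Reach ev D s V c w v m 1 X.compl := by
  refine .of_wp (by omega) ?_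
  simp only [bodyP, wp_block_cons, wp_block_nil, wp_ite]
  refine (wp_fetchP h hw).mono ?_
  rintro s1 k1 f1 ⟨hk1, hst1, ht1, hsp1, hit1⟩
  have hvs : s1.arr aVS = s.arr aVS := f1.arr _ (by decide)
  have hvr : s1.arr aVR = s.arr aVR := f1.arr _ (by decide)
  have hws : s1.arr aWS = s.arr aWS := f1.arr _ (by decide)
  have hfp : s1.reg rFP = s.reg rFP := f1.reg _ (by decide)
  have hvp : s1.reg rVP = v + 1 := (f1.reg _ (by decide)).trans hv
  refine ⟨fun h0 => absurd (hit1.trans hi) h0, fun _ => ?_⟩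
  refine wp.mono (p := negOpP) (Q := fun s' k => k ≤ 20 ∧
    s'.arr aVS = Function.update (s.arr aVS) v (1 - s.arr aVS v)) ?_ ?_
  · simp [negOpP, hvp, hvs]
  rintro s' k f ⟨hk, hvs'⟩
  have hst2 : Step s1 V c s' V c := .of_frame hst1.heap f (by decide) (.frame f (by decide))
  have hst := hst1.trans hst2
  have hvr' : s'.arr aVR = s.arr aVR := (f.arr _ (by decide)).trans hvr
  have ht' : s'.reg rT = s.reg rT + 16 := (f.reg _ (by decide)).trans ht1
  have hfp' : s'.reg rFP = s.reg rFP := (f.reg _ (by decide)).trans hfp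
  refine ⟨V, c, m, ⟨hst, (f.reg _ (by decide)).trans hsp1, (f.reg _ (by decide)).trans hvp,
    fun i _ => ?_, fun i hi => ?_, fun i _ => by rw [hvr'], ?_, by omega, by omega⟩, ?_⟩
  · rw [f.arr aWS (by decide), hws]
  · rw [hvs', Function.update_of_ne (by omega)]
  · rw [hvs', hvr', Function.update_self]
    exact (hX.step hst).compl
  · simp only [RAMExpr.cost]
    omega

/-- The constant part of the cost of `joinP` is `8 * 1600 * D`, which together with the handling of
the stacks fits into the `16000 * D` granted to one item. -/
theorem Reach.joinOp {ev : RAMProg} {D : ℕ} {s : RAMState} {V : Set ℕ} {c : ℕ → ℕ}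
    {w v m m' : ℕ} {X X' : FreeB} (h : Heap s V c) (hD : 1 ≤ D) (hw : s.reg rSP = w + 1)
    (hi : s.arr aWS w = 1) (hv : s.reg rVP = v + 2)
    (hX : IsVal s V c (s.arr aVS v) (s.arr aVR v) X m)
    (hX' : IsVal s V c (s.arr aVS (v + 1)) (s.arr aVR (v + 1)) X' m')
    (hT : s.reg rFP + (m + m') ≤ s.reg rT) (hTD : s.reg rT + 16 ≤ 2 ^ D) :
    Reach ev D s V c w v (m + m') 1 (X.join X') := by
  refine .of_wp (by omega) ?_
  simp only [bodyP, wp_block_cons, wp_block_nil, wp_ite]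
  refine (wp_fetchP h hw).mono ?_
  rintro s1 k1 f1 ⟨hk1, hst1, ht1, hsp1, hit1⟩
  have hvs : s1.arr aVS = s.arr aVS := f1.arr _ (by decide)
  have hvr : s1.arr aVR = s.arr aVR := f1.arr _ (by decide)
  have hws : s1.arr aWS = s.arr aWS := f1.arr _ (by decide)
  have hfp : s1.reg rFP = s.reg rFP := f1.reg _ (by decide)
  have hvp : s1.reg rVP = v + 2 := (f1.reg _ (by decide)).trans hv
  rw [hi] at hit1
  refine ⟨fun _ => ⟨fun h0 => absurd (show _ = 0 by simp [hit1]) h0, fun _ => ?_⟩,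
    fun h0 => absurd (show s1.reg rItem = 0 from h0) (by omega)⟩
  simp only [joinOpP, wp_block_cons]
  refine wp.mono (p := loadValsP) (Q := fun s' k => k ≤ 40 ∧ s'.reg rVP = v + 1 ∧
    s'.reg rGa = s.arr aVS v ∧ s'.reg rRa = s.arr aVR v ∧ s'.reg rGb = s.arr aVS (v + 1) ∧
    s'.reg rRb = s.arr aVR (v + 1)) ?_ ?_
  · simp [loadValsP, hvp, hvs, hvr]
  rintro s2 k2 f2 ⟨hk2, hvp2, hga, hra, hgb, hrb⟩
  have hst2 : Step s V c s2 V c :=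
    hst1.trans (.of_frame hst1.heap f2 (by decide) (.frame f2 (by decide)))
  have ht2 : s2.reg rT = s.reg rT + 16 := (f2.reg _ (by decide)).trans ht1
  have hfp2 : s2.reg rFP = s.reg rFP := (f2.reg _ (by decide)).trans hfp
  refine (wp_joinP (D := D) (m := m) (m' := m') (X := X) (X' := X') hst2.heap ?_ ?_ ?_ hD ?_).mono ?_
  · rw [hga, hra]; exact hX.step hst2
  · rw [hgb, hrb]; exact hX'.step hst2
  · omega
  · omega
  rintro s3 k3 f3 ⟨V', c', m'', hst3, hval, hk3, hfp3, hfp3'⟩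
  have hvp3 : s3.reg rVP = v + 1 := (f3.reg _ (by decide)).trans hvp2
  have hvs3 : s3.arr aVS = s.arr aVS :=
    (f3.arr _ (by decide)).trans ((f2.arr _ (by decide)).trans hvs)
  have hvr3 : s3.arr aVR = s.arr aVR :=
    (f3.arr _ (by decide)).trans ((f2.arr _ (by decide)).trans hvr)
  refine wp.mono (p := storeValP) (Q := fun s' k => k ≤ 40 ∧
    s'.arr aVS = Function.update (s.arr aVS) v (s3.reg rGa) ∧
    s'.arr aVR = Function.update (s.arr aVR) v (s3.reg rRa)) ?_ ?_
  · simp [storeValP, hvp3, hvs3, hvr3]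
  rintro s4 k4 f4 ⟨hk4, hvs4, hvr4⟩
  have hst4 : Step s3 V' c' s4 V' c' := .of_frame hst3.heap f4 (by decide) (.frame f4 (by decide))
  have hws4 : s4.arr aWS = s.arr aWS := (f4.arr _ (by decide)).trans ((f3.arr _ (by decide)).trans
    ((f2.arr _ (by decide)).trans hws))
  have hsp4 : s4.reg rSP = w := (f4.reg _ (by decide)).trans ((f3.reg _ (by decide)).trans
    ((f2.reg _ (by decide)).trans hsp1))
  have ht4 : s4.reg rT = s.reg rT + 16 :=
    (f4.reg _ (by decide)).trans ((f3.reg _ (by decide)).trans ht2)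
  have hfp4 : s4.reg rFP = s3.reg rFP := f4.reg _ (by decide)
  rw [wp_block_nil]
  refine ⟨V', c', m'', ⟨hst2.trans (hst3.trans hst4), hsp4, (f4.reg _ (by decide)).trans hvp3,
    fun i _ => by rw [hws4], fun i hi => ?_, fun i hi => ?_, ?_, by omega, by omega⟩, ?_⟩
  · rw [hvs4, Function.update_of_ne (by omega)]
  · rw [hvr4, Function.update_of_ne (by omega)]
  · rw [hvs4, hvr4, Function.update_self, Function.update_self]
    exact hval.step hst4
  · simp only [RAMExpr.cost]
    rw [mul_add] at hk3
    omega

/-- The first part of the treatment of the item `p + 2`. -/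
theorem wp_bodyP_ev {ev : RAMProg} {s : RAMState} {V : Set ℕ} {c : ℕ → ℕ} (h : Heap s V c)
    {w p : ℕ} (hw : s.reg rSP = w + 1) (hi : s.arr aWS w = p + 2) {Q : RAMState → ℕ → Prop}
    (H : ∀ s', Step s V c s' V c → s'.reg rT = s.reg rT + 16 → s'.reg rSP = w →
      s'.reg rItem = p + 2 → s'.reg rVP = s.reg rVP → s'.reg rFP = s.reg rFP →
      s'.arr = s.arr → wp ev s' fun s'' k => ∀ k' ≤ k + 30, Q s'' k') :
    wp (bodyP ev) s Q := by
  simp only [bodyP, wp_block_cons, wp_block_nil, wp_ite]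
  refine (wp_fetchP h hw).mono ?_
  rintro s1 k1 f1 ⟨hk1, hst1, ht1, hsp1, hit1⟩
  rw [hi] at hit1
  refine ⟨fun _ => ⟨fun _ => ?_, fun h0 => absurd (show s1.reg rItem - 1 = 0 from h0) (by omega)⟩,
    fun h0 => absurd (show s1.reg rItem = 0 from h0) (by omega)⟩
  refine (H s1 hst1 ht1 hsp1 hit1 (f1.reg _ (by decide)) (f1.reg _ (by decide))
    (funext fun a => f1.arr _ (by simp [fetchP, RAMProg.block, RAMProg.arrs]))).mono ?_
  intro s2 k2 _ hQ
  refine hQ _ ?_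
  simp only [RAMExpr.cost]
  omega

-- Evaluation of single nodes

section
open RAMExpr RAMProg

/-- Write a new variable with index in `aIn` at `rP + 1` to the output. -/
def newVarP : RAMProg := block [
  store aAL (reg rFP) (const 0),
  store aVar (load aIn (add (reg rP) (const 1))) (reg rFP),
  assign rQ (reg rFP),
  emitP (const 2),
  emitP (load aIn (add (reg rP) (const 1)))]

/-- Push the value of the variable with index in `aIn` at `rP + 1`. -/
def varP : RAMProg := block [
  assign rQ (load aVar (load aIn (add (reg rP) (const 1)))),
  ite (reg rQ) skip newVarP,
  leafP,
  pushP (const 0) (reg rRC)]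

/-- Push the items for a complement. -/
def negExpP : RAMProg := block [
  pushItemP (const 0),
  pushItemP (add (load aIn (add (reg rP) (const 1))) (const 2))]

/-- The branch of the evaluation of a node with label `n`, where `op` treats `n > 3`. -/
def branchP (op : RAMProg) (n : ℕ) : RAMProg :=
  if n < 2 then pushP (reg rLab) (const 0) else if n = 2 then varP else if n = 3 then negExpP
  else op

/-- Treat the item `rItem = p + 2`: evaluate the node at address `p`. -/
def evP (op : RAMProg) : RAMProg := block [
  assign rP (sub (reg rItem) (const 2)),
  assign rLab (load aIn (reg rP)),
  ite (lt (reg rLab) (const 2)) (pushP (reg rLab) (const 0))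
    (ite (eq (reg rLab) (const 2)) varP
      (ite (eq (reg rLab) (const 3)) negExpP op))]

/-- Push the items for an `n`-ary join. -/
def supExpP : RAMProg := block [
  pushP (const 0) (const 0),
  assign rLen (load aIn (add (reg rP) (const 1))),
  assign rI (const 0),
  loop (lt (reg rI) (reg rLen)) (block [
    pushItemP (const 1),
    pushItemP (add (load aIn (add (add (reg rP) (const 2)) (reg rI))) (const 2)),
    assign rI (add (reg rI) (const 1))])]

/-- Push the items for a binary join or meet. -/
def binExpP : RAMProg :=
  ite (eq (reg rLab) (const 4))
    (block [pushItemP (const 1), pushItemP (add (load aIn (add (reg rP) (const 2))) (const 2)),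
      pushItemP (add (load aIn (add (reg rP) (const 1))) (const 2))])
    (block [pushItemP (const 0), pushItemP (const 1), pushItemP (const 0),
      pushItemP (add (load aIn (add (reg rP) (const 2))) (const 2)), pushItemP (const 0),
      pushItemP (add (load aIn (add (reg rP) (const 1))) (const 2))])

end

theorem wp_newVarP {s : RAMState} {V : Set ℕ} {c : ℕ → ℕ} (h : Heap s V c)
    (h0 : s.arr aVar (s.arr aIn (s.reg rP + 1)) = 0) : wp newVarP s fun s' k => k ≤ 60 ∧
      s'.reg rFP = s.reg rFP + 2 ∧ ∃ V' c', Step s V c s' V' c' ∧ s'.reg rQ ∈ V' ∧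
      c' (s'.reg rQ) = varC (s.arr aIn (s.reg rP + 1)) ∧ s'.arr aAL (s'.reg rQ) = 0 := by
  refine wp.mono (Q := fun s' k => k ≤ 60 ∧ s'.reg rQ = s.reg rFP ∧
    s'.reg rFP = s.reg rFP + 2 ∧
    s'.arr aOut = Function.update (Function.update (s.arr aOut) (s.reg rFP) 2) (s.reg rFP + 1)
      (s.arr aIn (s.reg rP + 1)) ∧
    (∀ i < s.reg rFP + 2, s'.arr aHalf i = i / 2) ∧
    s'.arr aAL = Function.update (s.arr aAL) (s.reg rFP) 0 ∧
    s'.arr aVar = Function.update (s.arr aVar) (s.arr aIn (s.reg rP + 1)) (s.reg rFP)) ?_ ?_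
  · simp only [newVarP, wp_block_cons, wp_store, wp_assign]
    refine (wp_emitP ?_ ?_).mono ?_
    · simpa using h.fp
    · simpa using h.half
    rintro s1 k1 f1 ⟨rfl, fp1, out1, half1⟩
    simp at fp1 out1 half1
    refine (wp_emitP ?_ ?_).mono ?_
    · have := h.fp; omega
    · exact fun i hi => half1 i (by omega)
    rintro s2 k2 f2 ⟨rfl, fp2, out2, half2⟩
    have in1 : s1.arr aIn = s.arr aIn := (f1.arr _ (by decide)).trans (by simp)
    have p1 : s1.reg rP = s.reg rP := (f1.reg _ (by decide)).trans (by simp)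
    have hq : s2.reg rQ = s.reg rFP :=
      (f2.reg _ (by decide)).trans ((f1.reg _ (by decide)).trans (by simp))
    have hal : s2.arr aAL = Function.update (s.arr aAL) (s.reg rFP) 0 :=
      (f2.arr _ (by decide)).trans ((f1.arr _ (by decide)).trans (by simp))
    have hvar : s2.arr aVar =
        Function.update (s.arr aVar) (s.arr aIn (s.reg rP + 1)) (s.reg rFP) :=
      (f2.arr _ (by decide)).trans ((f1.arr _ (by decide)).trans (by simp))
    rw [fp1] at fp2 out2 half2
    rw [wp_block_nil]
    refine ⟨by simp, hq, fp2, ?_, half2, hal, hvar⟩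
    rw [out2, out1]
    simp [in1, p1]
  rintro s' k f ⟨hk, hq, hfp, hout, hhalf, hal, hvar⟩
  obtain ⟨H, E⟩ := h.addVar (s' := s') h0 hfp
    (fun i hi => by rw [hout, Function.update_of_ne (by omega), Function.update_of_ne (by omega)])
    (by rw [hout, Function.update_of_ne (by omega), Function.update_self])
    (by rw [hout, Function.update_self]) (by rwa [hfp]) hal hvar (f.arr _ (by decide))
    (Trie.congr_frame f (by decide))
  refine ⟨hk, hfp, _, _, ⟨H, E, .frame f (by decide)⟩, ?_, ?_, ?_⟩
  · rw [hq]; exact Set.mem_insert _ _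
  · rw [hq, Function.update_self]
  · rw [hq, hal, Function.update_self]

theorem wp_pushP {s : RAMState} {g r : RAMExpr} {rv : ℕ}
    (hr : ∀ i x, r.val (s.setArr aVS i x) = rv) : wp (pushP g r) s fun s' k =>
      k = g.cost + r.cost + 9 ∧ s'.reg rVP = s.reg rVP + 1 ∧
      s'.arr aVS = Function.update (s.arr aVS) (s.reg rVP) (g.val s) ∧
      s'.arr aVR = Function.update (s.arr aVR) (s.reg rVP) rv := by
  simp [pushP, hr]
  omega

/-- The treatment of the item `p + 2` up to the branch for its label. -/
theorem wp_item {op : RAMProg} {s : RAMState} {V : Set ℕ} {c : ℕ → ℕ} (h : Heap s V c)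
    {w p : ℕ} (hw : s.reg rSP = w + 1) (hi : s.arr aWS w = p + 2) {Q : RAMState → ℕ → Prop}
    (H : ∀ s', Step s V c s' V c → s'.reg rT = s.reg rT + 16 → s'.reg rSP = w →
      s'.reg rP = p → s'.reg rLab = s.arr aIn p → s'.reg rVP = s.reg rVP →
      s'.reg rFP = s.reg rFP → s'.arr = s.arr →
      wp (branchP op (s.arr aIn p)) s' fun s'' k => ∀ k' ≤ k + 80, Q s'' k') :
    wp (bodyP (evP op)) s Q := by
  refine wp_bodyP_ev h hw hi ?_
  intro s1 hst1 ht1 hsp1 hit1 hvp1 hfp1 harr1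
  simp only [evP, wp_block_cons, wp_block_nil]
  refine wp.mono (p := .assign rP _) (Q := fun s' k => k ≤ 10 ∧ s'.reg rP = p) ?_ ?_
  · simp [hit1]
  rintro s2 k2 f2 ⟨hk2, hp2⟩
  refine wp.mono (p := .assign rLab _) (Q := fun s' k => k ≤ 10 ∧ s'.reg rLab = s2.arr aIn p) ?_ ?_
  · simp [hp2]
  rintro s3 k3 f3 ⟨hk3, hl3⟩
  have harr2 : s2.arr = s.arr := (funext fun a => f2.arr a (by simp [RAMProg.arrs])).trans harr1
  have harr3 : s3.arr = s.arr := (funext fun a => f3.arr a (by simp [RAMProg.arrs])).trans harr2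
  rw [harr2] at hl3
  have hst2 : Step s1 V c s2 V c := .of_frame hst1.heap f2 (by decide) (.frame f2 (by decide))
  have hst3 : Step s2 V c s3 V c := .of_frame hst2.heap f3 (by decide) (.frame f3 (by decide))
  have hr : ∀ x, x ≠ rP → x ≠ rLab → s3.reg x = s1.reg x := fun x h1 h2 =>
    (f3.reg x (by simpa [RAMProg.regs] using h2)).trans
      (f2.reg x (by simpa [RAMProg.regs] using h1))
  have key := H s3 (hst1.trans (hst2.trans hst3)) ((hr _ (by decide) (by decide)).trans ht1)
    ((hr _ (by decide) (by decide)).trans hsp1) ((f3.reg _ (by decide)).trans hp2) hl3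
    ((hr _ (by decide) (by decide)).trans hvp1) ((hr _ (by decide) (by decide)).trans hfp1) harr3
  unfold branchP at key
  simp only [wp_ite]
  refine ⟨fun hc => ?_, fun hc => ⟨fun hc2 => ?_, fun hc2 => ⟨fun hc3 => ?_, fun hc3 => ?_⟩⟩⟩
  all_goals simp [hl3] at *
  · rw [if_pos hc] at key
    refine key.mono fun s' k _ hQ k' hk' => hQ _ ?_
    omega
  · rw [if_neg (by omega), if_pos hc2] at key
    refine key.mono fun s' k _ hQ k' hk' => hQ _ ?_
    omega
  · rw [if_neg (by omega), if_neg hc2, if_pos hc3] at key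
    refine key.mono fun s' k _ hQ k' hk' => hQ _ ?_
    omega
  · rw [if_neg (by omega), if_neg hc2, if_neg hc3] at key
    refine key.mono fun s' k _ hQ k' hk' => hQ _ ?_
    omega

/-- The items `l` on top of the stack of items are replaced by the value `X` on the stack of
values. -/
def Produces (ev : RAMProg) (D : ℕ) (H : ℕ → ℕ) (l : List ℕ) (n : ℕ) (X : FreeB) : Prop :=
  ∀ (s : RAMState) (V : Set ℕ) (c : ℕ → ℕ) (w v : ℕ), Heap s V c → s.arr aIn = H →
    s.reg rSP = w + l.length → (∀ (i : ℕ) (h : i < l.length), s.arr aWS (w + i) = l[i]) →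
    s.reg rVP = v → s.reg rFP ≤ s.reg rT → s.reg rT + 16 * n ≤ 2 ^ D →
    Reach ev D s V c w v 0 n X

theorem Produces.mono {ev : RAMProg} {D : ℕ} {H : ℕ → ℕ} {l : List ℕ} {n n' : ℕ} {X : FreeB}
    (h : Produces ev D H l n X) (hn : n ≤ n') : Produces ev D H l n' X :=
  fun s V c w v h1 h2 h3 h4 h5 h6 h7 => (h s V c w v h1 h2 h3 h4 h5 h6 (by omega)).mono hn

theorem Produces.neg {ev : RAMProg} {D : ℕ} {H : ℕ → ℕ} {l : List ℕ} {n : ℕ} {X : FreeB}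
    (h : Produces ev D H l n X) (hD : 1 ≤ D) (hi : aIn ∉ (bodyP ev).arrs) :
    Produces ev D H (0 :: l) (n + 1) X.compl := by
  intro s V c w v h1 h2 h3 h4 h5 h6 h7
  rw [List.length_cons] at h3
  refine (h s V c (w + 1) v h1 h2 (by omega) (fun i hi => ?_) h5 h6 (by omega)).bind (m₂ := 0)
    (n₂ := 1) (by omega) le_rfl rfl rfl hi ?_
  · have := h4 (i + 1) (by simpa using hi)
    rw [List.getElem_cons_succ] at this
    rw [← this]
    congr 1
    omega
  · intro s' V' c' m ht he
    have h0 := h4 0 (by simp)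
    exact .negOp ht.step.heap hD ht.sp ((ht.ws w (by omega)).trans h0) ht.vp ht.val

/-- The last entry of the list is on top of the stack. So `l` is worked off first and its value, the
left argument, lies below that of `l'`. -/
theorem Produces.join {ev : RAMProg} {D : ℕ} {H : ℕ → ℕ} {l l' : List ℕ} {n n' : ℕ}
    {X X' : FreeB} (h : Produces ev D H l n X) (h' : Produces ev D H l' n' X') (hD : 1 ≤ D)
    (hi : aIn ∉ (bodyP ev).arrs) :
    Produces ev D H (1 :: (l' ++ l)) (n + (n' + 1)) (X.join X') := by
  intro s V c w v h1 h2 h3 h4 h5 h6 h7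
  rw [List.length_cons, List.length_append] at h3
  have hl' : ∀ (i : ℕ) (h : i < l'.length), s.arr aWS (w + 1 + i) = l'[i] := by
    intro i hi
    have := h4 (i + 1) (by simp; omega)
    rw [List.getElem_cons_succ, List.getElem_append_left hi] at this
    rw [← this]
    congr 1
    omega
  refine (h s V c (w + 1 + l'.length) v h1 h2 (by omega) (fun i hi => ?_) h5 h6 (by omega)).bind
    (m₂ := 0) (by omega) le_rfl rfl rfl hi ?_
  · have := h4 (l'.length + i + 1) (by simp; omega)
    rw [List.getElem_cons_succ, List.getElem_append_right (by omega)] at this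
    simp only [Nat.add_sub_cancel_left] at this
    rw [← this]
    congr 1
    omega
  · intro s1 V1 c1 m1 t1 e1
    have a1 := t1.fp
    have a2 := t1.t
    refine (h' s1 V1 c1 (w + 1) (v + 1) t1.step.heap (e1.trans h2) t1.sp (fun i hi => ?_) t1.vp
      (by omega) (by omega)).bind (m₂ := m1) (by omega) (Nat.le_succ v) (by omega) rfl hi ?_
    · rw [t1.ws _ (by omega), hl' i hi]
    · intro s2 V2 c2 m2 t2 e2
      have a3 := t2.fp
      have a4 := t2.t
      have h0 := h4 0 (by simp)
      rw [add_comm]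
      refine .joinOp t2.step.heap hD t2.sp ?_ t2.vp ?_ t2.val (by omega) (by omega)
      · rw [t2.ws w (by omega), t1.ws w (by omega)]; exact h0
      · rw [t2.vs v (by omega), t2.vr v (by omega)]
        exact t1.val.step t2.step

/-- For nodes of bounded arity the item is replaced in constant time by the items `l`; `hf` says
that atoms, tries, ropes, values, input and credit are not written. -/
theorem Produces.expand {op : RAMProg} {D : ℕ} {H : ℕ → ℕ} {l : List ℕ} {n p : ℕ} {X : FreeB}
    (h : Produces (evP op) D H l n X) (hD : 1 ≤ D) (q : RAMProg) (hq : branchP op (H p) = q)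
    (hf : ((rFP ∉ q.regs ∧ aOut ∉ q.arrs ∧ aHalf ∉ q.arrs ∧ aAt ∉ q.arrs ∧
      aAL ∉ q.arrs ∧ aVar ∉ q.arrs) ∧
      rTC ∉ q.regs ∧ aFl ∉ q.arrs ∧ aLe ∉ q.arrs ∧ aRi ∉ q.arrs ∧ aCo ∉ q.arrs) ∧
      (rRC ∉ q.regs ∧ aRA ∉ q.arrs ∧ aRB ∉ q.arrs ∧ aRM ∉ q.arrs) ∧
      rT ∉ q.regs ∧ rVP ∉ q.regs ∧ aIn ∉ q.arrs ∧ aVS ∉ q.arrs ∧ aVR ∉ q.arrs)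
    (hwp : ∀ s : RAMState, s.arr aIn = H → s.reg rP = p → s.reg rLab = H p →
      wp q s fun s' k => k ≤ 1000 ∧ s'.reg rSP = s.reg rSP + l.length ∧
        (∀ i < s.reg rSP, s'.arr aWS i = s.arr aWS i) ∧
        ∀ (i : ℕ) (h : i < l.length), s'.arr aWS (s.reg rSP + i) = l[i]) :
    Produces (evP op) D H [p + 2] (n + 1) X := by
  intro s V c w v h1 h2 h3 h4 h5 h6 h7
  have hw : s.reg rSP = w + 1 := h3
  refine .head (n₁ := 1) (by omega) (add_comm _ _) le_rfl (wp_item h1 hw (h4 0 (by simp)) ?_)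
  intro s1 hst1 ht1 hsp1 hp1 hl1 hvp1 hfp1 harr1
  rw [h2] at hl1
  rw [h2, hq]
  refine (hwp s1 (by rw [harr1, h2]) hp1 hl1).mono ?_
  rintro s2 k2 f2 ⟨hk2, hsp2, hws2, hl2⟩ k' hk'
  obtain ⟨g1, g2, g3, g4, g5, g6, g7⟩ := hf
  have hst2 : Step s1 V c s2 V c := .of_frame hst1.heap f2 g1 (.frame f2 g2)
  have hT2 : s2.reg rT = s.reg rT + 16 := (f2.reg _ g3).trans ht1
  have hfp2 : s2.reg rFP = s.reg rFP := (f2.reg _ g1.1.1).trans hfp1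
  rw [hsp1] at hsp2 hws2 hl2
  refine ⟨by omega, hst1.trans hst2, hT2, hfp2, fun i hi => ?_, fun i _ => ?_, fun i _ => ?_, ?_⟩
  · rw [hws2 i hi, harr1]
  · rw [f2.arr _ g6, harr1]
  · rw [f2.arr _ g7, harr1]
  · exact h s2 V c w v hst2.heap (by rw [f2.arr _ g5, harr1, h2]) hsp2 hl2
      ((f2.reg _ g4).trans (hvp1.trans h5)) (by omega) (by omega)

theorem Produces.const {op : RAMProg} {D : ℕ} {H : ℕ → ℕ} {p : ℕ} (hp : H p < 2) (hD : 1 ≤ D) :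
    Produces (evP op) D H [p + 2] 1 (if H p = 0 then .norm ∅ else .top) := by
  intro s V c w v h1 h2 h3 h4 h5 h6 h7
  have hw : s.reg rSP = w + 1 := h3
  refine .of_wp (by omega) (wp_item h1 hw (h4 0 (by simp)) ?_)
  intro s1 hst1 ht1 hsp1 hp1 hl1 hvp1 hfp1 harr1
  rw [h2] at hl1
  rw [h2, branchP, if_pos hp]
  refine (wp_pushP (rv := 0) fun _ _ => rfl).mono ?_
  rintro s2 k2 f2 ⟨rfl, hvp2, hvs2, hvr2⟩ k' hk'
  have hst2 : Step s1 V c s2 V c := .of_frame hst1.heap f2 (by simp [pushP, RAMProg.block,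
    RAMProg.regs, RAMProg.arrs]) (.frame f2 (by simp [pushP, RAMProg.block, RAMProg.regs,
    RAMProg.arrs]))
  have hT2 : s2.reg rT = s.reg rT + 16 := (f2.reg _ (by decide)).trans ht1
  have hfp2 : s2.reg rFP = s.reg rFP := (f2.reg _ (by decide)).trans hfp1
  have hsp2 : s2.reg rSP = w := (f2.reg _ (by decide)).trans hsp1
  have hws2 : s2.arr aWS = s.arr aWS := (f2.arr _ (by decide)).trans (by rw [harr1])
  rw [hvp1, h5] at hvp2 hvs2 hvr2
  rw [harr1] at hvs2 hvr2
  refine ⟨V, c, 0, ⟨hst1.trans hst2, hsp2, hvp2, fun i _ => by rw [hws2], fun i hi => ?_,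
    fun i hi => ?_, ?_, by omega, by omega⟩, ?_⟩
  · rw [hvs2, Function.update_of_ne (by omega)]
  · rw [hvr2, Function.update_of_ne (by omega)]
  · rw [hvs2, hvr2, Function.update_self, Function.update_self, RAMExpr.val_reg, hl1]
    exact .nil _ _ _ (by omega)
  · simp only [RAMExpr.cost] at hk'
    omega

theorem Produces.var {op : RAMProg} {D : ℕ} {H : ℕ → ℕ} {p : ℕ} (hp : H p = 2) (hD : 1 ≤ D) :
    Produces (evP op) D H [p + 2] 1 (FreeB.gen (H (p + 1))) := by
  intro s V c w v h1 h2 h3 h4 h5 h6 h7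
  have hw : s.reg rSP = w + 1 := h3
  refine .of_wp (by omega) (wp_item h1 hw (h4 0 (by simp)) ?_)
  intro s1 hst1 ht1 hsp1 hp1 hl1 hvp1 hfp1 harr1
  rw [h2, branchP, if_neg (by omega), if_pos hp]
  simp only [varP, wp_block_cons, wp_assign]
  have hin1 : s1.arr aIn = H := by rw [harr1, h2]
  obtain ⟨v', hv'⟩ : ∃ v', v' = H (p + 1) := ⟨_, rfl⟩
  have hq1 : RAMExpr.val s1 (.load aVar (.load aIn (.add (.reg rP) (.const 1)))) =
      s1.arr aVar v' := by simp [hin1, hp1, hv']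
  rw [hq1, ← hv']
  have hs1 := Step.setReg hst1.heap (x := rQ) (s1.arr aVar v') (by decide)
  refine wp.mono (Q := fun s2 k => k ≤ 80 ∧ ∃ V' c', Step s1 V c s2 V' c' ∧ s2.reg rQ ∈ V' ∧
    c' (s2.reg rQ) = varC v' ∧ s2.arr aAL (s2.reg rQ) = 0 ∧ s2.reg rFP ≤ s.reg rFP + 2) ?_ ?_
  · rw [wp_ite]
    constructor
    · intro hne
      have hne' : s1.arr aVar v' ≠ 0 := by simpa using hne
      obtain ⟨a1, a2⟩ := hst1.heap.var v' hne'
      rw [wp_skip]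
      refine ⟨by simp, V, c, hs1, by simpa using a1, by simpa using a2, ?_, by simp [hfp1]⟩
      rcases hst1.heap.cases _ a1 with hv | hn
      · simpa using hv.len
      · exact absurd (a2.symm.trans hn.code) (varC_ne_negC _ _)
    · intro he
      have he' : s1.arr aVar v' = 0 := by simpa using he
      refine (wp_newVarP hs1.heap ?_).mono ?_
      · simpa [hin1, hp1, hv'] using he'
      rintro s2 k2 f2 ⟨hk2, hfp2, V', c', hst2, b1, b2, b3⟩
      simp [hin1, hp1, ← hv', hfp1] at hfp2 b2
      refine ⟨by simp; omega, V', c', hs1.trans hst2, b1, b2, b3, by omega⟩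
  rintro s2 k2 f2 ⟨hk2, V', c', hst2, b1, b2, b3, hfp2⟩
  refine (wp_leafP hst2.heap b1).mono ?_
  rintro s3 k3 f3 ⟨hk3, hst3, hrc3, hr3⟩
  refine (wp_pushP (rv := s3.reg rRC) fun _ _ => rfl).mono ?_
  rintro s4 k4 f4 ⟨rfl, hvp4, hvs4, hvr4⟩
  have hst4 : Step s3 V' c' s4 V' c' := .of_frame hst3.heap f4 (by decide) (.frame f4 (by decide))
  have hreg : ∀ x, x ∈ [rT, rSP, rVP] → s3.reg x = s1.reg x := by
    intro x hx
    simp at hx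
    rcases hx with rfl | rfl | rfl <;>
      exact (f3.reg _ (by decide)).trans ((f2.reg _ (by decide)).trans (by simp))
  have harr : ∀ a, a ∈ [aWS, aVS, aVR] → s3.arr a = s.arr a := by
    intro a ha
    rw [← harr1]
    simp at ha
    rcases ha with rfl | rfl | rfl <;>
      exact (f3.arr _ (by decide)).trans ((f2.arr _ (by decide)).trans (by simp))
  have hT4 : s4.reg rT = s.reg rT + 16 :=
    (f4.reg _ (by decide)).trans ((hreg _ (by decide)).trans ht1)
  have hsp4 : s4.reg rSP = w := (f4.reg _ (by decide)).trans ((hreg _ (by decide)).trans hsp1)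
  have hfp4 : s4.reg rFP = s2.reg rFP := (f4.reg _ (by decide)).trans (f3.reg _ (by decide))
  rw [hreg _ (by decide), hvp1, h5] at hvp4 hvs4 hvr4
  rw [harr _ (by decide)] at hvs4 hvr4
  have hcod : codesL c' [s2.reg rQ] = {varC v'} := by rw [codesL_singleton, b2]
  rw [wp_block_nil]
  intro k' hk'
  refine ⟨V', c', 2, ⟨hst1.trans (hst2.trans (hst3.trans hst4)), hsp4, hvp4, fun i _ => ?_,
    fun i hi => ?_, fun i hi => ?_, ⟨[s2.reg rQ], ⟨?_, fun C hC => ?_⟩, ?_, .inl ⟨?_, ?_⟩⟩,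
    by omega, by omega⟩, ?_⟩
  · rw [f4.arr _ (by decide), harr _ (by decide)]
  · rw [hvs4, Function.update_of_ne (by omega)]
  · rw [hvr4, Function.update_of_ne (by omega)]
  · rw [hvr4, Function.update_self]
    exact hr3.mono hst4.rext hst4.hext
  · rw [hcod] at hC
    exact varC_ne_negC _ _ (Finset.singleton_inj.1 hC)
  · rw [(hst3.trans hst4).hext.meas_eq (by simpa using b1)]
    simp [RAMState.meas, b3]
  · rw [hvs4, Function.update_self]; rfl
  · rw [hcod, FreeB.gen]
  · simp only [RAMExpr.cost] at hk'
    omega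

theorem Produces.negNode {op : RAMProg} {D : ℕ} {H : ℕ → ℕ} {p n : ℕ} {X : FreeB}
    (hp : H p = 3) (h : Produces (evP op) D H [H (p + 1) + 2] n X) (hD : 1 ≤ D)
    (hi : aIn ∉ (bodyP (evP op)).arrs) : Produces (evP op) D H [p + 2] (n + 1 + 1) X.compl := by
  refine (h.neg hD hi).expand hD negExpP (by simp [branchP, hp]) (by decide) ?_
  intro s h1 h2 h3
  simp [negExpP, pushItemP, h1, h2]
  refine ⟨fun i hi => ?_, fun i hi => ?_⟩
  · rw [Function.update_of_ne (by omega), Function.update_of_ne (by omega)]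
  · interval_cases i <;> simp

theorem Produces.joinNode {D : ℕ} {H : ℕ → ℕ} {p n n' : ℕ} {X X' : FreeB}
    (hp : H p = 4) (h : Produces (evP binExpP) D H [H (p + 1) + 2] n X)
    (h' : Produces (evP binExpP) D H [H (p + 2) + 2] n' X') (hD : 1 ≤ D) :
    Produces (evP binExpP) D H [p + 2] (n + (n' + 1) + 1) (X.join X') := by
  refine (h.join h' hD (by decide)).expand hD binExpP (by simp [branchP, hp]) (by decide) ?_
  intro s h1 h2 h3
  simp [binExpP, pushItemP, h1, h2, h3, hp]
  refine ⟨fun i hi => ?_, fun i hi => ?_⟩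
  · rw [Function.update_of_ne (by omega), Function.update_of_ne (by omega),
      Function.update_of_ne (by omega)]
  · interval_cases i <;> simp [add_assoc]

theorem Produces.meetNode {D : ℕ} {H : ℕ → ℕ} {p n n' : ℕ} {X X' : FreeB}
    (hp : H p = 5) (h : Produces (evP binExpP) D H [H (p + 1) + 2] n X)
    (h' : Produces (evP binExpP) D H [H (p + 2) + 2] n' X') (hD : 1 ≤ D) :
    Produces (evP binExpP) D H [p + 2] (n + 1 + (n' + 1 + 1) + 1 + 1)
      (X.compl.join X'.compl).compl := by
  refine (((h.neg hD (by decide)).join (h'.neg hD (by decide)) hD (by decide)).neg hD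
    (by decide)).expand hD binExpP (by simp [branchP, hp]) (by decide) ?_
  intro s h1 h2 h3
  simp [binExpP, pushItemP, h1, h2, h3, hp]
  refine ⟨fun i hi => ?_, fun i hi => ?_⟩
  · rw [Function.update_of_ne (by omega), Function.update_of_ne (by omega),
      Function.update_of_ne (by omega), Function.update_of_ne (by omega),
      Function.update_of_ne (by omega), Function.update_of_ne (by omega)]
  · interval_cases i <;> simp [add_assoc]

/-- The accumulator starts with `0`. For each argument there is an instruction to join and, above
it, the instruction to evaluate, so arguments are added from the last to the first. -/
theorem wp_supExpP (s : RAMState) : wp supExpP s fun s' k =>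
    k ≤ 60 * (s.arr aIn (s.reg rP + 1) + 1) ∧ s'.reg rVP = s.reg rVP + 1 ∧
    s'.arr aVS = Function.update (s.arr aVS) (s.reg rVP) 0 ∧
    s'.arr aVR = Function.update (s.arr aVR) (s.reg rVP) 0 ∧
    s'.reg rSP = s.reg rSP + 2 * s.arr aIn (s.reg rP + 1) ∧
    (∀ i < s.reg rSP, s'.arr aWS i = s.arr aWS i) ∧
    ∀ i < s.arr aIn (s.reg rP + 1), s'.arr aWS (s.reg rSP + 2 * i) = 1 ∧
      s'.arr aWS (s.reg rSP + 2 * i + 1) = s.arr aIn (s.reg rP + 2 + i) + 2 := by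
  simp only [supExpP, wp_block_cons, wp_assign, wp_block_nil]
  refine (wp_pushP (rv := 0) fun _ _ => rfl).mono ?_
  rintro s1 k1 f1 ⟨rfl, hvp1, hvs1, hvr1⟩
  have hin1 : s1.arr aIn = s.arr aIn := f1.arr _ (by decide)
  have hp1 : s1.reg rP = s.reg rP := f1.reg _ (by decide)
  have hsp1 : s1.reg rSP = s.reg rSP := f1.reg _ (by decide)
  have hws1 : s1.arr aWS = s.arr aWS := f1.arr _ (by decide)
  simp only [RAMExpr.val_load, RAMExpr.val_add, RAMExpr.val_const, RAMExpr.val_reg, hin1, hp1]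
  obtain ⟨N, hN⟩ : ∃ N, N = s.arr aIn (s.reg rP + 1) := ⟨_, rfl⟩
  rw [← hN]
  refine (wp_loop (b := 60 * N) (fun b s' => b = 60 * (N - s'.reg rI) ∧ s'.reg rI ≤ N ∧
    s'.reg rSP = s.reg rSP + 2 * s'.reg rI ∧ (∀ i < s.reg rSP, s'.arr aWS i = s.arr aWS i) ∧
    ∀ i < s'.reg rI, s'.arr aWS (s.reg rSP + 2 * i) = 1 ∧
      s'.arr aWS (s.reg rSP + 2 * i + 1) = s.arr aIn (s.reg rP + 2 + i) + 2) ?_ ?_).mono ?_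
  · rintro b s' ⟨rfl, hI, hsp, hws, hit⟩ hf he
    have eN : s'.reg rLen = N := (hf.reg _ (by decide)).trans (by simp)
    have eP : s'.reg rP = s.reg rP := (hf.reg _ (by decide)).trans (by simp [hp1])
    have eIn : s'.arr aIn = s.arr aIn := (hf.arr _ (by decide)).trans (by simp [hin1])
    have hlt : s'.reg rI < N := by simpa [eN] using he
    simp [pushItemP, eP, eIn, hsp]
    refine ⟨⟨hlt, by omega, fun i hi => ?_, fun i hi => ?_⟩, by omega⟩
    · rw [Function.update_of_ne (by omega), Function.update_of_ne (by omega), hws i hi]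
    · by_cases hi' : i = s'.reg rI
      · subst hi'
        exact ⟨by rw [Function.update_of_ne (by omega), Function.update_self],
          by rw [Function.update_self]⟩
      · rw [Function.update_of_ne (by omega), Function.update_of_ne (by omega),
          Function.update_of_ne (by omega), Function.update_of_ne (by omega)]
        exact hit i (by omega)
  · exact ⟨by simp, by simp, by simp [hsp1], by simp [hws1], by simp⟩
  · rintro s2 k2 f2 ⟨b, ⟨rfl, hI, hsp, hws, hit⟩, he, hk⟩
    have eN : s2.reg rLen = N := (f2.reg _ (by decide)).trans (by simp)
    have hge : N ≤ s2.reg rI := by simpa [eN] using he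
    have hIe : s2.reg rI = N := le_antisymm hI hge
    rw [hIe] at hsp hit
    simp at hk
    refine ⟨?_, ?_, ?_, ?_, hsp, hws, hit⟩
    · simp
      omega
    · rw [f2.reg _ (by decide)]
      simp [hvp1]
    · rw [f2.arr _ (by decide)]
      simpa using hvs1
    · rw [f2.arr _ (by decide)]
      simpa using hvr1

theorem JTerm.length_le_sizeList (l : List JTerm) : l.length ≤ JTerm.sizeList l := by
  induction l with
  | nil => simp
  | cons t l ih =>
    have := t.size_pos
    simp only [List.length_cons, JTerm.sizeList]
    omega

/-- Joining the values of the first `i` terms of a list to the top value. -/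
theorem Reach.joinList {D : ℕ} {H : ℕ → ℕ} {p : ℕ} {l : List JTerm} (hD : 1 ≤ D)
    (ih : ∀ (i : ℕ) (h : i < l.length), ∃ n, n + 2 = 5 * l[i].size ∧
      Produces (evP supExpP) D H [H (p + 2 + i) + 2] n (l[i].eval FreeB.gen))
    {i : ℕ} (hi : i ≤ l.length) :
    ∀ {s : RAMState} {V : Set ℕ} {c : ℕ → ℕ} {w v m n : ℕ} {X : FreeB}, Heap s V c →
      s.arr aIn = H → s.reg rSP = w + 2 * i →
      (∀ j < i, s.arr aWS (w + 2 * j) = 1 ∧ s.arr aWS (w + 2 * j + 1) = H (p + 2 + j) + 2) →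
      s.reg rVP = v + 1 → IsVal s V c (s.arr aVS v) (s.arr aVR v) X m →
      s.reg rFP + m ≤ s.reg rT → s.reg rT + 16 * n ≤ 2 ^ D →
      n + i = 5 * JTerm.sizeList (l.take i) →
      Reach (evP supExpP) D s V c w v m n
        (OCBSL.join (JTerm.evalList FreeB.gen (l.take i)) X) := by
  induction i with
  | zero =>
    intro s V c w v m n X h h1 h2 h3 h4 h5 h6 h7 h8
    refine ⟨s, V, c, m, 0, .refl s, ⟨.refl h, h2, h4, fun _ _ => rfl, fun _ _ => rfl,
      fun _ _ => rfl, ?_, le_rfl, by omega⟩, by omega⟩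
    simpa [JTerm.evalList, OCBSL.bot_join] using h5
  | succ i IH =>
    intro s V c w v m n X h h1 h2 h3 h4 h5 h6 h7 h8
    obtain ⟨n₁, hn₁, hP⟩ := ih i hi
    have htake : l.take (i + 1) = l.take i ++ [l[i]] := by simp
    rw [htake, JTerm.sizeList_append] at h8
    simp only [JTerm.sizeList] at h8
    have hle := JTerm.length_le_sizeList (l.take i)
    rw [List.length_take, min_eq_left (by omega)] at hle
    obtain ⟨n₂, hn₂⟩ : ∃ n₂, n₂ + i = 5 * JTerm.sizeList (l.take i) :=
      ⟨5 * JTerm.sizeList (l.take i) - i, by omega⟩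
    obtain ⟨hj1, hj2⟩ := h3 i (by omega)
    refine (hP s V c (w + 2 * i + 1) (v + 1) h h1 (by rw [h2]; simp; omega) ?_ h4 (by omega)
      (by omega)).bind (m₂ := m) (n₂ := 1 + n₂) (by omega) (by omega) (by omega) (by omega)
      (by decide) ?_
    · intro j hj
      obtain rfl : j = 0 := by simpa using hj
      exact hj2
    intro s1 V1 c1 m1 t1 e1
    have a1 := t1.fp
    have a2 := t1.t
    have hX1 : IsVal s1 V1 c1 (s1.arr aVS v) (s1.arr aVR v) X m := by
      rw [t1.vs v (by omega), t1.vr v (by omega)]; exact h5.step t1.step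
    rw [add_comm m1]
    refine (Reach.joinOp t1.step.heap hD t1.sp ((t1.ws _ (by omega)).trans hj1) t1.vp hX1 t1.val
      (by omega) (by omega)).bind (m₂ := 0) (by omega) le_rfl rfl rfl (by decide) ?_
    intro s2 V2 c2 m2 t2 e2
    have a3 := t2.fp
    have a4 := t2.t
    have hev : OCBSL.join (JTerm.evalList FreeB.gen (l.take (i + 1))) X =
        OCBSL.join (JTerm.evalList FreeB.gen (l.take i)) (OCBSL.join X (l[i].eval FreeB.gen)) := by
      rw [htake, JTerm.evalList_append]
      simp only [JTerm.evalList, OCBSL.join_bot]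
      rw [OCBSL.join_comm X, OCBSL.join_assoc]
    rw [hev]
    refine IH (by omega) t2.step.heap (e2.trans (e1.trans h1)) t2.sp (fun j hj => ?_) t2.vp t2.val
      (by omega) (by omega) hn₂
    rw [t2.ws _ (by omega), t1.ws _ (by omega), t2.ws _ (by omega), t1.ws _ (by omega)]
    exact h3 j (by omega)

/-- The arity is unbounded here, so the expansion is not a constant-time step and is charged to the
arguments. -/
theorem Produces.supNode {D : ℕ} {H : ℕ → ℕ} {p n : ℕ} {l : List JTerm} (hD : 1 ≤ D)
    (hp : H p = 4) (hl : H (p + 1) = l.length)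
    (ih : ∀ (i : ℕ) (h : i < l.length), ∃ n, n + 2 = 5 * l[i].size ∧
      Produces (evP supExpP) D H [H (p + 2 + i) + 2] n (l[i].eval FreeB.gen))
    (hn : n = 5 * JTerm.sizeList l + 1) :
    Produces (evP supExpP) D H [p + 2] n (JTerm.evalList FreeB.gen l) := by
  intro s V c w v h1 h2 h3 h4 h5 h6 h7
  have hw : s.reg rSP = w + 1 := h3
  have hle := JTerm.length_le_sizeList l
  obtain ⟨n₂, hn₂⟩ : ∃ n₂, n₂ + l.length = 5 * JTerm.sizeList l :=
    ⟨5 * JTerm.sizeList l - l.length, by omega⟩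
  -- Evaluating and joining an argument takes one unit less than five times its size; the unit left
  -- over pays for pushing its two items.
  refine .head (n₁ := 1 + l.length) (n₂ := n₂) (by omega) (by omega) (by omega)
    (wp_item h1 hw (h4 0 (by simp)) ?_)
  intro s1 hst1 ht1 hsp1 hp1 hl1 hvp1 hfp1 harr1
  rw [h2] at hl1
  have hb : branchP supExpP (s.arr aIn p) = supExpP := by rw [h2]; simp [branchP, hp]
  rw [hb]
  refine (wp_supExpP s1).mono ?_
  rintro s2 k2 f2 ⟨hk2, hvp2, hvs2, hvr2, hsp2, hws2, hit2⟩ k' hk'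
  have hst2 : Step s1 V c s2 V c := .of_frame hst1.heap f2 (by decide) (.frame f2 (by decide))
  have hT2 : s2.reg rT = s.reg rT + 16 := (f2.reg _ (by decide)).trans ht1
  have hfp2 : s2.reg rFP = s.reg rFP := (f2.reg _ (by decide)).trans hfp1
  rw [harr1, h2, hp1, hl] at hk2 hsp2 hit2
  rw [hsp1] at hsp2 hws2 hit2
  rw [hvp1, h5] at hvp2 hvs2 hvr2
  rw [harr1] at hvs2 hvr2 hws2
  have hk3 : 16000 * D * (1 + l.length) = 16000 * (D * (1 + l.length)) := mul_assoc _ _ _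
  have hk4 : 1 + l.length ≤ D * (1 + l.length) := Nat.le_mul_of_pos_left _ hD
  refine ⟨by omega, hst1.trans hst2, hT2, hfp2, hws2, fun i hi => ?_, fun i hi => ?_, ?_⟩
  · rw [hvs2, Function.update_of_ne (by omega)]
  · rw [hvr2, Function.update_of_ne (by omega)]
  · have := Reach.joinList hD ih le_rfl (X := .norm ∅) (m := 0) (n := n₂) hst2.heap
      (by rw [f2.arr _ (by decide), harr1, h2]) hsp2 hit2 hvp2
      (by rw [hvs2, hvr2, Function.update_self, Function.update_self]
          exact .nil _ _ _ (.inl rfl)) (by omega) (by omega) (by rw [List.take_length, hn₂])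
    rw [List.take_length] at this
    have hb : OCBSL.join (JTerm.evalList FreeB.gen l) (.norm ∅) = JTerm.evalList FreeB.gen l :=
      FreeB.join_bot _
    rwa [hb] at this

/-- The evaluation of a term over `(⨆, ¬, 0, 1)`. -/
theorem StoredJ.produces {D : ℕ} {H : ℕ → ℕ} {p : ℕ} {t : JTerm} (hD : 1 ≤ D)
    (h : StoredJ H p t) : ∃ n, n + 2 = 5 * t.size ∧
      Produces (evP supExpP) D H [p + 2] n (t.eval FreeB.gen) := by
  induction h with
  | @zero p hp =>
    have := Produces.const (op := supExpP) (H := H) (p := p) (by omega) hD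
    rw [if_pos hp] at this
    exact ⟨3, rfl, this.mono (by omega)⟩
  | @one p hp =>
    have := Produces.const (op := supExpP) (H := H) (p := p) (by omega) hD
    rw [if_neg (by omega)] at this
    exact ⟨3, rfl, this.mono (by omega)⟩
  | @var p hp => exact ⟨3, rfl, (Produces.var hp hD).mono (by omega)⟩
  | @neg p t hp _ ih =>
    obtain ⟨n, hn, h⟩ := ih
    refine ⟨n + 5, by simp only [JTerm.size]; omega, ?_⟩
    exact (h.negNode hp hD (by decide)).mono (by omega)
  | @sup p l hp hl _ ih =>
    refine ⟨5 * JTerm.sizeList l + 3, by simp only [JTerm.size]; omega, ?_⟩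
    exact (Produces.supNode hD hp hl ih rfl).mono (by omega)

/-- The evaluation of a term over `(∧, ⊔, ¬, 0, 1)`. -/
theorem StoredB.produces {D : ℕ} {H : ℕ → ℕ} {p : ℕ} {t : BTerm} (hD : 1 ≤ D)
    (h : StoredB H p t) : ∃ n, n + 2 = 5 * t.size ∧
      Produces (evP binExpP) D H [p + 2] n (t.eval FreeB.gen) := by
  induction h with
  | @zero p hp =>
    have := Produces.const (op := binExpP) (H := H) (p := p) (by omega) hD
    rw [if_pos hp] at this
    exact ⟨3, rfl, this.mono (by omega)⟩
  | @one p hp =>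
    have := Produces.const (op := binExpP) (H := H) (p := p) (by omega) hD
    rw [if_neg (by omega)] at this
    exact ⟨3, rfl, this.mono (by omega)⟩
  | @var p hp => exact ⟨3, rfl, (Produces.var hp hD).mono (by omega)⟩
  | @neg p t hp _ ih =>
    obtain ⟨n, hn, h⟩ := ih
    refine ⟨n + 5, by simp only [BTerm.size]; omega, ?_⟩
    exact (h.negNode hp hD (by decide)).mono (by omega)
  | @join p s t hp _ _ ih ih' =>
    obtain ⟨n, hn, h⟩ := ih
    obtain ⟨n', hn', h'⟩ := ih'
    refine ⟨n + n' + 7, by simp only [BTerm.size]; omega, ?_⟩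
    exact (h.joinNode hp h' hD).mono (by omega)
  | @meet p s t hp _ _ ih ih' =>
    obtain ⟨n, hn, h⟩ := ih
    obtain ⟨n', hn', h'⟩ := ih'
    refine ⟨n + n' + 7, by simp only [BTerm.size]; omega, ?_⟩
    exact (h.meetNode hp h' hD).mono (by omega)

/-! ### Terms in the output -/

theorem NegAt.card_codes {s : RAMState} {V : Set ℕ} {c : ℕ → ℕ} {q : ℕ} (h : Heap s V c)
    (hq : NegAt s V c q) : (s.codes c q).card = s.arr aAL q := by
  rw [RAMState.codes, Finset.card_image_of_injOn, Finset.card_range]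
  intro i hi j hj e
  have hi' := Finset.mem_range.1 (Finset.mem_coe.1 hi)
  have hj' := Finset.mem_range.1 (Finset.mem_coe.1 hj)
  exact hq.nodup i hi' j hj' (h.inj _ (hq.mem i hi').1 _ (hq.mem j hj').1 e)

theorem NegAt.codes_nonempty {s : RAMState} {V : Set ℕ} {c : ℕ → ℕ} {q : ℕ}
    (hq : NegAt s V c q) : (s.codes c q).Nonempty :=
  ⟨_, RAMState.mem_codes.2 ⟨0, hq.len, rfl⟩⟩

theorem Heap.good_atom {s : RAMState} {V : Set ℕ} {c : ℕ → ℕ} (h : Heap s V c) {x : ℕ}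
    (hx : x ∈ V) : Good {c x} := by
  rcases h.cases x hx with hv | hn
  · rw [hv.code]; exact good_var _
  · rw [hn.code]; exact good_neg hn.good hn.codes_nonempty hn.ne_neg

/-- The join whose complement is stored at `q`, provided that its arguments are stored. -/
theorem NegAt.exists_stored {s : RAMState} {V : Set ℕ} {c : ℕ → ℕ} {q : ℕ} (h : Heap s V c)
    (hq : NegAt s V c q)
    (ih : ∀ y ∈ V, y < q → ∃ u, StoredJ (s.arr aOut) y u ∧ Nice u ∧ u.Atomic ∧ u.asSet = {c y}) :
    ∃ u, StoredJ (s.arr aOut) (s.arr aOut (q + 1)) u ∧ Nice u ∧ Nice (.neg u) ∧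
      u.asSet = s.codes c q := by
  have hc : ∀ j < s.arr aAL q, c (s.arr aOut (q + 4 + j)) ∈ s.codes c q := fun j hj =>
    RAMState.mem_codes.2 ⟨j, hj, rfl⟩
  have hch : ∀ j : Fin (s.arr aAL q), ∃ u, StoredJ (s.arr aOut) (s.arr aOut (q + 4 + j)) u ∧
      Nice u ∧ u.Atomic ∧ u.asSet = {c (s.arr aOut (q + 4 + j))} := fun j =>
    ih _ (hq.mem j j.2).1 (hq.mem j j.2).2
  choose f hf using hch
  by_cases h1 : s.arr aAL q = 1
  · obtain ⟨g1, g2, g3, g4⟩ := hf ⟨0, by omega⟩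
    simp only [add_zero] at g1 g4
    have hcod : s.codes c q = {c (s.arr aOut (q + 4))} := by
      ext a
      rw [RAMState.mem_codes, h1, Finset.mem_singleton]
      constructor
      · rintro ⟨j, hj, rfl⟩
        rw [show j = 0 by omega]
      · rintro rfl
        exact ⟨0, by omega, rfl⟩
    refine ⟨f ⟨0, by omega⟩, by rw [hq.one h1]; exact g1, g2, ?_, by rw [g4, hcod]⟩
    cases hu : f ⟨0, by omega⟩ with
    | var v => exact .negvar v
    | neg u =>
      rw [hu] at g4
      exact absurd (hcod.trans g4.symm) (hq.ne_neg _)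
    | _ => rw [hu] at g3; cases g3
  · obtain ⟨e1, e2, e3⟩ := hq.many h1
    have hlen := hq.len
    have hset : JTerm.asSetList (List.ofFn f) = s.codes c q := by
      ext a
      rw [JTerm.mem_asSetList, RAMState.mem_codes]
      constructor
      · rintro ⟨t, ht, ha⟩
        obtain ⟨j, rfl⟩ := (List.mem_ofFn' f t).1 ht
        rw [(hf j).2.2.2, Finset.mem_singleton] at ha
        exact ⟨j, j.2, ha.symm⟩
      · rintro ⟨j, hj, rfl⟩
        refine ⟨f ⟨j, hj⟩, (List.mem_ofFn' f _).2 ⟨_, rfl⟩, ?_⟩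
        rw [(hf ⟨j, hj⟩).2.2.2]
        exact Finset.mem_singleton_self _
    have hnice : Nice (.sup (List.ofFn f)) := by
      refine .sup ?_ ?_ ?_ ?_ ?_
      · rw [List.length_ofFn]; omega
      · intro t ht
        obtain ⟨j, rfl⟩ := (List.mem_ofFn' f t).1 ht
        exact (hf j).2.1
      · intro t ht
        obtain ⟨j, rfl⟩ := (List.mem_ofFn' f t).1 ht
        exact (hf j).2.2.1
      · rw [List.map_ofFn]
        refine List.nodup_ofFn.2 fun i j e => ?_
        simp only [Function.comp_apply, (hf _).2.2.2] at e
        exact Fin.ext (hq.nodup i i.2 j j.2 (h.inj _ (hq.mem i i.2).1 _ (hq.mem j j.2).1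
          (Finset.singleton_inj.1 e)))
      · rw [hset]; exact hq.good
    refine ⟨.sup (List.ofFn f), ?_, hnice, .negsup hnice, hset⟩
    rw [e1]
    refine .sup e2 (by rw [List.length_ofFn, ← e3]) fun i hi => ?_
    rw [List.length_ofFn] at hi
    rw [List.getElem_ofFn]
    exact (hf ⟨i, hi⟩).1

/-- The arguments of an atom have smaller addresses, so the stored graph is acyclic and unfolds by
strong induction on the address. -/
theorem Heap.exists_stored {s : RAMState} {V : Set ℕ} {c : ℕ → ℕ} (h : Heap s V c) {x : ℕ}
    (hx : x ∈ V) : ∃ u, StoredJ (s.arr aOut) x u ∧ Nice u ∧ u.Atomic ∧ u.asSet = {c x} := by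
  induction x using Nat.strong_induction_on with
  | _ x ih =>
    rcases h.cases x hx with hv | hn
    · exact ⟨_, .var hv.lab, .var _, .var _, by rw [hv.code]; rfl⟩
    · obtain ⟨u, h1, h2, h3, h4⟩ := hn.exists_stored h fun y hy hlt => ih y hlt hy
      exact ⟨.neg u, .neg hn.lab h1, h3, .neg u, by rw [hn.code, ← h4]; rfl⟩

-- Addresses of normal forms

/-- The address `a` of a nonconstant term or of `0`, with its set of codes. -/
inductive SetAddr (s : RAMState) (V : Set ℕ) (c : ℕ → ℕ) : ℕ → Finset ℕ → Prop
  | zero : SetAddr s V c 0 ∅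
  | atom {x : ℕ} : x ∈ V → SetAddr s V c x {c x}
  | sup {q : ℕ} : q ∈ V → NegAt s V c q → s.arr aAL q ≠ 1 → SetAddr s V c (q + 2) (s.codes c q)

/-- The normal form of the element `X` is at the address `a`. -/
def IsAddr (s : RAMState) (V : Set ℕ) (c : ℕ → ℕ) (a : ℕ) (X : FreeB) : Prop :=
  a = 1 ∧ X = .top ∨ ∃ A, Good A ∧ X = .norm A ∧ SetAddr s V c a A

theorem IsAddr.step {s s' : RAMState} {V V' : Set ℕ} {c c' : ℕ → ℕ} {a : ℕ} {X : FreeB}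
    (h : IsAddr s V c a X) (hs : Step s V c s' V' c') : IsAddr s' V' c' a X := by
  rcases h with h | ⟨A, hA, hX, h⟩
  · exact .inl h
  · refine .inr ⟨A, hA, hX, ?_⟩
    cases h with
    | zero => exact .zero
    | atom hx => rw [← hs.hext.code _ hx]; exact .atom (hs.hext.sub hx)
    | @sup q hq hn hl =>
      have hc := hs.hext.code q hq
      rcases hs.heap.cases q (hs.hext.sub hq) with hv | hn'
      · exact absurd (hv.code.symm.trans (hc.trans hn.code)) (varC_ne_negC _ _)
      · rw [negC_inj (hn.code.symm.trans (hc.symm.trans hn'.code))]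
        exact .sup (hs.hext.sub hq) hn' (by rwa [hs.hext.len q hq])

theorem IsAddr.exists_stored {s : RAMState} {V : Set ℕ} {c : ℕ → ℕ} {a : ℕ} {X : FreeB}
    (hs : Heap s V c) (h : IsAddr s V c a X) :
    ∃ u, StoredJ (s.arr aOut) a u ∧ Nice u ∧ u.eval FreeB.gen = X := by
  rcases h with ⟨rfl, rfl⟩ | ⟨A, hA, rfl, h⟩
  · exact ⟨.one, .one hs.out1, .one, rfl⟩
  · cases h with
    | zero => exact ⟨.zero, .zero hs.out0, .zero, rfl⟩
    | atom hx =>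
      obtain ⟨u, h1, h2, h3, h4⟩ := hs.exists_stored hx
      exact ⟨u, h1, h2, by rw [← h4]; exact h2.eval_eq (by rintro rfl; cases h3)⟩
    | @sup q hq hn hl =>
      obtain ⟨u, h1, h2, h3, h4⟩ := hn.exists_stored hs fun y hy _ => hs.exists_stored hy
      rw [(hn.many hl).1] at h1
      exact ⟨u, h1, h2, by rw [← h4]; exact h2.eval_eq (by rintro rfl; cases h3)⟩

theorem StoredJ.unique {H : ℕ → ℕ} {a : ℕ} {t u : JTerm} (h : StoredJ H a t)
    (h' : StoredJ H a u) : t = u := by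
  induction h generalizing u with
  | zero h1 => cases h' <;> first | rfl | omega
  | one h1 => cases h' <;> first | rfl | omega
  | var h1 => cases h' <;> first | rfl | omega
  | neg h1 h2 ih =>
    cases h' with
    | neg _ h3 => rw [ih h3]
    | _ => omega
  | sup h1 h2 h3 ih =>
    cases h' with
    | sup g1 g2 g3 =>
      congr 1
      refine List.ext_getElem (h2.symm.trans g2) fun i hi hi' => ih i hi (g3 i hi')
    | _ => omega

/-- An address unfolds to one term only. Conversely, `0`, atoms and joins are told apart by the
cardinality of their sets, and atoms, hence also the complements that contain the joins, are
determined by their codes. So the word problem ends with a comparison of two numbers. -/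
theorem IsAddr.eq_iff {s : RAMState} {V : Set ℕ} {c : ℕ → ℕ} {a a' : ℕ} {X X' : FreeB}
    (hs : Heap s V c) (h : IsAddr s V c a X) (h' : IsAddr s V c a' X') : a = a' ↔ X = X' := by
  constructor
  · rintro rfl
    obtain ⟨u, h1, -, rfl⟩ := h.exists_stored hs
    obtain ⟨u', h1', -, rfl⟩ := h'.exists_stored hs
    rw [h1.unique h1']
  · intro e
    rcases h with ⟨rfl, rfl⟩ | ⟨A, hA, rfl, h⟩ <;> rcases h' with ⟨rfl, rfl⟩ | ⟨A', hA', rfl, h'⟩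
    · rfl
    · exact absurd hA' (FreeB.norm_eq_top.1 e.symm)
    · exact absurd hA (FreeB.norm_eq_top.1 e)
    · obtain rfl := FreeB.norm_inj hA e
      have hcard : ∀ q, NegAt s V c q → s.arr aAL q ≠ 1 → 2 ≤ (s.codes c q).card := by
        intro q hq hl
        have := hq.len
        rw [hq.card_codes hs]
        omega
      generalize hB : A = B at h'
      have hcB := congrArg Finset.card hB
      cases h with
      | zero =>
        cases h' with
        | zero => rfl
        | atom => simp at hcB
        | sup _ hq hl => have := hcard _ hq hl; simp only [Finset.card_empty] at hcB; omega
      | atom hx =>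
        cases h' with
        | zero => simp at hcB
        | atom hy => exact hs.inj _ hx _ hy (Finset.singleton_inj.1 hB)
        | sup _ hq hl => have := hcard _ hq hl; simp only [Finset.card_singleton] at hcB; omega
      | @sup q hV hq hl =>
        have := hcard _ hq hl
        cases h' with
        | zero => simp only [Finset.card_empty] at hcB; omega
        | atom => simp only [Finset.card_singleton] at hcB; omega
        | @sup q' hV' hq' hl' =>
          rw [hs.inj q hV q' hV' (by rw [hq.code, hq'.code, hB])]

section
open RAMExpr RAMProg

/-- Pop the top value and compute the address of its normal form in `rItem`. -/
def addrP : RAMProg := block [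
  assign rVP (sub (reg rVP) (const 1)),
  assign rGa (load aVS (reg rVP)),
  assign rIn (load aVR (reg rVP)),
  ite (reg rIn)
    (block [
      sealP,
      ite (reg rQ)
        (ite (reg rGa) (assign rItem (reg rQ))
          -- The sealed atom is the complement; the pointer in its second cell leads to the join
          -- itself.
          (assign rItem (load aOut (add (reg rQ) (const 1)))))
        -- The join is `1`; the constants `0` and `1` have the addresses `0` and `1`.
        (assign rItem (sub (const 1) (reg rGa)))])
    (assign rItem (reg rGa))]

end

/-- A nonempty list is sealed whatever its sign, because sealing detects inconsistency and writes
both the join and its complement. The cost is covered by the remaining measure `m`. -/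
theorem wp_addrP {s : RAMState} {V : Set ℕ} {c : ℕ → ℕ} (h : Heap s V c) {v m : ℕ} {X : FreeB}
    (hv : s.reg rVP = v + 1) (hX : IsVal s V c (s.arr aVS v) (s.arr aVR v) X m) {D : ℕ}
    (hD : 1 ≤ D) (hfp : s.reg rFP ≤ 2 ^ D) :
    wp addrP s fun s' k => ∃ V' c', Step s V c s' V' c' ∧ IsAddr s' V' c' (s'.reg rItem) X ∧
      k ≤ 800 * D * m + 60 ∧ 2 * s'.reg rFP ≤ 2 * s.reg rFP + 8 + m ∧ s'.reg rVP = v := by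
  obtain ⟨L, hL, rfl, hXL⟩ := hX
  have hg1 : s.arr aVS v ≤ 1 := by omega
  simp only [addrP]
  rw [wp_block_cons]
  refine wp.mono (p := .assign rVP _) (Q := fun s' k => k ≤ 10 ∧ s'.reg rVP = v) ?_ ?_
  · simp [hv]
  rintro s1 k1 f1 ⟨hk1, hvp1⟩
  rw [wp_block_cons]
  refine wp.mono (p := .assign rGa _) (Q := fun s' k => k ≤ 10 ∧ s'.reg rGa = s1.arr aVS v) ?_ ?_
  · simp [hvp1]
  rintro s2 k2 f2 ⟨hk2, hga2⟩
  rw [wp_block_cons]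
  refine wp.mono (p := .assign rIn _) (Q := fun s' k => k ≤ 10 ∧ s'.reg rIn = s2.arr aVR v) ?_ ?_
  · simp [(f2.reg rVP (by decide)).trans hvp1]
  rintro s3 k3 f3 ⟨hk3, hin3⟩
  have hst : Step s V c s3 V c := (Step.of_frame h f1 (by decide) (.frame f1 (by decide))).trans
    ((Step.of_frame (h.frame f1 (by decide) (Trie.congr_frame f1 (by decide) ▸ h.wf)
      (Trie.congr_frame f1 (by decide) ▸ .refl _)) f2 (by decide) (.frame f2 (by decide))).trans
    (.of_frame (h.frame f1 (by decide) (Trie.congr_frame f1 (by decide) ▸ h.wf)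
      (Trie.congr_frame f1 (by decide) ▸ .refl _) |>.frame f2 (by decide)
      (Trie.congr_frame f2 (by decide) ▸ Trie.congr_frame f1 (by decide) ▸ h.wf)
      (Trie.congr_frame f2 (by decide) ▸ .refl _)) f3 (by decide) (.frame f3 (by decide))))
  have hfp3 : s3.reg rFP = s.reg rFP :=
    (f3.reg _ (by decide)).trans ((f2.reg _ (by decide)).trans (f1.reg _ (by decide)))
  have hga3 : s3.reg rGa = s.arr aVS v := by
    rw [f3.reg _ (by decide), hga2, f1.arr _ (by decide)]
  have hin3' : s3.reg rIn = s.arr aVR v := by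
    rw [hin3, f2.arr _ (by decide), f1.arr _ (by decide)]
  have hvp3 : s3.reg rVP = v :=
    (f3.reg _ (by decide)).trans ((f2.reg _ (by decide)).trans hvp1)
  have hL3 := hL.step hst
  have hm3 := hst.hext.meas_eq hL.rope.mem
  simp only [wp_ite, wp_block_cons, wp_block_nil, wp_assign]
  constructor
  · intro hr
    have hr' : s3.reg rIn ≠ 0 := hr
    refine (wp_sealP hst.heap hr' (by rw [hin3']; exact hL3.rope) hL.ne_neg hD (by omega)).mono ?_
    rintro s4 k4 f4 ⟨V', c', H4, E4, hk4, hfp4, hfp4', hbad, hgood⟩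
    rw [hm3] at hk4 hfp4' hgood
    have hst4 : Step s3 V c s4 V' c' := ⟨H4, E4, .frame f4 (by decide)⟩
    have hvp4 : s4.reg rVP = v := (f4.reg _ (by decide)).trans hvp3
    have hga4 : s4.reg rGa = s.arr aVS v := (f4.reg _ (by decide)).trans hga3
    have hset : ∀ x, Step s V c (s4.setReg rItem x) V' c' := fun x =>
      hst.trans (hst4.trans (.setReg H4 x (by decide)))
    have hfin : ∀ x, IsAddr s4 V' c' x X → IsAddr (s4.setReg rItem x) V' c' x X := fun x hx =>
      hx.step (.setReg H4 x (by decide))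
    refine ⟨fun hq => ⟨fun hg => ?_, fun hg => ?_⟩, fun hq => ?_⟩
    · have hG : Good (codesL c L) := by
        by_contra hG
        exact hq (hbad hG)
      obtain ⟨a1, a2, a3⟩ := hgood hG
      have hg' : s.arr aVS v ≠ 0 := by rw [← hga4]; exact hg
      obtain ⟨-, rfl⟩ := hXL.resolve_left fun H => hg' H.1
      refine ⟨V', c', hset _, ?_, ?_, ?_, by simpa using hvp4⟩
      · have : IsAddr s4 V' c' (s4.reg rQ) (.compl (.norm (codesL c L))) := by
          rw [FreeB.compl_norm hG (hL.codesL_nonempty (by rwa [← hin3'])) hL.ne_neg, ← a2]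
          exact .inr ⟨_, H4.good_atom a1, rfl, .atom a1⟩
        simpa using hfin _ this
      · simp only [RAMExpr.cost]
        omega
      · simp
        omega
    · have hG : Good (codesL c L) := by
        by_contra hG
        exact hq (hbad hG)
      obtain ⟨a1, a2, a3⟩ := hgood hG
      have hg' : s.arr aVS v = 0 := by rw [← hga4]; exact hg
      obtain ⟨-, rfl⟩ := hXL.resolve_right fun H => by omega
      refine ⟨V', c', hset _, ?_, ?_, ?_, by simpa using hvp4⟩
      · have : IsAddr s4 V' c' (s4.arr aOut (s4.reg rQ + 1)) (.norm (codesL c L)) := by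
          refine .inr ⟨_, hG, rfl, ?_⟩
          rcases H4.cases _ a1 with hv | hn
          · exact absurd (hv.code.symm.trans a2) (varC_ne_negC _ _)
          · have hcod : codesL c L = s4.codes c' (s4.reg rQ) :=
              negC_inj (a2.symm.trans hn.code)
            rw [hcod]
            by_cases h1 : s4.arr aAL (s4.reg rQ) = 1
            · rw [hn.one h1]
              have : s4.codes c' (s4.reg rQ) = {c' (s4.arr aOut (s4.reg rQ + 4))} := by
                rw [RAMState.codes, h1]; simp
              rw [this]
              exact .atom (hn.mem 0 (by omega)).1
            · rw [(hn.many h1).1]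
              exact .sup a1 hn h1
        simpa using hfin _ this
      · simp only [RAMExpr.cost]
        omega
      · simp
        omega
    · have hq' : s4.reg rQ = 0 := hq
      have hG : ¬ Good (codesL c L) := fun hG => by
        have := H4.two_le _ (hgood hG).1
        omega
      refine ⟨V', c', hset _, ?_, ?_, ?_, by simpa using hvp4⟩
      · have : IsAddr s4 V' c' (1 - s4.reg rGa) X := by
          rw [hga4]
          rcases hXL with ⟨e, rfl⟩ | ⟨e, rfl⟩
          · exact .inl ⟨by rw [e], FreeB.norm_bad hG⟩
          · exact .inr ⟨∅, good_empty, by rw [FreeB.norm_bad hG]; rfl, by rw [e]; exact .zero⟩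
        simpa using hfin _ this
      · simp only [RAMExpr.cost]
        omega
      · simp
        omega
  · intro hr
    have hr' : s3.reg rIn = 0 := hr
    have hL0 : L = [] := by
      have := hL.rope
      rw [← hin3', hr'] at this
      exact this.eq_nil
    subst hL0
    refine ⟨V, c, hst.trans (.setReg hst.heap _ (by decide)), ?_, ?_, ?_, by simpa using hvp3⟩
    · have : IsAddr s3 V c (s3.reg rGa) X := by
        rw [hga3]
        rcases hXL with ⟨e, rfl⟩ | ⟨e, rfl⟩
        · exact .inr ⟨∅, good_empty, by simp [codesL], by rw [e]; exact .zero⟩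
        · exact .inl ⟨e, by simp [codesL, FreeB.compl_empty]⟩
      simpa using this.step (.setReg hst.heap (x := rItem) (s3.reg rGa) (by decide))
    · simp only [RAMExpr.cost]
      omega
    · simp
      omega

/-! ### The algorithms -/

section
open RAMExpr RAMProg

/-- Initialize the output array and the credit. -/
def startP : RAMProg := block [
  store aOut (const 1) (const 1),
  assign rFP (const 2),
  assign rT (const 2)]

/-- Normal form of the term over `(⨆, ¬, 0, 1)` at the address in register `0`. -/
def normalFormP : RAMProg := block [
  startP,
  store aWS (const 0) (add (reg 0) (const 2)),
  assign rSP (const 1),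
  loop (reg rSP) (bodyP (evP supExpP)),
  addrP,
  assign 0 (reg rItem)]

/-- Equality of the terms over `(∧, ⊔, ¬, 0, 1)` at the addresses in registers `0` and `1`. -/
def wordProblemP : RAMProg := block [
  startP,
  store aWS (const 0) (add (reg 0) (const 2)),
  store aWS (const 1) (add (reg 1) (const 2)),
  assign rSP (const 2),
  loop (reg rSP) (bodyP (evP binExpP)),
  addrP,
  assign rLab (reg rItem),
  addrP,
  assign 0 (eq (reg rLab) (reg rItem))]

end

theorem wp_startP (H : ℕ → ℕ) (r₀ r₁ : ℕ) : wp startP (RAMState.init H r₀ r₁) fun s k =>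
    k ≤ 20 ∧ Heap s ∅ (fun _ => 0) ∧ s.arr aIn = H ∧ s.reg rFP = 2 ∧ s.reg rT = 2 ∧
    s.reg rVP = 0 ∧ s.reg 0 = r₀ ∧ s.reg 1 = r₁ := by
  have hi : ∀ x, 2 ≤ x → (RAMState.init H r₀ r₁).reg x = 0 := fun x hx => by
    simp only [RAMState.init]
    rw [if_neg (by omega), if_neg (by omega)]
  have ha : ∀ a, 1 ≤ a → (RAMState.init H r₀ r₁).arr a = fun _ => 0 := fun a ha => by
    simp only [RAMState.init]
    simp [show a ≠ 0 by omega]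
  refine wp.mono (Q := fun s k => k ≤ 20 ∧ s.reg rFP = 2 ∧ s.reg rT = 2 ∧
    s.arr aOut = Function.update (fun _ => 0) 1 1) (by simp [startP, ha]) ?_
  rintro s k f ⟨hk, h1, h2, h3⟩
  have fa : ∀ a, 2 ≤ a → s.arr a = fun _ => 0 := fun a h => by
    rw [f.arr a (by simp [startP, RAMProg.block, RAMProg.arrs]; omega), ha a (by omega)]
  refine ⟨hk, ?_, ?_, h1, h2, ?_, ?_, ?_⟩
  · have htc : s.reg rTC = 0 := (f.reg _ (by decide)).trans (hi _ (by decide))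
    have ht : s.trie = ⟨0, fun _ => 0, fun _ => 0, fun _ => 0, fun _ => 0⟩ := by
      simp only [RAMState.trie, htc, fa aFl (by decide), fa aLe (by decide), fa aRi (by decide),
        fa aCo (by decide)]
    refine ⟨h1.ge, by rw [h3]; rfl, by rw [h3]; rfl, ?_, ?_, by simp, by simp, by simp, by simp,
      ?_, by simp, ?_, by simp⟩
    · rw [h1, fa aHalf (by decide)]
      intro i hi
      simp only
      omega
    · rw [ht]
      exact ⟨rfl, rfl, rfl, by simp, by simp; omega, by simp; omega, by simp, by simp; omega,
        by simp⟩
    · rw [fa aVar (by decide)]; simp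
    · rw [fa aAt (by decide)]; simp
  · rw [f.arr _ (by decide)]; rfl
  · rw [f.reg _ (by decide), hi _ (by decide)]
  · rw [f.reg _ (by decide)]; rfl
  · rw [f.reg _ (by decide)]; rfl

/-- The credit starts at `2` and gains `16` for each of fewer than `5 * n` units, so `2 ^ D` with `D
= Nat.log 2 n + 8` bounds all addresses of atoms. -/
theorem Nat.le_two_pow_log (n : ℕ) : 80 * n + 8 ≤ 2 ^ (Nat.log 2 n + 8) := by
  have h := Nat.lt_pow_succ_log_self (b := 2) (by omega) n
  rw [show Nat.log 2 n + 8 = (Nat.log 2 n).succ + 7 by omega, pow_add]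
  omega

/-- The left side is the actual time, `16000 * D` for each of at most `5 * n` units; one logarithm
is to spare. -/
theorem Nat.mul_log_le (n : ℕ) (hn : 1 ≤ n) : 80000 * (Nat.log 2 n + 8) * n + 300 ≤
    700000 * (n * (Nat.log 2 n + 1) ^ 2) := by
  nlinarith [Nat.zero_le (n * Nat.log 2 n), Nat.zero_le (n * Nat.log 2 n ^ 2)]

theorem run_normalFormP {t : JTerm} {H : ℕ → ℕ} {r : ℕ} (ht : t.Proper) (h : StoredJ H r t) :
    wp normalFormP (RAMState.init H r 0) fun s k =>
      k ≤ 700000 * (t.size * (Nat.log 2 t.size + 1) ^ 2) ∧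
      ∃ u, StoredJ (s.arr 1) (s.reg 0) u ∧ IsNormalFormOf u t := by
  have hn1 := t.size_pos
  have hpow := Nat.le_two_pow_log t.size
  have htime := Nat.mul_log_le t.size hn1
  obtain ⟨D, hDe⟩ : ∃ D, D = Nat.log 2 t.size + 8 := ⟨_, rfl⟩
  rw [← hDe] at hpow htime
  have hD : 1 ≤ D := by omega
  obtain ⟨n, hn, hP⟩ := h.produces (D := D) hD
  simp only [normalFormP, wp_block_cons]
  refine (wp_startP H r 0).mono ?_
  rintro s1 k1 - ⟨hk1, h1, in1, fp1, t1, vp1, r1, -⟩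
  refine wp.mono (p := .store aWS _ _) (Q := fun s' k => k ≤ 10 ∧ s'.arr aWS 0 = r + 2) ?_ ?_
  · simp [r1]
  rintro s2 k2 f2 ⟨hk2, ws2⟩
  have st2 : Step s1 ∅ (fun _ => 0) s2 ∅ (fun _ => 0) :=
    .of_frame h1 f2 (by simp [RAMProg.regs, RAMProg.arrs])
      (.frame f2 (by simp [RAMProg.regs, RAMProg.arrs]))
  rw [wp_assign]
  have st3 := st2.trans (.setReg st2.heap (x := rSP) ((RAMExpr.const 1).val s2) (by decide))
  obtain ⟨s4, V, c, m, k4, hI, hT, hk4⟩ := hP _ _ _ 0 0 st3.heap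
    ((f2.arr aIn (by simp [RAMProg.arrs])).trans in1) (by simp) (by
      intro i hi
      obtain rfl : i = 0 := by simpa using hi
      exact ws2) (by simp [f2.reg rVP (by simp [RAMProg.regs]), vp1])
    (by simp [f2.reg rFP (by simp [RAMProg.regs]), f2.reg rT (by simp [RAMProg.regs]), fp1, t1])
    (by simp [f2.reg rT (by simp [RAMProg.regs]), t1]; omega)
  have hfp := hT.fp
  have ht4 := hT.t
  simp [f2.reg rFP (by simp [RAMProg.regs]), f2.reg rT (by simp [RAMProg.regs]), fp1, t1]
    at hfp ht4
  refine ⟨s4, _, hI.run hT.sp, ?_⟩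
  refine (wp_addrP hT.step.heap hT.vp hT.val hD (by omega)).mono ?_
  rintro s5 k5 - ⟨V5, c5, st5, ha, hk5, -⟩
  obtain ⟨u, hu1, hu2, hu3⟩ := ha.exists_stored st5.heap
  simp only [wp_assign, wp_block_nil]
  refine ⟨?_, u, by simpa using hu1, hu2.isNormalFormOf ht hu3.symm⟩
  -- The two units by which `n` falls short of `5 * t.size` cover the start and the constant part of
  -- the end.
  have e1 : 16000 * D * n + 32000 * D = 80000 * D * t.size := by
    have : 16000 * D * (n + 2) = 16000 * D * (5 * t.size) := by rw [hn]
    rw [mul_add] at this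
    rw [show 80000 * D * t.size = 16000 * D * (5 * t.size) by ring]
    omega
  have e2 : 1600 * D * m = 2 * (800 * D * m) := by ring
  simp only [RAMExpr.cost]
  omega

theorem run_wordProblemP {t₁ t₂ : BTerm} {H : ℕ → ℕ} {r₁ r₂ : ℕ} (h₁ : StoredB H r₁ t₁)
    (h₂ : StoredB H r₂ t₂) : wp wordProblemP (RAMState.init H r₁ r₂) fun s k =>
      k ≤ 700000 * ((t₁.size + t₂.size) * (Nat.log 2 (t₁.size + t₂.size) + 1) ^ 2) ∧
      (OCBSLEq t₁ t₂ → s.reg 0 = 1) ∧ (¬ OCBSLEq t₁ t₂ → s.reg 0 = 0) := by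
  obtain ⟨N, hN⟩ : ∃ N, N = t₁.size + t₂.size := ⟨_, rfl⟩
  have hs1 : 1 ≤ t₁.size := by cases t₁ <;> simp [BTerm.size]
  have hpow := Nat.le_two_pow_log N
  have htime := Nat.mul_log_le N (by omega)
  rw [← hN]
  obtain ⟨D, hDe⟩ : ∃ D, D = Nat.log 2 N + 8 := ⟨_, rfl⟩
  rw [← hDe] at hpow htime
  have hD : 1 ≤ D := by omega
  obtain ⟨n₁, hn₁, hP₁⟩ := h₁.produces (D := D) hD
  obtain ⟨n₂, hn₂, hP₂⟩ := h₂.produces (D := D) hD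
  simp only [wordProblemP, wp_block_cons]
  refine (wp_startP H r₁ r₂).mono ?_
  rintro s1 k1 - ⟨hk1, h1, in1, fp1, t1, vp1, q1, q2⟩
  rw [wp_store]
  refine wp.mono (p := .store aWS _ _) (Q := fun s' k => k ≤ 10 ∧
    s'.arr aWS = Function.update (Function.update (s1.arr aWS) 0 (r₁ + 2)) 1 (r₂ + 2)) ?_ ?_
  · simp [q1, q2]
  rintro s2 k2 f2 ⟨hk2, ws2⟩
  have ff : Frame (.store aWS (.const 0) (.const 0)) s1 s2 := by
    refine ⟨fun x hx => ?_, fun a ha => ?_⟩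
    · exact (f2.reg x (by simp [RAMProg.regs])).trans (by simp)
    · have ha' : a ≠ aWS := by simpa [RAMProg.arrs] using ha
      exact (f2.arr a (by simpa [RAMProg.arrs] using ha')).trans (by simp [ha'])
  have st2 : Step s1 ∅ (fun _ => 0) s2 ∅ (fun _ => 0) :=
    .of_frame h1 ff (by decide) (.frame ff (by decide))
  have hreg2 : ∀ x, s2.reg x = s1.reg x := fun x => ff.reg x (by simp [RAMProg.regs])
  have in2 : s2.arr aIn = H := (ff.arr _ (by decide)).trans in1
  rw [wp_assign]
  have st3 := st2.trans (.setReg st2.heap (x := rSP) ((RAMExpr.const 2).val s2) (by decide))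
  -- The item of the second term is on top, so this term is evaluated first and its value ends up
  -- below the other one.
  obtain ⟨s4, V, c, m, k4, hI, hT, hk4⟩ := hP₂ _ _ _ 1 0 st3.heap
    (by simpa using in2) (by simp) (by
      intro i hi
      obtain rfl : i = 0 := by simpa using hi
      simp [ws2]) (by simp [hreg2, vp1]) (by simp [hreg2, fp1, t1])
    (by simp [hreg2, t1]; omega)
  have hfp := hT.fp
  have ht4 := hT.t
  simp [hreg2, fp1, t1] at hfp ht4
  obtain ⟨s5, V5, c5, m5, k5, hI5, hT5, hk5⟩ := hP₁ s4 V c 0 1 hT.step.heap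
    (by rw [hI.frame.arr _ (by decide)]; simpa using in2) hT.sp (by
      intro i hi
      obtain rfl : i = 0 := by simpa using hi
      have := hT.ws 0 (by omega)
      simpa [ws2] using this) hT.vp (by omega) (by omega)
  have hfp5 := hT5.fp
  have ht5 := hT5.t
  have hv1 : IsVal s5 V5 c5 (s5.arr aVS 0) (s5.arr aVR 0) (t₂.eval FreeB.gen) m := by
    rw [hT5.vs 0 (by omega), hT5.vr 0 (by omega)]
    exact hT.val.step hT5.step
  refine ⟨s5, _, (hI.trans hI5).run hT5.sp, ?_⟩
  refine (wp_addrP hT5.step.heap hT5.vp hT5.val hD (by omega)).mono ?_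
  rintro s6 k6 f6 ⟨V6, c6, st6, ha6, hk6, hfp6, hvp6⟩
  rw [wp_assign]
  have st7 := Step.setReg st6.heap (x := rLab) ((RAMExpr.reg rItem).val s6) (by decide)
  have hv7 := (hv1.step st6).step st7
  refine (wp_addrP (v := 0) (m := m) (X := t₂.eval FreeB.gen) st7.heap ?_ ?_ hD ?_).mono ?_
  · simpa using hvp6
  · simpa [f6.arr aVS (by decide), f6.arr aVR (by decide)] using hv7
  · simp
    omega
  rintro s8 k8 f8 ⟨V8, c8, st8, ha8, hk8, -⟩
  -- Atoms are never moved, so the first address stays valid while the second normal form is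
  -- written.
  have ha6' := (ha6.step st7).step st8
  have hlab : s8.reg rLab = s6.reg rItem := (f8.reg _ (by decide)).trans (by simp)
  simp only [wp_assign, wp_block_nil]
  have hiff := ha6'.eq_iff st8.heap ha8
  rw [ocbslEq_iff_eval, ← hiff]
  refine ⟨?_, fun he => ?_, fun he => ?_⟩
  · have e1 : 16000 * D * n₁ + 16000 * D * n₂ + 64000 * D = 80000 * D * N := by
      have : 16000 * D * (n₁ + 2 + (n₂ + 2)) = 16000 * D * (5 * N) := by rw [hn₁, hn₂, hN]; ring
      rw [show 80000 * D * N = 16000 * D * (5 * N) by ring, ← this]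
      ring
    have e2 : 1600 * D * m = 2 * (800 * D * m) := by ring
    have e3 : 1600 * D * m5 = 2 * (800 * D * m5) := by ring
    simp only [RAMExpr.cost]
    omega
  · simp [hlab, he, eqN]
  · simp [hlab, he, eqN]

/-- A program that runs in time `O(n log² n)` does so with polynomially bounded words. -/
theorem exists_exec {P : RAMProg} (hP : P.Lin) (K : ℕ) : ∃ C, K ≤ C ∧ ∀ (n W k : ℕ)
    (s s' : RAMState), 1 ≤ n → s.Le (W + 1) → Run P s s' k →
      k ≤ K * (n * (Nat.log 2 n + 1) ^ 2) → RAMExec ((n + W + 2) ^ C) P s s' k := by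
  -- With `b = n + W + 2` the time is at most `K * b ^ 3`, so words written to memory are at most `G
  -- * b ^ 3`, and `G ≤ b ^ G` turns this into a power of `b`.
  obtain ⟨G, hG⟩ : ∃ G, G = 1 + P.csum + P.csum * K := ⟨_, rfl⟩
  -- The summand `K` only ensures `K ≤ C`, so that one constant serves for both time and words.
  refine ⟨(G + 3) * P.deg + K, by omega, fun n W k s s' hn hs hr hk => ?_⟩
  refine (hr.exec hP le_rfl le_rfl hs (by omega) ?_).1
  obtain ⟨b, hb⟩ : ∃ b, b = n + W + 2 := ⟨_, rfl⟩
  rw [← hb]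
  have hlog : Nat.log 2 n + 1 ≤ n := Nat.log_lt_self 2 (by omega)
  have hkb : k ≤ K * b ^ 3 := by
    refine hk.trans (Nat.mul_le_mul_left _ ?_)
    calc n * (Nat.log 2 n + 1) ^ 2 ≤ b * b ^ 2 :=
          Nat.mul_le_mul (by omega) (Nat.pow_le_pow_left (by omega) 2)
      _ = b ^ 3 := by ring
  have hb3 : b + 1 ≤ b ^ 3 := by
    have h3 : 3 * 3 * b ≤ b * b * b :=
      Nat.mul_le_mul_right _ (Nat.mul_le_mul (by omega) (by omega))
    rw [show b ^ 3 = b * b * b by ring]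
    omega
  have hGb : G ≤ b ^ G := (Nat.lt_two_pow_self).le.trans (Nat.pow_le_pow_left (by omega) G)
  have hmain : W + 1 + k * P.csum + P.csum + 2 ≤ b ^ (G + 3) := by
    have h1 : k * P.csum ≤ K * b ^ 3 * P.csum := Nat.mul_le_mul_right _ hkb
    have h2 : P.csum ≤ P.csum * b ^ 3 := Nat.le_mul_of_pos_right _ (by omega)
    calc W + 1 + k * P.csum + P.csum + 2 ≤ b ^ 3 + K * b ^ 3 * P.csum + P.csum * b ^ 3 := by omega
      _ = G * b ^ 3 := by rw [hG]; ring
      _ ≤ b ^ G * b ^ 3 := Nat.mul_le_mul_right _ hGb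
      _ = b ^ (G + 3) := (pow_add _ _ _).symm
  calc (W + 1 + k * P.csum + P.csum + 2) ^ P.deg ≤ (b ^ (G + 3)) ^ P.deg :=
        Nat.pow_le_pow_left hmain _
    _ = b ^ ((G + 3) * P.deg) := (pow_mul _ _ _).symm
    _ ≤ _ := Nat.pow_le_pow_right (by omega) (by omega)

theorem RAMState.init_le {H : ℕ → ℕ} {r₀ r₁ W : ℕ} (h₀ : r₀ ≤ W) (h₁ : r₁ ≤ W)
    (hH : ∀ i, H i ≤ W) : (RAMState.init H r₀ r₁).Le (W + 1) := by
  refine ⟨fun x => ?_, fun a i => ?_⟩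
  · simp only [RAMState.init]
    split_ifs <;> omega
  · simp only [RAMState.init]
    split_ifs
    · exact (hH i).trans (Nat.le_succ W)
    · omega

theorem normalFormP_lin : normalFormP.Lin := by
  simp only [RAMProg.Lin, RAMProg.block, normalFormP, startP, bodyP, evP, fetchP, pushP,
    pushItemP, varP, newVarP, negExpP, supExpP, negOpP, joinOpP, loadValsP, storeValP,
    joinP, negnegP, negnegLeP, posnegP, swapP, concatP, leafP, addrP, sealP, checkP, checkAtomP,
    collectP, collectStepP, emitAtomP, emitP, insertP, ascendP, descendP, consP]
  repeat' constructor

theorem wordProblemP_lin : wordProblemP.Lin := by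
  simp only [RAMProg.Lin, RAMProg.block, wordProblemP, startP, bodyP, evP, fetchP, pushP,
    pushItemP, varP, newVarP, negExpP, binExpP, negOpP, joinOpP, loadValsP, storeValP,
    joinP, negnegP, negnegLeP, posnegP, swapP, concatP, leafP, addrP, sealP, checkP, checkAtomP,
    collectP, collectStepP, emitAtomP, emitP, insertP, ascendP, descendP, consP]
  repeat' constructor

theorem mainTheorem1 :
    (∀ t : JTerm, t.Proper →
      ∃ u, IsNormalFormOf u t ∧ ∀ u', IsNormalFormOf u' t → CommEq u u') ∧
    (∀ (t₁ t₂ : BTerm) (u₁ u₂ : JTerm), IsNormalFormOf u₁ t₁.toJTerm →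
      IsNormalFormOf u₂ t₂.toJTerm → (OCBSLEq t₁ t₂ ↔ CommEq u₁ u₂)) ∧
    (∃ (P : RAMProg) (C : ℕ), ComputesNormalForm P C) ∧
    (∃ (Q : RAMProg) (C : ℕ), DecidesWordProblem Q C) := by
  refine ⟨fun t ht => ?_, fun t₁ t₂ u₁ u₂ => ocbslEq_iff_commEq, ?_, ?_⟩
  · obtain ⟨u, hu⟩ := exists_isNormalFormOf t
    exact ⟨u, hu, fun u' hu' => hu.commEq ht hu'⟩
  · obtain ⟨C, hKC, hC⟩ := exists_exec normalFormP_lin 700000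
    refine ⟨normalFormP, C, fun t H r W ht h hr hH => ?_⟩
    obtain ⟨s', k, hrun, hk, hu⟩ := run_normalFormP ht h
    exact ⟨s', k, hC _ _ _ _ _ t.size_pos (RAMState.init_le hr (Nat.zero_le _) hH) hrun hk,
      hk.trans (Nat.mul_le_mul_right _ hKC), hu⟩
  · obtain ⟨C, hKC, hC⟩ := exists_exec wordProblemP_lin 700000
    refine ⟨wordProblemP, C, fun t₁ t₂ H r₁ r₂ W h₁ h₂ hr₁ hr₂ hH => ?_⟩
    obtain ⟨s', k, hrun, hk, hu⟩ := run_wordProblemP h₁ h₂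
    have hs : 1 ≤ t₁.size := by cases t₁ <;> simp [BTerm.size]
    exact ⟨s', k, hC _ _ _ _ _ (by omega) (RAMState.init_le hr₁ hr₂ hH) hrun hk,
      hk.trans (Nat.mul_le_mul_right _ hKC), hu⟩
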